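/- **Setting.** Let $\varepsilon_1,\dots,\varepsilon_4$ be the standard basis of $\mathbb R^4$, $\Phi=\{\pm\varepsilon_i\pm\varepsilon_j : i\ne j\}$ the root system $D_4$ with simple system $\pi$: $\alpha_1=\varepsilon_1-\varepsilon_2$, $\alpha_2=\varepsilon_2-\varepsilon_3$, $\alpha_3=\varepsilon_3-\varepsilon_4$, $\alpha_4=\varepsilon_3+\varepsilon_4$, positive roots $\Phi^+$ and Weyl group $W=W(D_4)$ generated by the reflections $\tau_\alpha$, $\alpha\in\Phi$; write $\tau_i=\tau_{\alpha_i}$, $s(w)=(-1)^{l(w)}$, and $abcd$ for $a\alpha_1+b\alpha_2+c\alpha_3+d\alpha_4$. Let $K$ be a field of characteristic $0$. For subgroups $H,H'\le W$ let $M=K[W/H]$ be the permutation module on the left cosets $\{wH\}$ (tabloids), $\kappa_{H'}=\sum_{\sigma\in H'}s(\sigma)\sigma$, $e=\kappa_{H'}\{H\}$, and let the generalized Specht module $S^{H,H'}\subseteq M$ be the span of all $we$, $w\in W$. For sets of roots $J,J'$ let $W(J)$ be the group generated by $\tau_\alpha$, $\alpha\in J$, and $S^{J,J'}=S^{W(J),W(J')}$,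 $e_{J,J'}=e$. For simple systems $J,J'\subset\Phi^+$ of additively closed subsystems $\Psi,\Psi'$ of $\Phi$ with $\Psi'\subseteq\Phi\setminus\Psi$, the pair $\{J,J'\}$ is a *useful system* if $W(J)\cap W(J')=1$ and $W(\Psi^\perp)\cap W(\Psi'^\perp)=1$, where $\Psi^\perp$ is the set of roots orthogonal to $\Psi$. It is a *good system* if moreover, for every $d\in W$ with $dJ\subset\Phi^+$ and $d\Psi\cap\Psi'=\emptyset$, the tabloid $\{dW(J)\}$ has nonzero coefficient in $e_{J,J'}$. An *extended subsystem*, with simple system $J$ and group $W(J)\le W$ (a *Steinberg–Weyl subgroup*), is one obtained, up to conjugacy, from $\pi$ and $W$ by repeatedly adding the negative of the highest root of a component to the Dynkin diagram and deleting at least one node of the extended component, passing to the dual system, and folding along a diagram symmetry: if $\tau$ is the isometry of $\operatorname{span}J$ inducing the symmetry, one takes the projections of $J$ to the fixed space of $\tau$ (one from each set of positive multiples) and the elements of the group that commute with $\tau$ on $\operatorname{span}J$. For Steinberg–Weyl subgroups $H,H'$, $H'$ is a *useful dual* of $H$ if $H\cap H'=1$, and a *good dual* if moreover $\kappa_{H'}\{wH\}\ne0$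 implies that $\{wH\}$ has nonzero coefficient in $\kappa_{H'}\{H\}$. **Statement.** The elements $1$, $\tau_2$, $\tau_1\tau_2$, $\tau_1\tau_3\tau_2$, $\tau_1\tau_2\tau_1\tau_3\tau_2\tau_1$, $\tau_1\tau_4\tau_2$, $\tau_1\tau_2\tau_1\tau_4\tau_2\tau_1$, $\tau_3\tau_4\tau_2$, $\tau_2\tau_3\tau_2\tau_4\tau_2\tau_3$, $\tau_1\tau_3\tau_4\tau_2$, $\tau_1\tau_2\tau_1\tau_3\tau_2\tau_1\tau_4\tau_2\tau_1\tau_3\tau_2\tau_4$, $\tau_2\tau_1\tau_3\tau_4\tau_2$, $\tau_2\tau_1\tau_4\tau_2\tau_1\tau_3$ represent the conjugacy classes $C_1,\dots,C_{13}$ of $W$, each exactly once. Let $\chi_1,\dots,\chi_{13}$ be the class functions $$\begin{array}{r|rrrrrrrrrrrrr} &C_1&C_2&C_3&C_4&C_5&C_6&C_7&C_8&C_9&C_{10}&C_{11}&C_{12}&C_{13}\\\hline \chi_1&1&1&1&1&1&1&1&1&1&1&1&1&1\\ \chi_2&1&-1&1&-1&1&-1&1&-1&1&1&1&-1&1\\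 \chi_3&2&0&-1&0&2&0&2&0&2&-1&2&0&2\\ \chi_4&3&1&0&1&3&-1&-1&-1&-1&0&3&1&-1\\ \chi_5&3&1&0&-1&-1&-1&-1&1&3&0&3&1&-1\\ \chi_6&3&-1&0&-1&3&1&-1&1&-1&0&3&-1&-1\\ \chi_7&3&-1&0&1&-1&1&-1&-1&3&0&3&-1&-1\\ \chi_8&3&-1&0&1&-1&-1&3&1&-1&0&3&-1&-1\\ \chi_9&3&1&0&-1&-1&1&3&-1&-1&0&3&1&-1\\ \chi_{10}&4&-2&1&0&0&0&0&0&0&-1&-4&2&0\\ \chi_{11}&4&2&1&0&0&0&0&0&0&-1&-4&-2&0\\ \chi_{12}&6&0&0&0&-2&0&-2&0&-2&0&6&0&2\\ \chi_{13}&8&0&-1&0&0&0&0&0&0&1&-8&0&0 \end{array}$$ 1. For each of the following pairs, $J$ and $J'$ are simple systems of extended subsystems, $\{J,J'\}$ is a good system, $W(J')$ is a good dual of $W(J)$, and $S^{J,J'}$ is irreducible with the character given: $$\begin{array}{l|l|l} J&J'&\text{character}\\\hline 1000,0100,0010\ (A_3)&1101,0111\ (2A_1)&\chi_4\\ 1000,0100,0001\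 (A_3')&1110,0111\ (2A_1')&\chi_9\\ 0100,0010,0001\ (A_3'')&1110,1101\ (2A_1'')&\chi_5\\ 1000,1211,0010,0001\ (4A_1)&1100,0110,0101\ (3A_1)&\chi_3\\ 1000,0010,0001\ (3A_1)&1111,0100\ (A_2)&\chi_{13}\\ 1000,0100\ (A_2)&1110,1101,0111\ (3A_1)&\chi_{13}\\ 1000,0010\ (2A_1)&0001,1100,0110\ (A_3)&\chi_6\\ 1000,0001\ (2A_1')&0010,0101,1100\ (A_3')&\chi_8\\ 0010,0001\ (2A_1'')&1000,0101,0110\ (A_3'')&\chi_7\\ 1000,0100,0010,0001\ (D_4)&\emptyset&\chi_1\\ \emptyset&1000,0100,0010,0001\ (D_4)&\chi_2 \end{array}$$ 2. In the case $J_1=\{1000,0100,0010\}$, $J_1'=\{1101,0111\}$, the tabloids $t_w=\{wW(J_1)\}$ for $w=1$, $\tau_4$, $\tau_2\tau_4$, $\tau_1\tau_2\tau_4$, $\tau_3\tau_2\tau_4$, $\tau_1\tau_3\tau_2\tau_4$, $\tau_2\tau_1\tau_3\tau_2\tau_4$, $\tau_4\tau_2\tau_1\tau_3\tau_2\tau_4$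 are all the tabloids, without repetition. With $u=t_{\tau_1\tau_2\tau_4}+t_{\tau_3\tau_2\tau_4}$ and $e=e_{J_1,J_1'}$ one has $e=t_1-u+t_{\tau_4\tau_2\tau_1\tau_3\tau_2\tau_4}$, $\tau_4e=t_{\tau_4}-u+t_{\tau_2\tau_1\tau_3\tau_2\tau_4}$, $\tau_2\tau_4e=t_{\tau_2\tau_4}-u+t_{\tau_1\tau_3\tau_2\tau_4}$. These three elements form a basis of $S^{J_1,J_1'}$; $\tau_2$ fixes the first and interchanges the other two. 3. Let $W(G_2)=\langle\tau_2,\ \tau_1\tau_3\tau_4\rangle$. It is the Steinberg–Weyl subgroup of an extended subsystem with simple system $\{0100,\frac13(1000+0010+0001)\}$. For $J'=\{0001,0110\}$ ($A_2$), $W(J')$ is a good dual of $W(G_2)$ and $S^{W(G_2),W(J')}$ is irreducible with character $\chi_{12}$. 4. For $J_1,J_1'$ as in 2 and $J_2'=\{1101\}$ ($A_1$), $W(J_1')$ is a good dual and $W(J_2')$ a useful dual of $W(J_1)$, $W(J_2')$ is a Steinberg–Weyl subgroup of $W(J_1')$, $S^{J_1,J_1'}\subseteq S^{J_1,J_2'}$,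 and $S^{J_1,J_2'}/S^{J_1,J_1'}$ is irreducible with character $\chi_{11}$. 5. Let $W(B_3)=\langle\tau_2,\ \tau_4,\ \tau_{1000}\tau_{1211}\rangle$. It is the Steinberg–Weyl subgroup of an extended subsystem with simple system $\{0100,0001,\frac12(1000-1211)\}$. For $J=\{1000\}$ ($A_1$) and $J'=\{0100,0001,0010\}$ ($A_3$), $W(J')$ is a useful dual and $W(B_3)$ a good dual of $W(J)$, $W(J')$ is a Steinberg–Weyl subgroup of $W(B_3)$, $S^{W(J),W(B_3)}\subseteq S^{W(J),W(J')}$, and $S^{W(J),W(J')}/S^{W(J),W(B_3)}$ is irreducible with character $\chi_{10}$. 6. Every irreducible $KW$-module is isomorphic to one of the modules in 1, 3, 4, 5, and its character is exactly one of $\chi_1,\dots,\chi_{13}$. -/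

import Mathlib

noncomputable section

namespace WeylSpecht

open scoped NNReal RealInnerProductSpace

/-! ## Reflections, Weyl groups, subsystems -/

section RootSystems

variable {E : Type*} [NormedAddCommGroup E] [InnerProductSpace ℝ E]

/-- The reflection `τ_α` of a Euclidean space in the hyperplane orthogonal to `α`. -/
def refl (α : E) : E ≃ₗᵢ[ℝ] E := (ℝ ∙ α)ᗮ.reflection

/-- The group `W(Φ)` of isometries generated by the `τ_α`, `α ∈ Φ`. -/
def weyl (Φ : Set E) : Subgroup (E ≃ₗᵢ[ℝ] E) := Subgroup.closure (refl '' Φ)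

/-- The subgroup `W(J)` of `W(Φ)` generated by the reflections `τ_α`, `α ∈ J`. -/
def reflSubgroup (Φ J : Set E) : Subgroup (weyl Φ) :=
  Subgroup.closure {w | ∃ α ∈ J, (w : E ≃ₗᵢ[ℝ] E) = refl α}

/-- The length of `w` with respect to the simple system `π`: the least number of factors in an
expression of `w` as a product of simple reflections. -/
def length (Φ π : Set E) (w : weyl Φ) : ℕ :=
  sInf {n | ∃ l : List (weyl Φ),
    (∀ x ∈ l, ∃ α ∈ π, (x : E ≃ₗᵢ[ℝ] E) = refl α) ∧ l.prod = w ∧ l.length = n}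

/-- The sign `s(w) = (-1) ^ l(w)`. -/
def sign (Φ π : Set E) (w : weyl Φ) : ℤ := (-1) ^ length Φ π w

/-- The positive roots: the roots that are nonnegative combinations of simple roots. -/
def positive (Φ π : Set E) : Set E := {α ∈ Φ | α ∈ Submodule.span ℝ≥0 π}

/-- An additively closed subsystem `Ψ` of a root system `Φ`. (A subset of a root system is a root
system in its span as soon as it is stable under its own reflections.) -/
def IsSubsystem (Φ Ψ : Set E) : Prop :=
  Ψ ⊆ Φ ∧ (∀ α ∈ Ψ, ∀ β ∈ Ψ, refl α β ∈ Ψ) ∧ ∀ α ∈ Ψ, ∀ β ∈ Ψ, α + β ∈ Φ → α + β ∈ Ψ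

/-- `J` is a simple system of `Ψ`. -/
def IsSimpleSystem (Ψ J : Set E) : Prop :=
  J ⊆ Ψ ∧ LinearIndependent ℝ (Subtype.val : J → E) ∧
    ∀ α ∈ Ψ, α ∈ Submodule.span ℝ≥0 J ∨ -α ∈ Submodule.span ℝ≥0 J

/-- The subsystem `Ψ = W(J) J` which has `J` as simple system. -/
def rootsOf (Φ J : Set E) : Set E :=
  {v | ∃ w ∈ reflSubgroup Φ J, ∃ j ∈ J, v = (w : E ≃ₗᵢ[ℝ] E) j}

/-- The largest subsystem `Ψ^⊥` of `Φ` orthogonal to `Ψ`. -/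
def orth (Φ Ψ : Set E) : Set E := {α ∈ Φ | ∀ β ∈ Ψ, ⟪α, β⟫ = 0}

/-- The distinguished coset representatives `D_Ψ = {w | w j ∈ Φ⁺ for all j ∈ J}`. -/
def distinguished (Φ π J : Set E) : Set (weyl Φ) :=
  {w | ∀ j ∈ J, (w : E ≃ₗᵢ[ℝ] E) j ∈ positive Φ π}

/-- The pair `{J, J'}` is a useful system in `Φ`. -/
structure IsUsefulSystem (Φ π J J' : Set E) : Prop where
  subsystem_left : IsSubsystem Φ (rootsOf Φ J)
  simple_left : IsSimpleSystem (rootsOf Φ J) J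
  positive_left : J ⊆ positive Φ π
  subsystem_right : IsSubsystem Φ (rootsOf Φ J')
  simple_right : IsSimpleSystem (rootsOf Φ J') J'
  positive_right : J' ⊆ positive Φ π
  disjoint : rootsOf Φ J' ⊆ Φ \ rootsOf Φ J
  inf_eq_bot : reflSubgroup Φ J ⊓ reflSubgroup Φ J' = ⊥
  orth_inf_eq_bot :
    reflSubgroup Φ (orth Φ (rootsOf Φ J)) ⊓ reflSubgroup Φ (orth Φ (rootsOf Φ J')) = ⊥

/-! ## Extended subsystems and Steinberg–Weyl subgroups -/

variable [FiniteDimensional ℝ E]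

/-- `IsExtendedSubsystem Φ J₀ G₀ J G`: the simple system `J` and the group `G = W(J) ≤ W(Φ)`, which
acts on `span J` as the reflection group with simple roots `J`, are obtained (up to conjugacy) from
`J₀` and `G₀ = W(J₀)` by repeatedly extending the Dynkin diagram and deleting nodes, passing to the
dual system, and folding along a symmetry of the Dynkin diagram (Steinberg's construction). -/
inductive IsExtendedSubsystem (Φ : Set E) (J₀ : Set E) (G₀ : Subgroup (weyl Φ)) :
    Set E → Subgroup (weyl Φ) → Prop
  | base : IsExtendedSubsystem Φ J₀ G₀ J₀ G₀
  | conj {J : Set E} {G : Subgroup (weyl Φ)} (h : IsExtendedSubsystem Φ J₀ G₀ J G)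
      (w : weyl Φ) (hw : w ∈ G₀) :
      IsExtendedSubsystem Φ J₀ G₀ ((w : E ≃ₗᵢ[ℝ] E) '' J) (G.map (MulAut.conj w).toMonoidHom)
  /-- `C` is a connected component of the diagram `J`, and `a` is the highest root of the
  corresponding component of the root system `G J`; the node `-a` is added and one or more nodes
  of the extended component (and any other nodes) are deleted, which leaves `K`. -/
  | delete {J : Set E} {G : Subgroup (weyl Φ)} (h : IsExtendedSubsystem Φ J₀ G₀ J G)
      (C : Set E) (hC : C ⊆ J) (hCorth : ∀ α ∈ C, ∀ β ∈ J \ C, ⟪α, β⟫ = 0)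
      (a : E) (ha : ∃ g ∈ G, ∃ j ∈ J, a = (g : E ≃ₗᵢ[ℝ] E) j) (haC : a ∈ Submodule.span ℝ C)
      (hmax : ∀ g ∈ G, ∀ j ∈ J, (g : E ≃ₗᵢ[ℝ] E) j ∈ Submodule.span ℝ C →
        a - (g : E ≃ₗᵢ[ℝ] E) j ∈ Submodule.span ℝ≥0 C)
      (K : Set E) (hK : K ⊆ insert (-a) J) (hdel : ¬ insert (-a) C ⊆ K) :
      IsExtendedSubsystem Φ J₀ G₀ K
        (Subgroup.closure {g | g ∈ G ∧ ∃ α ∈ K, ∀ v ∈ Submodule.span ℝ J,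
          (g : E ≃ₗᵢ[ℝ] E) v = refl α v})
  | dual {J : Set E} {G : Subgroup (weyl Φ)} (h : IsExtendedSubsystem Φ J₀ G₀ J G) :
      IsExtendedSubsystem Φ J₀ G₀ ((fun α : E => (2 / ‖α‖ ^ 2) • α) '' J) G
  /-- `τ` is the isometry which permutes `J` up to positive multiples, according to a symmetry of
  the Dynkin diagram. The new group consists of the elements of `G` that commute with `τ` on
  `span J`. The new simple roots are the projections of the elements of `J` to the subspace fixed
  by `τ` in `span J`, one being kept out of each set of positive multiples. -/
  | fold {J : Set E} {G : Subgroup (weyl Φ)} (h : IsExtendedSubsystem Φ J₀ G₀ J G)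
      (τ : E ≃ₗᵢ[ℝ] E) (hτ : ∀ r ∈ J, ∃ c : ℝ, 0 < c ∧ ∃ r' ∈ J, τ r = c • r')
      (V₁ : Submodule ℝ E) (hV₁ : ∀ v, v ∈ V₁ ↔ v ∈ Submodule.span ℝ J ∧ τ v = v)
      (J₁ : Set E) (hJ₁ : J₁ ⊆ (fun r => V₁.starProjection r) '' J)
      (hJ₁' : ∀ r ∈ J, ∃! s, s ∈ J₁ ∧ ∃ c : ℝ, 0 < c ∧ V₁.starProjection r = c • s)
      (G₁ : Subgroup (weyl Φ))
      (hG₁ : ∀ g, g ∈ G₁ ↔ g ∈ G ∧ ∀ v ∈ Submodule.span ℝ J,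
        (g : E ≃ₗᵢ[ℝ] E) (τ v) = τ ((g : E ≃ₗᵢ[ℝ] E) v)) :
      IsExtendedSubsystem Φ J₀ G₀ J₁ G₁

/-- Steinberg–Weyl subgroups of `W(Φ)`. -/
def IsSWSubgroup (Φ π : Set E) (H : Subgroup (weyl Φ)) : Prop :=
  ∃ J, IsExtendedSubsystem Φ π ⊤ J H

/-- `H'` is a useful dual of `H`. -/
def IsUsefulDual (Φ π : Set E) (H H' : Subgroup (weyl Φ)) : Prop :=
  IsSWSubgroup Φ π H ∧ IsSWSubgroup Φ π H' ∧ H ⊓ H' = ⊥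

end RootSystems

/-! ## Generalized Specht modules -/

section Specht

variable (K : Type*) [Field K] {G : Type*} [Group G]

/-- The permutation module `M^Δ` on the tabloids, i.e. the left cosets of `H = W(J)`. -/
abbrev tabloidRep (H : Subgroup G) : Representation K G (MonoidAlgebra K (G ⧸ H)) :=
  Representation.ofMulAction K G (G ⧸ H)

variable {K} in
/-- The tabloid `{w H}`, as a basis element of `M^Δ`. -/
abbrev tabloid {H : Subgroup G} (w : G) : MonoidAlgebra K (G ⧸ H) :=
  MonoidAlgebra.single (w : G ⧸ H) 1

/-- The action of `κ_{H'} = ∑ σ ∈ H', s(σ) σ` on `M^Δ` (used for finite `H'`). -/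
def kappa (s : G → ℤ) (H H' : Subgroup G) : Module.End K (MonoidAlgebra K (G ⧸ H)) :=
  ∑ᶠ σ : H', ((s σ : ℤ) : K) • tabloidRep K H (σ : G)

/-- The generalized polytabloid `e = κ_{H'} {H}`. -/
def polytabloid (s : G → ℤ) (H H' : Subgroup G) : MonoidAlgebra K (G ⧸ H) :=
  kappa K s H H' (tabloid 1)

/-- The generalized Specht module: the span of the polytabloids
`w e = κ_{w H' w⁻¹} {w H}`, `w ∈ G`. -/
def specht (s : G → ℤ) (H H' : Subgroup G) : Subrepresentation (tabloidRep K H) where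
  toSubmodule := Submodule.span K (Set.range fun w : G => tabloidRep K H w (polytabloid K s H H'))
  apply_mem_toSubmodule g v hv := by
    induction hv using Submodule.span_induction with
    | mem x hx =>
      obtain ⟨w, rfl⟩ := hx
      refine Submodule.subset_span ⟨g * w, ?_⟩
      simp [map_mul]
    | zero => simp
    | add x y _ _ hx hy => simpa using Submodule.add_mem _ hx hy
    | smul a x _ hx => simpa using Submodule.smul_mem _ a hx

variable {K}

/-- The module `σ₁ / σ₂` for submodules `σ₂ ⊆ σ₁` of a `KG`-module. -/
def subquotient {M : Type*} [AddCommGroup M] [Module K M] {ρ : Representation K G M}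
    (σ₁ σ₂ : Subrepresentation ρ) :
    Representation K G (σ₁.toSubmodule ⧸ σ₂.toSubmodule.submoduleOf σ₁.toSubmodule) :=
  σ₁.toRepresentation.quotient _ fun g _ hv => σ₂.apply_mem_toSubmodule g hv

end Specht

section Good

variable (K : Type*) [Field K] {E : Type*} [NormedAddCommGroup E] [InnerProductSpace ℝ E]

/-- A useful system is good if every tabloid `{d J}`, `d ∈ D_Ψ`, with `d Ψ ∩ Ψ' = ∅` appears with
nonzero coefficient in `e_{J,J'}`. -/
def IsGoodSystem (Φ π J J' : Set E) : Prop :=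
  IsUsefulSystem Φ π J J' ∧
    ∀ d ∈ distinguished Φ π J,
      ((d : E ≃ₗᵢ[ℝ] E) '' rootsOf Φ J) ∩ rootsOf Φ J' = ∅ →
      (polytabloid K (sign Φ π) (reflSubgroup Φ J) (reflSubgroup Φ J')).coeff (d : weyl Φ ⧸ _) ≠ 0

/-- A useful dual `H'` of `H` is good if every tabloid `{w H}` with `κ_{H'} {w H} ≠ 0` appears in
`e = κ_{H'} {H}`. -/
def IsGoodDual [FiniteDimensional ℝ E] (Φ π : Set E) (H H' : Subgroup (weyl Φ)) : Prop :=
  IsUsefulDual Φ π H H' ∧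
    ∀ w : weyl Φ, kappa K (sign Φ π) H H' (tabloid w) ≠ 0 →
      (polytabloid K (sign Φ π) H H').coeff (w : weyl Φ ⧸ H) ≠ 0

end Good

/-! ## The root system `D₄` -/

section D4

abbrev V4 : Type := EuclideanSpace ℝ (Fin 4)

/-- The standard basis of `ℝ⁴`; `ε 0, …, ε 3` are `ε₁, …, ε₄`. -/
def ε (i : Fin 4) : V4 := EuclideanSpace.single i 1

/-- The roots `± ε_i ± ε_j`, `i ≠ j`. -/
def Φ : Set V4 :=
  {v | ∃ i j, i ≠ j ∧ (v = ε i + ε j ∨ v = ε i - ε j ∨ v = -ε i + ε j ∨ v = -ε i - ε j)}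

/-- The simple roots `α₁ = ε₁ - ε₂`, `α₂ = ε₂ - ε₃`, `α₃ = ε₃ - ε₄`, `α₄ = ε₃ + ε₄`. -/
def α : Fin 4 → V4 := ![ε 0 - ε 1, ε 1 - ε 2, ε 2 - ε 3, ε 2 + ε 3]

def π : Set V4 := Set.range α

/-- The vector `a b c d = a α₁ + b α₂ + c α₃ + d α₄`. -/
def rt (a b c d : ℝ) : V4 := a • α 0 + b • α 1 + c • α 2 + d • α 3

theorem α_mem (i : Fin 4) : α i ∈ Φ := by
  fin_cases i
  · exact ⟨0, 1, by decide, .inr (.inl rfl)⟩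
  · exact ⟨1, 2, by decide, .inr (.inl rfl)⟩
  · exact ⟨2, 3, by decide, .inr (.inl rfl)⟩
  · exact ⟨2, 3, by decide, .inl rfl⟩

/-- The Weyl group of type `D₄`. -/
abbrev W : Type := weyl Φ

/-- The simple reflections `τ₁, …, τ₄`. -/
def τ (i : Fin 4) : W := ⟨refl (α i), Subgroup.subset_closure ⟨α i, α_mem i, rfl⟩⟩
def τ₁ : W := τ 0
def τ₂ : W := τ 1
def τ₃ : W := τ 2
def τ₄ : W := τ 3

/-- Representatives of the conjugacy classes `C₁, …, C₁₃`. -/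
def classRep : Fin 13 → W := ![
  1, τ₂, τ₁ * τ₂, τ₁ * τ₃ * τ₂, τ₁ * τ₂ * τ₁ * τ₃ * τ₂ * τ₁, τ₁ * τ₄ * τ₂,
  τ₁ * τ₂ * τ₁ * τ₄ * τ₂ * τ₁, τ₃ * τ₄ * τ₂, τ₂ * τ₃ * τ₂ * τ₄ * τ₂ * τ₃,
  τ₁ * τ₃ * τ₄ * τ₂, τ₁ * τ₂ * τ₁ * τ₃ * τ₂ * τ₁ * τ₄ * τ₂ * τ₁ * τ₃ * τ₂ * τ₄,
  τ₂ * τ₁ * τ₃ * τ₄ * τ₂, τ₂ * τ₁ * τ₄ * τ₂ * τ₁ * τ₃]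

/-- The character table: row `i`, column `j` is the value of `χ_{i+1}` on `C_{j+1}`. -/
def charTable : Matrix (Fin 13) (Fin 13) ℤ := !![
  1,  1,  1,  1,  1,  1,  1,  1,  1,  1,  1,  1,  1;
  1, -1,  1, -1,  1, -1,  1, -1,  1,  1,  1, -1,  1;
  2,  0, -1,  0,  2,  0,  2,  0,  2, -1,  2,  0,  2;
  3,  1,  0,  1,  3, -1, -1, -1, -1,  0,  3,  1, -1;
  3,  1,  0, -1, -1, -1, -1,  1,  3,  0,  3,  1, -1;
  3, -1,  0, -1,  3,  1, -1,  1, -1,  0,  3, -1, -1;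
  3, -1,  0,  1, -1,  1, -1, -1,  3,  0,  3, -1, -1;
  3, -1,  0,  1, -1, -1,  3,  1, -1,  0,  3, -1, -1;
  3,  1,  0, -1, -1,  1,  3, -1, -1,  0,  3,  1, -1;
  4, -2,  1,  0,  0,  0,  0,  0,  0, -1, -4,  2,  0;
  4,  2,  1,  0,  0,  0,  0,  0,  0, -1, -4, -2,  0;
  6,  0,  0,  0, -2,  0, -2,  0, -2,  0,  6,  0,  2;
  8,  0, -1,  0,  0,  0,  0,  0,  0,  1, -8,  0,  0]

/-- `ρ` is irreducible with character `χ_n`, `1 ≤ n ≤ 13`. -/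
def Affords {K : Type*} [Field K] {M : Type*} [AddCommGroup M] [Module K M]
    (ρ : Representation K W M) (n : ℕ) : Prop :=
  ρ.IsIrreducible ∧ ∃ i : Fin 13, (i : ℕ) + 1 = n ∧
    ∀ j, ρ.character (classRep j) = ((charTable i j : ℤ) : K)

/-- The reflection subgroup `W(J)` of `W(D₄)`. -/
abbrev WJ (J : Set V4) : Subgroup W := reflSubgroup Φ J

/-- The generalized Specht module for a pair of subgroups of `W(D₄)`. -/
abbrev S (K : Type*) [Field K] (H H' : Subgroup W) : Subrepresentation (tabloidRep K H) :=
  specht K (sign Φ π) H H'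

/-- Rows `J` of the eleven pairs `(J, J')` of simple systems: types
`A₃, A₃', A₃'', 4A₁, 3A₁, A₂, 2A₁, 2A₁', 2A₁'', D₄, ∅`. -/
def rowJ : Fin 11 → Set V4 := ![
  {rt 1 0 0 0, rt 0 1 0 0, rt 0 0 1 0},
  {rt 1 0 0 0, rt 0 1 0 0, rt 0 0 0 1},
  {rt 0 1 0 0, rt 0 0 1 0, rt 0 0 0 1},
  {rt 1 0 0 0, rt 1 2 1 1, rt 0 0 1 0, rt 0 0 0 1},
  {rt 1 0 0 0, rt 0 0 1 0, rt 0 0 0 1},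
  {rt 1 0 0 0, rt 0 1 0 0},
  {rt 1 0 0 0, rt 0 0 1 0},
  {rt 1 0 0 0, rt 0 0 0 1},
  {rt 0 0 1 0, rt 0 0 0 1},
  {rt 1 0 0 0, rt 0 1 0 0, rt 0 0 1 0, rt 0 0 0 1},
  ∅]

/-- Columns `J'` of the eleven pairs `(J, J')`: types
`2A₁, 2A₁', 2A₁'', 3A₁, A₂, 3A₁, A₃, A₃', A₃'', ∅, D₄`. -/
def colJ : Fin 11 → Set V4 := ![
  {rt 1 1 0 1, rt 0 1 1 1},
  {rt 1 1 1 0, rt 0 1 1 1},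
  {rt 1 1 1 0, rt 1 1 0 1},
  {rt 1 1 0 0, rt 0 1 1 0, rt 0 1 0 1},
  {rt 1 1 1 1, rt 0 1 0 0},
  {rt 1 1 1 0, rt 1 1 0 1, rt 0 1 1 1},
  {rt 0 0 0 1, rt 1 1 0 0, rt 0 1 1 0},
  {rt 0 0 1 0, rt 0 1 0 1, rt 1 1 0 0},
  {rt 1 0 0 0, rt 0 1 0 1, rt 0 1 1 0},
  ∅,
  {rt 1 0 0 0, rt 0 1 0 0, rt 0 0 1 0, rt 0 0 0 1}]

/-- The number `n` such that the `r`-th pair affords `χ_n`. -/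
def rowChar : Fin 11 → ℕ := ![4, 9, 5, 3, 13, 13, 6, 8, 7, 1, 2]

/-- Simple system of type `A₃`. -/
def JA3 : Set V4 := {rt 1 0 0 0, rt 0 1 0 0, rt 0 0 1 0}
/-- Simple system of type `2A₁`. -/
def J2A1 : Set V4 := {rt 1 1 0 1, rt 0 1 1 1}
/-- Simple system of type `A₁`, contained in `J2A1`. -/
def JA1 : Set V4 := {rt 1 1 0 1}
/-- Simple system of type `A₂`. -/
def JA2 : Set V4 := {rt 0 0 0 1, rt 0 1 1 0}
/-- Simple system of the extended subsystem `G₂`. -/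
def JG2 : Set V4 := {rt 0 1 0 0, (1 / 3 : ℝ) • (rt 1 0 0 0 + rt 0 0 1 0 + rt 0 0 0 1)}
/-- The Steinberg subgroup `W(G₂)`: the reflection of `span JG2` in the short simple root is
realised by `τ₁ τ₃ τ₄`. -/
def WG2 : Subgroup W := Subgroup.closure {τ₂, τ₁ * τ₃ * τ₄}
/-- Simple system of type `A₁`. -/
def JA1' : Set V4 := {rt 1 0 0 0}
/-- Simple system of type `A₃`. -/
def JA3' : Set V4 := {rt 0 1 0 0, rt 0 0 0 1, rt 0 0 1 0}
/-- Simple system of the extended subsystem `B₃`, obtained from the part `1000, -1211, 0100, 0001`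
of the extended Dynkin diagram of `D₄` by interchanging `1000` and `-1211`. -/
def JB3 : Set V4 := {rt 0 1 0 0, rt 0 0 0 1, (1 / 2 : ℝ) • (rt 1 0 0 0 - rt 1 2 1 1)}
/-- The Steinberg subgroup `W(B₃)`: the reflection of `span JB3` in the short simple root is
realised by the product of the reflections in the orthogonal roots `1000` and `1211`. -/
def WB3 : Subgroup W :=
  Subgroup.closure {w | w = τ₂ ∨ w = τ₄ ∨
    (w : V4 ≃ₗᵢ[ℝ] V4) = refl (rt 1 0 0 0) * refl (rt 1 2 1 1)}

end D4

end WeylSpecht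

end

noncomputable section

namespace WeylSpecht

open scoped NNReal RealInnerProductSpace

set_option linter.unusedSectionVars false
set_option linter.unnecessarySeqFocus false

section SpechtTheory

variable {K : Type*} [Field K] {G : Type*} [Group G] {H : Subgroup G}

theorem tabloidRep_tabloid (x w : G) :
    tabloidRep K H x (tabloid w) = tabloid (x * w) := by
  simp [tabloid]

theorem tabloidRep_coeff (x g : G) (m : MonoidAlgebra K (G ⧸ H)) :
    (tabloidRep K H x m).coeff (g : G ⧸ H) = m.coeff ((x⁻¹ * g : G) : G ⧸ H) := by
  rw [Representation.ofMulAction_def]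
  have h : (g : G ⧸ H) = x • ((x⁻¹ * g : G) : G ⧸ H) := by
    rw [MulAction.Quotient.smul_coe, smul_eq_mul, mul_inv_cancel_left]
  rw [h]
  exact Finsupp.mapDomain_apply (MulAction.injective x) _ _

theorem coeff_ext {m m' : MonoidAlgebra K (G ⧸ H)}
    (h : ∀ g : G, m.coeff (g : G ⧸ H) = m'.coeff (g : G ⧸ H)) : m = m' := by
  ext q
  induction q using QuotientGroup.induction_on with
  | H g => exact h g

open Classical in
theorem tabloid_coeff (w g : G) :
    (tabloid w : MonoidAlgebra K (G ⧸ H)).coeff (g : G ⧸ H) = if w⁻¹ * g ∈ H then 1 else 0 := by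
  simp [tabloid, Finsupp.single_apply, QuotientGroup.eq]

/-- The cyclic submodule of the permutation module generated by `e`. -/
def cyclic (e : MonoidAlgebra K (G ⧸ H)) : Subrepresentation (tabloidRep K H) where
  toSubmodule := Submodule.span K (Set.range fun w : G => tabloidRep K H w e)
  apply_mem_toSubmodule g v hv := by
    induction hv using Submodule.span_induction with
    | mem x hx =>
      obtain ⟨w, rfl⟩ := hx
      refine Submodule.subset_span ⟨g * w, ?_⟩
      simp [map_mul]
    | zero => simp
    | add x y _ _ hx hy => simpa using Submodule.add_mem _ hx hy
    | smul a x _ hx => simpa using Submodule.smul_mem _ a hx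

theorem self_mem_cyclic (e : MonoidAlgebra K (G ⧸ H)) : e ∈ (cyclic e).toSubmodule :=
  Submodule.subset_span ⟨1, by simp⟩

theorem cyclic_le {e : MonoidAlgebra K (G ⧸ H)} {σ : Subrepresentation (tabloidRep K H)}
    (h : e ∈ σ.toSubmodule) : (cyclic e).toSubmodule ≤ σ.toSubmodule := by
  refine Submodule.span_le.2 ?_
  rintro _ ⟨w, rfl⟩
  exact σ.apply_mem_toSubmodule w h

theorem cyclic_induction {e : MonoidAlgebra K (G ⧸ H)} {p : MonoidAlgebra K (G ⧸ H) → Prop}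
    (hp : ∀ w, p (tabloidRep K H w e)) (h0 : p 0) (ha : ∀ x y, p x → p y → p (x + y))
    (hs : ∀ (a : K) x, p x → p (a • x)) {x} (hx : x ∈ (cyclic e).toSubmodule) : p x := by
  induction hx using Submodule.span_induction with
  | mem x hx => obtain ⟨w, rfl⟩ := hx; exact hp w
  | zero => exact h0
  | add x y _ _ hx hy => exact ha x y hx hy
  | smul a x _ hx => exact hs a x hx

variable [Fintype G]

/-- The operator `∑ e(g) g`, where `e(g)` is the coefficient of the tabloid `{gH}` in `e`, on any
representation. -/
def coeffOp {M : Type*} [AddCommGroup M] [Module K M] (ρ : Representation K G M)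
    (e : MonoidAlgebra K (G ⧸ H)) : Module.End K M :=
  ∑ g : G, e.coeff (g : G ⧸ H) • ρ g

theorem coeffOp_apply {M : Type*} [AddCommGroup M] [Module K M] (ρ : Representation K G M)
    (e : MonoidAlgebra K (G ⧸ H)) (m : M) :
    coeffOp ρ e m = ∑ g : G, e.coeff (g : G ⧸ H) • ρ g m := by
  simp [coeffOp, LinearMap.sum_apply]

theorem coeffOp_rho {M : Type*} [AddCommGroup M] [Module K M] (ρ : Representation K G M)
    (e : MonoidAlgebra K (G ⧸ H)) (x : G) (m : M) :
    coeffOp ρ (tabloidRep K H x e) m = ρ x (coeffOp ρ e m) := by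
  rw [coeffOp_apply, coeffOp_apply, map_sum,
    ← Equiv.sum_comp (Equiv.mulLeft x)]
  refine Finset.sum_congr rfl fun g _ => ?_
  rw [Equiv.coe_mulLeft, tabloidRep_coeff, inv_mul_cancel_left, map_smul, map_mul]
  rfl

/-- `e` behaves like a primitive idempotent, up to the nonzero factor `n`. -/
structure IsQuasiPrimitive (e : MonoidAlgebra K (G ⧸ H)) (n : K) : Prop where
  rank_one : ∀ m, ∃ c : K, coeffOp (tabloidRep K H) e m = c • e
  eigen : coeffOp (tabloidRep K H) e e = n • e
  ne_zero : n ≠ 0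
  gen_ne_zero : e ≠ 0

/-- The linear map `s ↦ ∑ s(g) g m`, from the permutation module to a representation. -/
def toRep {M : Type*} [AddCommGroup M] [Module K M] (ρ : Representation K G M) (m : M) :
    MonoidAlgebra K (G ⧸ H) →ₗ[K] M where
  toFun s := coeffOp ρ s m
  map_add' s t := by simp [coeffOp_apply, add_smul, Finset.sum_add_distrib]
  map_smul' c s := by simp [coeffOp_apply, Finset.smul_sum, mul_smul]

namespace IsQuasiPrimitive

variable {e : MonoidAlgebra K (G ⧸ H)} {n : K}

theorem irreducible [CharZero K] (h : IsQuasiPrimitive e n) :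
    (cyclic e).toRepresentation.IsIrreducible := by
  have hne : NeZero (Nat.card G : K) := ⟨by simp [Nat.card_eq_fintype_card]⟩
  have hc : ComplementedLattice (Subrepresentation (cyclic e).toRepresentation) :=
    (Representation.isSemisimpleRepresentation_iff_isSemisimpleModule_asModule _).2 inferInstance
  let ee : (cyclic e).toSubmodule := ⟨e, self_mem_cyclic e⟩
  have htop : ∀ U : Subrepresentation (cyclic e).toRepresentation, ee ∈ U.toSubmodule → U = ⊤ := by
    intro U hU
    apply Subrepresentation.toSubmodule_injective
    refine Submodule.eq_top_iff'.2 ?_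
    rintro ⟨x, hx⟩
    have : ∃ hx' : x ∈ (cyclic e).toSubmodule,
        (⟨x, hx'⟩ : (cyclic e).toSubmodule) ∈ U.toSubmodule := by
      refine cyclic_induction (e := e)
        (p := fun x => ∃ hx' : x ∈ (cyclic e).toSubmodule,
          (⟨x, hx'⟩ : (cyclic e).toSubmodule) ∈ U.toSubmodule)
        (fun w => ⟨_, U.apply_mem_toSubmodule w hU⟩) ⟨_, U.toSubmodule.zero_mem⟩ ?_ ?_ hx
      · rintro x y ⟨hx, hx'⟩ ⟨hy, hy'⟩
        exact ⟨_, U.toSubmodule.add_mem hx' hy'⟩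
      · rintro a x ⟨hx, hx'⟩
        exact ⟨_, U.toSubmodule.smul_mem a hx'⟩
    exact this.2
  have key : ∀ U : Subrepresentation (cyclic e).toRepresentation, ∀ u ∈ U.toSubmodule,
      U = ⊤ ∨ coeffOp (tabloidRep K H) e (u : MonoidAlgebra K (G ⧸ H)) = 0 := by
    intro U u hu
    obtain ⟨c, hc⟩ := h.rank_one u
    by_cases h0 : c = 0
    · right; rw [hc, h0, zero_smul]
    left
    apply htop
    have h1 : coeffOp (cyclic e).toRepresentation e u ∈ U.toSubmodule := by
      rw [coeffOp_apply]
      exact Submodule.sum_mem _ fun g _ => U.toSubmodule.smul_mem _ (U.apply_mem_toSubmodule g hu)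
    have h2 : coeffOp (cyclic e).toRepresentation e u = c • ee := by
      apply Subtype.ext
      rw [Submodule.coe_smul, ← hc, coeffOp_apply, coeffOp_apply, Submodule.coe_sum]
      rfl
    rw [h2] at h1
    have := U.toSubmodule.smul_mem c⁻¹ h1
    rwa [smul_smul, inv_mul_cancel₀ h0, one_smul] at this
  have : Nontrivial (Subrepresentation (cyclic e).toRepresentation) := by
    refine ⟨⊥, ⊤, fun hbt => h.gen_ne_zero ?_⟩
    have h1 : ee ∈ (⊤ : Subrepresentation (cyclic e).toRepresentation).toSubmodule :=
      Submodule.mem_top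
    rw [← hbt] at h1
    exact congrArg Subtype.val ((Submodule.mem_bot K).1 h1)
  refine ⟨fun U => ?_⟩
  obtain ⟨V, hV⟩ := exists_isCompl U
  have hmem : ee ∈ U.toSubmodule ⊔ V.toSubmodule := by
    rw [← Subrepresentation.toSubmodule_sup, hV.sup_eq_top]
    exact Submodule.mem_top
  obtain ⟨u, hu, v, hv, huv⟩ := Submodule.mem_sup.1 hmem
  rcases key U u hu with h1 | h1
  · exact .inr h1
  rcases key V v hv with h2 | h2
  · left
    have := hV.inf_eq_bot
    rwa [h2, inf_top_eq] at this
  · exfalso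
    have h3 : (u : MonoidAlgebra K (G ⧸ H)) + v = e := congrArg Subtype.val huv
    have h4 : coeffOp (tabloidRep K H) e (u + v) = 0 := by rw [map_add, h1, h2, add_zero]
    rw [h3, h.eigen] at h4
    rcases smul_eq_zero.1 h4 with h5 | h5
    · exact h.ne_zero h5
    · exact h.gen_ne_zero h5

/-- The character of the module generated by a quasi-primitive element. -/
theorem character (h : IsQuasiPrimitive e n) (g : G) :
    n * (cyclic e).toRepresentation.character g =
      ∑ x : G, e.coeff ((x⁻¹ * g⁻¹ * x : G) : G ⧸ H) := by
  classical
  let S := (cyclic e).toSubmodule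
  let ι : S →ₗ[K] (G → K) :=
    { toFun := fun s x => (s : MonoidAlgebra K (G ⧸ H)).coeff (x : G ⧸ H)
      map_add' := fun s t => by ext; simp
      map_smul' := fun c s => by ext; simp }
  let p : (G → K) →ₗ[K] S :=
    { toFun := fun f => ⟨∑ x, f x • tabloidRep K H x e, Submodule.sum_mem _ fun x _ =>
        Submodule.smul_mem _ _ (Submodule.subset_span ⟨x, rfl⟩)⟩
      map_add' := fun s t => by
        apply Subtype.ext; simp [add_smul, Finset.sum_add_distrib]
      map_smul' := fun c s => by
        apply Subtype.ext; simp [Finset.smul_sum, mul_smul] }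
  have hpi : p ∘ₗ ι = n • LinearMap.id := by
    apply LinearMap.ext
    rintro ⟨x, hx⟩
    apply Subtype.ext
    have hgoal : coeffOp (tabloidRep K H) x e = n • x := by
      refine cyclic_induction (p := fun x => coeffOp (tabloidRep K H) x e = n • x) ?_ ?_ ?_ ?_ hx
      · intro w
        rw [coeffOp_rho, h.eigen, map_smul]
      · simp [coeffOp_apply]
      · intro x y hx hy
        have := (toRep (H := H) (tabloidRep K H) e).map_add x y
        simp only [toRep, LinearMap.coe_mk, AddHom.coe_mk] at this
        rw [this, hx, hy, smul_add]
      · intro a x hx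
        have := (toRep (H := H) (tabloidRep K H) e).map_smul a x
        simp only [toRep, LinearMap.coe_mk, AddHom.coe_mk] at this
        rw [this, hx, smul_comm]
    rw [coeffOp_apply] at hgoal
    exact hgoal
  have h1 : n * (cyclic e).toRepresentation.character g =
      LinearMap.trace K S ((p ∘ₗ ι) ∘ₗ (cyclic e).toRepresentation g) := by
    rw [hpi, Representation.character]
    simp [S, LinearMap.smul_comp]
  rw [h1, LinearMap.comp_assoc, LinearMap.trace_comp_comm',
    LinearMap.trace_eq_matrix_trace K (Pi.basisFun K G), Matrix.trace]
  refine Finset.sum_congr rfl fun x _ => ?_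
  rw [Matrix.diag_apply, LinearMap.toMatrix_apply, Pi.basisFun_repr, Pi.basisFun_apply]
  have hp : p (Pi.single x 1) =
      ⟨tabloidRep K H x e, Submodule.subset_span ⟨x, rfl⟩⟩ := by
    apply Subtype.ext
    change ∑ y, (Pi.single x 1 : G → K) y • tabloidRep K H y e = _
    rw [Finset.sum_eq_single x]
    · simp
    · intro y _ hy; simp [hy]
    · simp
  rw [LinearMap.comp_apply, LinearMap.comp_apply, hp]
  change (tabloidRep K H g (tabloidRep K H x e)).coeff (x : G ⧸ H) = _
  rw [tabloidRep_coeff, tabloidRep_coeff, mul_assoc]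

/-- An irreducible representation on which `∑ e(g) g` does not vanish is isomorphic to the module
generated by `e`. -/
theorem nonempty_equiv [CharZero K] (h : IsQuasiPrimitive e n) {M : Type*} [AddCommGroup M]
    [Module K M] (ρ : Representation K G M) [ρ.IsIrreducible] (hρ : coeffOp ρ e ≠ 0) :
    Nonempty (ρ.Equiv (cyclic e).toRepresentation) := by
  have := h.irreducible
  obtain ⟨m, hm⟩ : ∃ m, coeffOp ρ e m ≠ 0 := by
    by_contra! hc
    exact hρ (LinearMap.ext hc)
  let f : Representation.IntertwiningMap (cyclic e).toRepresentation ρ :=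
    LinearMap.intertwiningMap_of_isIntertwiningMap _ _
      ((toRep ρ m).domRestrict (cyclic e).toSubmodule)
      (fun g v => coeffOp_rho ρ (v : MonoidAlgebra K (G ⧸ H)) g m)
  rcases Representation.IsIrreducible.bijective_or_eq_zero f with hb | h0
  · exact ⟨(f.ofBijective hb).symm⟩
  · exact absurd (congrArg (fun F => F ⟨e, self_mem_cyclic e⟩) h0) hm

end IsQuasiPrimitive

end SpechtTheory

section SignedSums

variable {K : Type*} [Field K] {G : Type*} [Group G] [Fintype G] {H : Subgroup G}

/-- The action of `∑ β(g) g` on the permutation module. -/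
def signedSum (K : Type*) [Field K] (H : Subgroup G) (β : G → ℤ) :
    Module.End K (MonoidAlgebra K (G ⧸ H)) :=
  ∑ g : G, (β g : K) • tabloidRep K H g

theorem signedSum_apply (β : G → ℤ) (m : MonoidAlgebra K (G ⧸ H)) :
    signedSum K H β m = ∑ g : G, (β g : K) • tabloidRep K H g m := by
  simp [signedSum, LinearMap.sum_apply]

open Classical in
/-- The coefficient of `{gH}` in `∑ β(u) {uH}`. -/
def tabloidCoeff (H : Subgroup G) (β : G → ℤ) (g : G) : ℤ := ∑ u : G, if u⁻¹ * g ∈ H then β u else 0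

theorem signedSum_coeff (β : G → ℤ) (g : G) :
    (signedSum K H β (tabloid 1)).coeff (g : G ⧸ H) = (tabloidCoeff H β g : K) := by
  classical
  rw [signedSum_apply, tabloidCoeff, MonoidAlgebra.coeff_sum, Finsupp.finsetSum_apply]
  push_cast
  refine Finset.sum_congr rfl fun u _ => ?_
  rw [MonoidAlgebra.coeff_smul, Finsupp.smul_apply, tabloidRep_coeff, tabloid_coeff]
  simp

/-- `β` restricts to a sign character of the subgroup which is its support. -/
structure IsSignFunction (β : G → ℤ) : Prop where
  map_one : β 1 = 1
  map_mul : ∀ u, β u ≠ 0 → ∀ g, β (g * u) = β g * β u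

theorem IsSignFunction.mul_self {β : G → ℤ} (h : IsSignFunction β) {u : G} (hu : β u ≠ 0) :
    β u * β u = 1 := by
  have h1 : β u⁻¹ * β u = 1 := by rw [← h.map_mul u hu, inv_mul_cancel, h.map_one]
  rcases Int.isUnit_iff.1 (IsUnit.of_mul_eq_one_right _ h1) with h2 | h2 <;> rw [h2] <;> rfl

theorem IsSignFunction.signedSum_mul {β : G → ℤ} (h : IsSignFunction β) {u : G} (hu : β u ≠ 0)
    (m : MonoidAlgebra K (G ⧸ H)) :
    signedSum K H β (tabloidRep K H u m) = (β u : K) • signedSum K H β m := by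
  rw [signedSum_apply, signedSum_apply, Finset.smul_sum, ← Equiv.sum_comp (Equiv.mulRight u⁻¹)]
  refine Finset.sum_congr rfl fun g _ => ?_
  have h1 : β (g * u⁻¹) = β u * β g := by
    have h2 := h.map_mul u hu (g * u⁻¹)
    rw [inv_mul_cancel_right] at h2
    rw [h2, mul_left_comm, h.mul_self hu, mul_one]
  rw [Equiv.coe_mulRight, h1, Int.cast_mul, mul_smul, ← Module.End.mul_apply, ← _root_.map_mul,
    inv_mul_cancel_right]

theorem IsSignFunction.signedSum_eq_zero [CharZero K] {β : G → ℤ} (h : IsSignFunction β) {u w : G}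
    (hu : β u = -1) (hw : w⁻¹ * u * w ∈ H) :
    signedSum K H β (tabloid w) = 0 := by
  have h1 := h.signedSum_mul (K := K) (H := H) (u := u) (by rw [hu]; decide) (tabloid w)
  have h2 : (tabloid (u * w) : MonoidAlgebra K (G ⧸ H)) = tabloid w := by
    have : ((u * w : G) : G ⧸ H) = w := by
      rw [eq_comm, QuotientGroup.eq, ← mul_assoc]; exact hw
    rw [tabloid, tabloid, this]
  rw [tabloidRep_tabloid, h2, hu] at h1
  rw [Int.cast_neg, Int.cast_one, neg_smul, one_smul] at h1
  have h3 := eq_neg_iff_add_eq_zero.1 h1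
  rw [← two_smul K, smul_eq_zero] at h3
  exact h3.resolve_left two_ne_zero

theorem IsSignFunction.signedSum_tabloid {β : G → ℤ} (h : IsSignFunction β) {u w : G}
    (hu : β u ≠ 0) (hw : u⁻¹ * w ∈ H) :
    signedSum K H β (tabloid w) = (β u : K) • signedSum K H β (tabloid 1) := by
  rw [← h.signedSum_mul hu, tabloidRep_tabloid, mul_one]
  have : ((w : G) : G ⧸ H) = u := by rw [eq_comm, QuotientGroup.eq]; exact hw
  rw [tabloid, tabloid, this]

/-- Every tabloid is either in the `β`-orbit of `{H}` or killed by `∑ β(u) u`. -/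
def Covers (β : G → ℤ) (H : Subgroup G) : Prop :=
  ∀ w, (∃ u, β u ≠ 0 ∧ u⁻¹ * w ∈ H) ∨ ∃ u, β u = -1 ∧ w⁻¹ * u * w ∈ H

theorem coeffOp_signedSum (β : G → ℤ) (m : MonoidAlgebra K (G ⧸ H)) :
    coeffOp (tabloidRep K H) (signedSum K H β (tabloid 1)) m =
      signedSum K H β (coeffOp (tabloidRep K H) (tabloid (H := H) 1) m) := by
  classical
  conv_rhs => rw [coeffOp_apply, signedSum_apply]
  rw [coeffOp_apply]
  simp only [signedSum_coeff, tabloidCoeff, map_sum,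
    map_smul, tabloid_coeff, Finset.smul_sum, Int.cast_sum, Finset.sum_smul]
  rw [Finset.sum_comm]
  refine Finset.sum_congr rfl fun u _ => ?_
  rw [← Equiv.sum_comp (Equiv.mulLeft u)]
  refine Finset.sum_congr rfl fun g _ => ?_
  rw [Equiv.coe_mulLeft, inv_mul_cancel_left, inv_one, one_mul, _root_.map_mul]
  split_ifs <;> simp

theorem IsSignFunction.isQuasiPrimitive [CharZero K] {β : G → ℤ} (h : IsSignFunction β)
    (hc : Covers β H) {n : ℤ} (h1 : tabloidCoeff H β 1 = 1)
    (hn : ∑ g, tabloidCoeff H β g * tabloidCoeff H β g⁻¹ = n) (h0 : n ≠ 0) :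
    IsQuasiPrimitive (signedSum K H β (tabloid 1)) (n : K) := by
  set e := signedSum K H β (tabloid 1) with he
  have hb : ∀ m, signedSum K H β m ∈ Submodule.span K {e} := by
    intro m
    induction m using MonoidAlgebra.induction_linear with
    | zero => simp
    | add x y hx hy => rw [map_add]; exact Submodule.add_mem _ hx hy
    | single q a =>
      induction q using QuotientGroup.induction_on with
      | H w =>
        have h2 : (MonoidAlgebra.single (w : G ⧸ H) a) = a • tabloid w := by
          simp [tabloid]
        rw [h2, map_smul]
        refine Submodule.smul_mem _ _ ?_
        rcases hc w with ⟨u, hu, hw⟩ | ⟨u, hu, hw⟩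
        · rw [h.signedSum_tabloid hu hw]
          exact Submodule.smul_mem _ _ (Submodule.mem_span_singleton_self e)
        · rw [h.signedSum_eq_zero hu hw]
          exact Submodule.zero_mem _
  have hr : ∀ m, ∃ c : K, coeffOp (tabloidRep K H) e m = c • e := by
    intro m
    obtain ⟨c, hc⟩ := Submodule.mem_span_singleton.1
      (hb (coeffOp (tabloidRep K H) (tabloid (H := H) 1) m))
    exact ⟨c, by rw [he, coeffOp_signedSum, ← he, hc]⟩
  refine ⟨hr, ?_, by exact_mod_cast h0, ?_⟩
  · obtain ⟨c, hc⟩ := hr e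
    have h3 := congrArg (fun m : MonoidAlgebra K (G ⧸ H) => m.coeff ((1 : G) : G ⧸ H)) hc
    rw [coeffOp_apply, MonoidAlgebra.coeff_sum, Finsupp.finsetSum_apply, MonoidAlgebra.coeff_smul,
      Finsupp.smul_apply, he, signedSum_coeff, h1] at h3
    rw [hc, ← hn]
    congr 1
    rw [Int.cast_one, smul_eq_mul, mul_one] at h3
    rw [← h3]
    push_cast
    refine Finset.sum_congr rfl fun g _ => ?_
    rw [MonoidAlgebra.coeff_smul, Finsupp.smul_apply, tabloidRep_coeff, signedSum_coeff,
      signedSum_coeff, mul_one, smul_eq_mul]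
  · intro h4
    have h5 : e.coeff ((1 : G) : G ⧸ H) = 0 := by rw [h4]; rfl
    rw [he, signedSum_coeff, h1] at h5
    simp at h5

open Classical in
/-- The sign `s` on the subgroup `H'`, extended by zero. -/
def signOn (s : G → ℤ) (H' : Subgroup G) (g : G) : ℤ := if g ∈ H' then s g else 0

theorem kappa_eq_signedSum (s : G → ℤ) (H H' : Subgroup G) :
    kappa K s H H' = signedSum K H (signOn s H') := by
  classical
  rw [kappa, finsum_eq_sum_of_fintype, signedSum]
  rw [← Finset.sum_subtype (p := (· ∈ H')) (Finset.univ.filter (· ∈ H')) (by simp)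
    (fun σ : G => ((s σ : ℤ) : K) • tabloidRep K H σ), Finset.sum_filter]
  refine Finset.sum_congr rfl fun g _ => ?_
  unfold signOn
  split_ifs <;> simp

theorem polytabloid_eq_signedSum (s : G → ℤ) (H H' : Subgroup G) :
    polytabloid K s H H' = signedSum K H (signOn s H') (tabloid 1) := by
  rw [polytabloid, kappa_eq_signedSum]

theorem isSignFunction_signOn {s : G → ℤ} (hs : ∀ g h, s (g * h) = s g * s h) (h1 : s 1 = 1)
    (H' : Subgroup G) : IsSignFunction (signOn s H') := by
  refine ⟨by simp [signOn, h1], fun u hu g => ?_⟩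
  have hu' : u ∈ H' := by
    by_contra hc
    exact hu (by simp [signOn, hc])
  by_cases hg : g ∈ H' <;> simp [signOn, hu', H'.mul_mem_cancel_right hu', hs, hg]

theorem tabloidCoeff_signOn_of_mem {s : G → ℤ} {H H' : Subgroup G} (h : H ⊓ H' = ⊥) {u g : G}
    (hu : u ∈ H') (hg : u⁻¹ * g ∈ H) : tabloidCoeff H (signOn s H') g = s u := by
  classical
  rw [tabloidCoeff, Finset.sum_eq_single u]
  · simp [hg, signOn, hu]
  · intro v _ hv
    split_ifs with h1
    · rw [signOn, if_neg]
      intro h2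
      apply hv
      have h3 : v⁻¹ * u ∈ H ⊓ H' := by
        refine ⟨?_, H'.mul_mem (H'.inv_mem h2) hu⟩
        have := H.mul_mem h1 (H.inv_mem hg)
        simpa [mul_assoc] using this
      rw [h, Subgroup.mem_bot] at h3
      exact inv_mul_eq_one.1 h3
    · rfl
  · simp

theorem tabloidCoeff_signOn_of_notMem {s : G → ℤ} {H H' : Subgroup G} {g : G}
    (hg : ∀ u ∈ H', u⁻¹ * g ∉ H) : tabloidCoeff H (signOn s H') g = 0 := by
  classical
  refine Finset.sum_eq_zero fun u _ => ?_
  split_ifs with h1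
  · rw [signOn, if_neg fun h2 => hg u h2 h1]
  · rfl

/-- The function obtained from `β` by multiplication with `1 - z`. -/
def twist (z : G) (β : G → ℤ) (g : G) : ℤ := β g - β (z * g)

theorem isSignFunction_twist {s : G → ℤ} (hs : ∀ g h, s (g * h) = s g * s h) (h1 : s 1 = 1)
    {H' : Subgroup G} {z : G} (hz : ∀ g, g * z = z * g) (hz2 : z * z = 1) (hzH : z ∉ H') :
    IsSignFunction (twist z (signOn s H')) := by
  have hβ := isSignFunction_signOn hs h1 H'
  have h0 : ∀ v, v ∉ H' → signOn s H' v = 0 := fun v hv => by simp [signOn, hv]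
  have hzu : ∀ u ∈ H', z * u ∉ H' := fun u hu hc => hzH ((H'.mul_mem_cancel_right hu).1 hc)
  refine ⟨?_, fun u hu g => ?_⟩
  · rw [twist, hβ.map_one, mul_one, h0 z hzH, sub_zero]
  · by_cases h2 : u ∈ H'
    · have h3 : signOn s H' u ≠ 0 := by
        simpa only [twist, h0 _ (hzu u h2), sub_zero] using hu
      rw [twist, twist, twist, h0 _ (hzu u h2), sub_zero, ← mul_assoc, hβ.map_mul u h3,
        hβ.map_mul u h3, sub_mul]
    · have h3 : signOn s H' (z * u) ≠ 0 := by
        simpa only [twist, h0 _ h2, zero_sub, ne_eq, neg_eq_zero] using hu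
      have h4 : g * u = (z * g) * (z * u) := by
        rw [← hz g, mul_assoc, ← mul_assoc z z, hz2, one_mul]
      have h5 : z * (g * u) = g * (z * u) := by rw [← mul_assoc, ← hz, mul_assoc]
      rw [twist, h5, h4, hβ.map_mul _ h3, hβ.map_mul _ h3, twist, twist, h0 _ h2]
      ring

theorem signedSum_twist {z : G} (hz2 : z * z = 1) (β : G → ℤ)
    (m : MonoidAlgebra K (G ⧸ H)) :
    signedSum K H (twist z β) m =
      signedSum K H β m - tabloidRep K H z (signedSum K H β m) := by
  simp only [signedSum_apply, twist, Int.cast_sub, sub_smul, Finset.sum_sub_distrib, map_sum,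
    map_smul]
  congr 1
  rw [← Equiv.sum_comp (Equiv.mulLeft z)]
  refine Finset.sum_congr rfl fun g _ => ?_
  rw [Equiv.coe_mulLeft, ← mul_assoc, hz2, one_mul, map_mul]
  rfl

theorem tabloidCoeff_twist {z : G} (β : G → ℤ) (g : G) :
    tabloidCoeff H (twist z β) g = tabloidCoeff H β g - tabloidCoeff H β (z * g) := by
  classical
  have h1 : tabloidCoeff H β (z * g) = ∑ u : G, if u⁻¹ * g ∈ H then β (z * u) else 0 := by
    rw [tabloidCoeff, ← Equiv.sum_comp (Equiv.mulLeft z)]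
    refine Finset.sum_congr rfl fun u _ => ?_
    rw [Equiv.coe_mulLeft, mul_inv_rev, mul_assoc, inv_mul_cancel_left]
  rw [h1, tabloidCoeff, tabloidCoeff, ← Finset.sum_sub_distrib]
  refine Finset.sum_congr rfl fun u _ => ?_
  split_ifs <;> simp [twist]

end SignedSums

section CentralQuotient

variable {K : Type*} [Field K] [CharZero K] {G : Type*} [Group G] {H : Subgroup G}

/-- If `z` is a central involution, `1 - z` induces an isomorphism from `K G e / K G (1 + z) e` to
`K G (1 - z) e`. -/
theorem subquotient_equiv_cyclic {z : G} (hz : ∀ g, g * z = z * g) (hz2 : z * z = 1)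
    {e₁ e₂ : MonoidAlgebra K (G ⧸ H)} (he : e₂ = e₁ + tabloidRep K H z e₁) :
    Nonempty ((subquotient (cyclic e₁) (cyclic e₂)).Equiv
      (cyclic (e₁ - tabloidRep K H z e₁)).toRepresentation) := by
  have hcomm : ∀ g m, tabloidRep K H z (tabloidRep K H g m) =
      tabloidRep K H g (tabloidRep K H z m) := by
    intro g m
    rw [← Module.End.mul_apply, ← Module.End.mul_apply, ← map_mul, ← map_mul, hz]
  have hinv : ∀ m, tabloidRep K H z (tabloidRep K H z m) = m := by
    intro m
    rw [← Module.End.mul_apply, ← map_mul, hz2, map_one, Module.End.one_apply]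
  let d : MonoidAlgebra K (G ⧸ H) →ₗ[K] MonoidAlgebra K (G ⧸ H) :=
    LinearMap.id - tabloidRep K H z
  have hd : ∀ m, d m = m - tabloidRep K H z m := fun m => rfl
  have hmap : ∀ x ∈ (cyclic e₁).toSubmodule,
      d x ∈ (cyclic (e₁ - tabloidRep K H z e₁)).toSubmodule := by
    intro x hx
    refine cyclic_induction (p := fun x => d x ∈ _) ?_ ?_ ?_ ?_ hx
    · intro w
      rw [hd, hcomm, ← map_sub]
      exact (cyclic _).apply_mem_toSubmodule w (self_mem_cyclic _)
    · rw [map_zero]; exact Submodule.zero_mem _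
    · intro x y hx hy; rw [map_add]; exact Submodule.add_mem _ hx hy
    · intro a x hx; rw [map_smul]; exact Submodule.smul_mem _ _ hx
  let f : (cyclic e₁).toSubmodule →ₗ[K] (cyclic (e₁ - tabloidRep K H z e₁)).toSubmodule :=
    d.restrict hmap
  have hsum : ∀ x ∈ (cyclic e₁).toSubmodule, x + tabloidRep K H z x ∈ (cyclic e₂).toSubmodule := by
    intro x hx
    refine cyclic_induction (p := fun x => x + tabloidRep K H z x ∈ _) ?_ ?_ ?_ ?_ hx
    · intro w
      rw [hcomm, ← map_add, ← he]
      exact (cyclic _).apply_mem_toSubmodule w (self_mem_cyclic _)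
    · simp
    · intro x y hx hy
      rw [map_add, add_add_add_comm]; exact Submodule.add_mem _ hx hy
    · intro a x hx
      rw [map_smul, ← smul_add]; exact Submodule.smul_mem _ _ hx
  have hker : LinearMap.ker f = (cyclic e₂).toSubmodule.submoduleOf (cyclic e₁).toSubmodule := by
    ext ⟨x, hx⟩
    rw [LinearMap.mem_ker, Submodule.submoduleOf, Submodule.mem_comap, Submodule.subtype_apply,
      ← Subtype.coe_inj]
    change d x = 0 ↔ x ∈ _
    rw [hd, sub_eq_zero]
    constructor
    · intro h
      have h1 := hsum x hx
      rw [← h, ← two_smul K] at h1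
      have := Submodule.smul_mem _ (2⁻¹ : K) h1
      rwa [smul_smul, inv_mul_cancel₀ two_ne_zero, one_smul] at this
    · intro h
      refine (cyclic_induction (p := fun x => tabloidRep K H z x = x) ?_ ?_ ?_ ?_ h).symm
      · intro w
        rw [hcomm, he, map_add, hinv, add_comm]
      · rw [map_zero]
      · intro x y hx hy; rw [map_add, hx, hy]
      · intro a x hx; rw [map_smul, hx]
  have hsurj : Function.Surjective f := by
    rintro ⟨y, hy⟩
    have : ∃ x, ∃ hx : x ∈ (cyclic e₁).toSubmodule, d x = y := by
      refine cyclic_induction (p := fun y => ∃ x, ∃ hx : x ∈ (cyclic e₁).toSubmodule, d x = y)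
        ?_ ?_ ?_ ?_ hy
      · intro w
        refine ⟨tabloidRep K H w e₁, Submodule.subset_span ⟨w, rfl⟩, ?_⟩
        rw [hd, hcomm, map_sub]
      · exact ⟨0, Submodule.zero_mem _, map_zero _⟩
      · rintro x y ⟨a, ha, rfl⟩ ⟨b, hb, rfl⟩
        exact ⟨a + b, Submodule.add_mem _ ha hb, map_add _ _ _⟩
      · rintro c x ⟨a, ha, rfl⟩
        exact ⟨c • a, Submodule.smul_mem _ _ ha, map_smul _ _ _⟩
    obtain ⟨x, hx, hxy⟩ := this
    exact ⟨⟨x, hx⟩, Subtype.ext hxy⟩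
  refine ⟨Representation.Equiv.mk
    ((Submodule.quotEquivOfEq _ _ hker.symm).trans (f.quotKerEquivOfSurjective hsurj)) ?_⟩
  intro g
  apply LinearMap.ext
  intro q
  induction q using Submodule.Quotient.induction_on with
  | H x =>
    apply Subtype.ext
    change d (tabloidRep K H g (x : MonoidAlgebra K (G ⧸ H))) = tabloidRep K H g (d x)
    rw [hd, hd, hcomm, map_sub]

theorem cyclic_le_of_eq_add {z : G} {e₁ e₂ : MonoidAlgebra K (G ⧸ H)}
    (he : e₂ = e₁ + tabloidRep K H z e₁) : cyclic e₂ ≤ cyclic e₁ := by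
  refine cyclic_le ?_
  rw [he]
  exact Submodule.add_mem _ (self_mem_cyclic _)
    ((cyclic e₁).apply_mem_toSubmodule z (self_mem_cyclic _))

end CentralQuotient

section Reflections

variable {E : Type*} [NormedAddCommGroup E] [InnerProductSpace ℝ E]

theorem refl_apply (α v : E) : refl α v = v - (2 * ⟪α, v⟫ / ‖α‖ ^ 2) • α := by
  have h : 2 * ⟪α, v⟫ / ‖α‖ ^ 2 = ⟪α, v⟫ / ‖α‖ ^ 2 + ⟪α, v⟫ / ‖α‖ ^ 2 := by ring
  rw [refl, Submodule.reflection_orthogonal_apply, Submodule.reflection_singleton_apply, neg_sub,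
    h, add_smul, two_smul]
  rfl

theorem refl_self (α : E) : refl α α = -α :=
  Submodule.reflection_orthogonalComplement_singleton_eq_neg α

theorem refl_mul_self (α : E) : refl α * refl α = 1 := by
  apply LinearIsometryEquiv.ext
  intro v
  exact Submodule.reflection_reflection (ℝ ∙ α)ᗮ v

theorem refl_inv (α : E) : (refl α)⁻¹ = refl α := inv_eq_of_mul_eq_one_left (refl_mul_self α)

theorem refl_map (w : E ≃ₗᵢ[ℝ] E) (α : E) : refl (w α) = w * refl α * w⁻¹ := by
  apply LinearIsometryEquiv.ext
  intro v
  obtain ⟨u, rfl⟩ := w.surjective v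
  have h : w⁻¹ (w u) = u := w.symm_apply_apply u
  simp only [LinearIsometryEquiv.coe_mul, Function.comp_apply, h]
  rw [refl_apply, refl_apply, w.inner_map_map, w.norm_map, map_sub, map_smul]

end Reflections

/-! ### Signed permutations as octal numerals

The isometry which maps `ε i` to `± ε (σ i)` is encoded by the number whose `i`-th octal digit is
`σ i` for the sign `+`, and `σ i + 4` for the sign `-`. -/

section Codes

/-- The `i`-th octal digit. -/
def digit (n i : ℕ) : ℕ := Nat.land (Nat.shiftRight n (Nat.mul 3 i)) 7

/-- The action of a code on the numbers `x < 8`, where `x` stands for `ε x` and `x + 4` for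
`-ε x`. -/
def act (n x : ℕ) : ℕ := Nat.xor (digit n (Nat.land x 3)) (Nat.land x 4)

def ofDigits4 (a b c d : ℕ) : ℕ := a + 8 * b + 64 * c + 512 * d

def cmul (m n : ℕ) : ℕ :=
  ofDigits4 (act m (digit n 0)) (act m (digit n 1)) (act m (digit n 2)) (act m (digit n 3))

def cinv (n : ℕ) : ℕ :=
  let f := fun j => Nat.shiftLeft (Nat.xor j (Nat.land (digit n j) 4))
    (Nat.mul 3 (Nat.land (digit n j) 3))
  f 0 + f 1 + f 2 + f 3

def cone : ℕ := ofDigits4 0 1 2 3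

/-- The code of the reflection in the root `p`, where the pair `p` stands for the sum of the
vectors encoded by its entries. -/
def reflCode (p : ℕ × ℕ) : ℕ :=
  let f := fun x => bif x == p.1 then Nat.xor p.2 4 else bif x == Nat.xor p.1 4 then p.2 else
    bif x == p.2 then Nat.xor p.1 4 else bif x == Nat.xor p.2 4 then p.1 else x
  ofDigits4 (f 0) (f 1) (f 2) (f 3)

/-- The elements of the group generated by `gens`, by depth-first search. -/
def closeAux (gens : List ℕ) : ℕ → List ℕ → ℕ → List ℕ → List ℕ
  | 0, _, _, acc => acc
  | _ + 1, [], _, acc => acc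
  | n + 1, x :: todo, seen, acc =>
    bif seen.testBit x then closeAux gens n todo seen acc
    else closeAux gens n (gens.map (cmul · x) ++ todo) (Nat.lor seen (Nat.shiftLeft 1 x)) (x :: acc)

def close (gens : List ℕ) : List ℕ := closeAux gens 800 [cone] 0 []

/-- The set of codes in a list, as a bit mask. -/
def bits (l : List ℕ) : ℕ := l.foldr (fun x m => Nat.lor m (Nat.shiftLeft 1 x)) 0

def simpleRoots : List (ℕ × ℕ) := [(0, 5), (1, 6), (2, 7), (2, 3)]

/-- All roots of `D₄`. -/
def roots : List (ℕ × ℕ) :=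
  (List.range 8).flatMap fun a =>
    ((List.range 8).filter fun b => Nat.blt (Nat.land a 3) (Nat.land b 3)).map fun b => (a, b)

def elems : List ℕ := close (simpleRoots.map reflCode)

/-- The sign of the underlying permutation. -/
def sgn (n : ℕ) : ℤ :=
  let g := fun i j =>
    if Nat.blt (Nat.land (digit n i) 3) (Nat.land (digit n j) 3) then (1 : ℤ) else -1
  g 0 1 * g 0 2 * g 0 3 * g 1 2 * g 1 3 * g 2 3

theorem testBit_bits (l : List ℕ) (x : ℕ) : (bits l).testBit x = true ↔ x ∈ l := by
  induction l with
  | nil => simp [bits]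
  | cons y l ih =>
    have h : bits (y :: l) = bits l ||| 1 <<< y := rfl
    rw [h, Nat.testBit_or, Bool.or_eq_true, ih, List.mem_cons, Nat.one_shiftLeft, Nat.testBit_two_pow,
      decide_eq_true_eq, or_comm, eq_comm]

theorem close_induction {gens : List ℕ} {P : ℕ → Prop} (h1 : P cone)
    (hmul : ∀ g ∈ gens, ∀ x, P x → P (cmul g x)) : ∀ x ∈ close gens, P x := by
  have key : ∀ n todo seen acc, (∀ x ∈ todo, P x) → (∀ x ∈ acc, P x) →
      ∀ x ∈ closeAux gens n todo seen acc, P x := by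
    intro n
    induction n with
    | zero => intro todo seen acc _ h; exact h
    | succ n ih =>
      intro todo seen acc ht ha
      cases todo with
      | nil => exact ha
      | cons x todo =>
        rw [closeAux]
        have hx := ht x (by simp)
        have ht' : ∀ y ∈ todo, P y := fun y hy => ht y (by simp [hy])
        cases seen.testBit x with
        | true => exact ih _ _ _ ht' ha
        | false =>
          refine ih _ _ _ ?_ ?_
          · intro y hy
            rcases List.mem_append.1 hy with hy | hy
            · obtain ⟨g, hg, rfl⟩ := List.mem_map.1 hy
              exact hmul g hg x hx
            · exact ht' y hy
          · intro y hy
            rcases List.mem_cons.1 hy with rfl | hy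
            · exact hx
            · exact ha y hy
  exact key _ _ _ _ (by simpa using h1) (by simp)

theorem digit_lt (n i : ℕ) : digit n i < 8 :=
  Nat.lt_succ_of_le (Nat.and_le_right (n := n >>> (3 * i)) (m := 7))

theorem act_lt (n x : ℕ) : act n x < 8 := by
  have h1 := digit_lt n (Nat.land x 3)
  have h2 : Nat.land x 4 ≤ 4 := Nat.and_le_right (n := x) (m := 4)
  exact Nat.xor_lt_two_pow (n := 3) h1 (by omega)

theorem digit_ofDigits4 {a b c d : ℕ} (ha : a < 8) (hb : b < 8) (hc : c < 8) (hd : d < 8) :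
    digit (ofDigits4 a b c d) 0 = a ∧ digit (ofDigits4 a b c d) 1 = b ∧
      digit (ofDigits4 a b c d) 2 = c ∧ digit (ofDigits4 a b c d) 3 = d := by
  have h : ∀ n i, digit n i = n / 2 ^ (3 * i) % 8 := by
    intro n i
    have := Nat.and_two_pow_sub_one_eq_mod (n / 2 ^ (3 * i)) 3
    rw [← Nat.shiftRight_eq_div_pow] at this ⊢
    exact this
  simp only [h, ofDigits4]
  norm_num
  omega

theorem digit_cmul (m n : ℕ) {i : ℕ} (hi : i < 4) : digit (cmul m n) i = act m (digit n i) := by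
  obtain ⟨h0, h1, h2, h3⟩ := digit_ofDigits4 (act_lt m (digit n 0)) (act_lt m (digit n 1))
    (act_lt m (digit n 2)) (act_lt m (digit n 3))
  interval_cases i
  · exact h0
  · exact h1
  · exact h2
  · exact h3

theorem act_cmul (m n : ℕ) {x : ℕ} (hx : x < 8) : act (cmul m n) x = act m (act n x) := by
  have h1 : Nat.land x 3 < 4 := Nat.lt_succ_of_le (Nat.and_le_right (n := x) (m := 3))
  have key : ∀ d < 8, ∀ x < 8, Nat.land (Nat.xor d (Nat.land x 4)) 3 = Nat.land d 3 ∧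
      Nat.land (Nat.xor d (Nat.land x 4)) 4 = Nat.xor (Nat.land d 4) (Nat.land x 4) := by decide
  obtain ⟨h2, h3⟩ := key (digit n (Nat.land x 3)) (digit_lt _ _) x hx
  rw [act, digit_cmul m n h1, act, act, act, h2, h3]
  exact Nat.xor_assoc _ _ _

/-- The coordinates of the vector encoded by `x`. -/
def ptCoord (x : ℕ) (i : Fin 4) : ℤ :=
  bif Nat.land x 3 == i.val then (bif Nat.land x 4 == 0 then 1 else -1) else 0

/-- The vector `ε x` for `x < 4`, and `-ε (x - 4)` for `4 ≤ x < 8`. -/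
def pt (x : ℕ) : V4 := WithLp.toLp 2 fun i => (ptCoord x i : ℝ)

theorem pt_apply (x : ℕ) (i : Fin 4) : pt x i = (ptCoord x i : ℝ) := rfl

theorem ε_eq_pt (i : Fin 4) : ε i = pt i := by
  ext j
  rw [pt_apply, ε]
  fin_cases i <;> fin_cases j <;> simp [ptCoord]

theorem pt_xor (x : ℕ) (hx : x < 8) : pt (Nat.xor x 4) = -pt x := by
  ext j
  rw [PiLp.neg_apply, pt_apply, pt_apply]
  have : ∀ x < 8, ∀ j, ptCoord (Nat.xor x 4) j = -ptCoord x j := by decide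
  rw [this x hx, Int.cast_neg]

theorem pt_injOn {x y : ℕ} (hx : x < 8) (hy : y < 8) (h : pt x = pt y) : x = y := by
  have h1 : ∀ i, ptCoord x i = ptCoord y i := by
    intro i
    have := congrArg (fun v : V4 => v i) h
    simpa [pt_apply] using this
  have : ∀ x < 8, ∀ y < 8, (∀ i, ptCoord x i = ptCoord y i) → x = y := by decide +kernel
  exact this x hx y hy h1

/-- The vector encoded by a pair. -/
def vec (p : ℕ × ℕ) : V4 := pt p.1 + pt p.2

def vecCoord (p : ℕ × ℕ) (i : Fin 4) : ℤ := ptCoord p.1 i + ptCoord p.2 i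

theorem vec_apply (p : ℕ × ℕ) (i : Fin 4) : vec p i = (vecCoord p i : ℝ) := by
  simp [vec, vecCoord, pt_apply]

def dot (u v : Fin 4 → ℤ) : ℤ := u 0 * v 0 + u 1 * v 1 + u 2 * v 2 + u 3 * v 3

theorem inner_eq_dot {u v : V4} {a b : Fin 4 → ℤ} (hu : ∀ i, u i = a i) (hv : ∀ i, v i = b i) :
    ⟪u, v⟫ = (dot a b : ℝ) := by
  simp [PiLp.inner_apply, Fin.sum_univ_four, hu, hv, dot]
  ring

theorem inner_vec (p q : ℕ × ℕ) : ⟪vec p, vec q⟫ = (dot (vecCoord p) (vecCoord q) : ℝ) :=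
  inner_eq_dot (vec_apply p) (vec_apply q)

theorem roots_lt {p : ℕ × ℕ} (hp : p ∈ roots) : p.1 < 8 ∧ p.2 < 8 := by
  have : ∀ p ∈ roots, p.1 < 8 ∧ p.2 < 8 := by decide
  exact this p hp

theorem normSq_vec {p : ℕ × ℕ} (hp : p ∈ roots) : ‖vec p‖ ^ 2 = 2 := by
  have : ∀ p ∈ roots, dot (vecCoord p) (vecCoord p) = 2 := by decide
  rw [← real_inner_self_eq_norm_sq, inner_vec, this p hp]
  norm_num

theorem mem_Φ_iff {v : V4} : v ∈ Φ ↔ ∃ p ∈ roots, v = vec p := by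
  have h4 : ∀ i : Fin 4, pt (i + 4) = -ε i := by
    intro i
    rw [ε_eq_pt, ← pt_xor i (by omega)]
    congr 1
    revert i; decide
  constructor
  · rintro ⟨i, j, hij, h⟩
    have key : ∀ i j : Fin 4, i ≠ j → ∀ s ∈ [0, 4], ∀ t ∈ [0, 4],
        (i.val + s, j.val + t) ∈ roots ∨ (j.val + t, i.val + s) ∈ roots := by decide
    have : ∃ s ∈ [0, 4], ∃ t ∈ [0, 4], v = pt (i + s) + pt (j + t) := by
      rcases h with rfl | rfl | rfl | rfl
      · exact ⟨0, by simp, 0, by simp, by rw [ε_eq_pt, ε_eq_pt]; rfl⟩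
      · exact ⟨0, by simp, 4, by simp, by rw [h4, ε_eq_pt i, sub_eq_add_neg]; rfl⟩
      · exact ⟨4, by simp, 0, by simp, by rw [h4, ε_eq_pt j]; rfl⟩
      · exact ⟨4, by simp, 4, by simp, by rw [h4, h4, sub_eq_add_neg]⟩
    obtain ⟨s, hs, t, ht, rfl⟩ := this
    rcases key i j hij s hs t ht with h | h
    · exact ⟨_, h, rfl⟩
    · exact ⟨_, h, add_comm _ _⟩
  · rintro ⟨⟨a, b⟩, hp, rfl⟩
    have key : ∀ p ∈ roots, ∃ i j : Fin 4, i ≠ j ∧ (p = (i.val, j.val) ∨ p = (i.val, j.val + 4) ∨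
      p = (i.val + 4, j.val) ∨ p = (i.val + 4, j.val + 4)) := by decide
    obtain ⟨i, j, hij, h⟩ := key _ hp
    refine ⟨i, j, hij, ?_⟩
    rcases h with h | h | h | h <;> rw [h, vec]
    · exact .inl (by rw [ε_eq_pt, ε_eq_pt])
    · exact .inr (.inl (by rw [h4, ε_eq_pt i, sub_eq_add_neg]))
    · exact .inr (.inr (.inl (by rw [h4, ε_eq_pt j])))
    · exact .inr (.inr (.inr (by rw [h4, h4, sub_eq_add_neg])))

/-- The isometry `w` is the signed permutation with code `n`. -/
def HasCode (w : V4 ≃ₗᵢ[ℝ] V4) (n : ℕ) : Prop := ∀ x < 8, w (pt x) = pt (act n x)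

theorem HasCode.mul {v w : V4 ≃ₗᵢ[ℝ] V4} {m n : ℕ} (hv : HasCode v m) (hw : HasCode w n) :
    HasCode (v * w) (cmul m n) := by
  intro x hx
  rw [LinearIsometryEquiv.coe_mul, Function.comp_apply, hw x hx, hv _ (act_lt _ _),
    act_cmul m n hx]

theorem hasCode_one : HasCode 1 cone := by
  intro x hx
  have : ∀ x < 8, act cone x = x := by decide
  rw [this x hx]
  rfl

theorem eq_sum_pt (v : V4) : v = ∑ i : Fin 4, v i • pt i := by
  ext j
  simp only [Fin.sum_univ_four, PiLp.add_apply, PiLp.smul_apply, pt_apply]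
  fin_cases j <;> simp [ptCoord]

theorem HasCode.unique {v w : V4 ≃ₗᵢ[ℝ] V4} {n : ℕ} (hv : HasCode v n) (hw : HasCode w n) :
    v = w := by
  apply LinearIsometryEquiv.ext
  intro x
  rw [eq_sum_pt x, map_sum, map_sum]
  refine Finset.sum_congr rfl fun i _ => ?_
  rw [map_smul, map_smul, hv i (by omega), hw i (by omega)]

theorem hasCode_refl {p : ℕ × ℕ} (hp : p ∈ roots) : HasCode (refl (vec p)) (reflCode p) := by
  intro x hx
  rw [refl_apply, normSq_vec hp, inner_eq_dot (vec_apply p) (pt_apply x)]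
  ext i
  rw [PiLp.sub_apply, PiLp.smul_apply, smul_eq_mul, vec_apply, pt_apply, pt_apply]
  have key : ∀ p ∈ roots, ∀ x < 8, ∀ i : Fin 4,
      ptCoord (act (reflCode p) x) i = ptCoord x i - dot (vecCoord p) (ptCoord x) * vecCoord p i := by
    decide +kernel
  rw [key p hp x hx]
  push_cast
  ring

/-- The group operations on codes are compatible with `elems`. -/
theorem elems_check :
    (elems.all fun n => cmul n cone == n && (bits elems).testBit (cinv n) &&
      cmul (cinv n) n == cone && (sgn (cinv n) == sgn n) &&
      roots.all fun p => (bits elems).testBit (cmul (reflCode p) n) &&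
        sgn (cmul (reflCode p) n) == -sgn n) = true := by
  decide +kernel

theorem elems_nodup : elems.Nodup := by decide +kernel

theorem cone_mem_elems : cone ∈ elems := by decide +kernel

end Codes

section WeylGroup

theorem elems_facts {n : ℕ} (hn : n ∈ elems) :
    cmul n cone = n ∧ cinv n ∈ elems ∧ cmul (cinv n) n = cone ∧ sgn (cinv n) = sgn n ∧
      ∀ p ∈ roots, cmul (reflCode p) n ∈ elems ∧ sgn (cmul (reflCode p) n) = -sgn n := by
  have h := List.all_eq_true.1 elems_check n hn
  simp only [Bool.and_eq_true, beq_iff_eq, List.all_eq_true, testBit_bits] at h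
  obtain ⟨⟨⟨⟨h1, h2⟩, h3⟩, h4⟩, h5⟩ := h
  exact ⟨h1, h2, h3, h4, h5⟩

theorem simpleRoots_subset : ∀ p ∈ simpleRoots, p ∈ roots := by decide

/-- The element `τ_α` of `W` for the root `α` encoded by `p`. -/
def reflW (p : ℕ × ℕ) (hp : p ∈ roots) : W :=
  ⟨refl (vec p), Subgroup.subset_closure ⟨vec p, mem_Φ_iff.2 ⟨p, hp, rfl⟩, rfl⟩⟩

theorem exists_code (w : W) : ∃ n ∈ elems, HasCode w n := by
  obtain ⟨w, hw⟩ := w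
  refine Subgroup.closure_induction_left (p := fun w _ => ∃ n ∈ elems, HasCode w n) ?_ ?_ ?_ hw
  · exact ⟨cone, cone_mem_elems, hasCode_one⟩
  · rintro _ ⟨r, hr, rfl⟩ y _ ⟨n, hn, h⟩
    obtain ⟨p, hp, rfl⟩ := mem_Φ_iff.1 hr
    exact ⟨_, ((elems_facts hn).2.2.2.2 p hp).1, (hasCode_refl hp).mul h⟩
  · rintro _ ⟨r, hr, rfl⟩ y _ ⟨n, hn, h⟩
    obtain ⟨p, hp, rfl⟩ := mem_Φ_iff.1 hr
    rw [refl_inv]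
    exact ⟨_, ((elems_facts hn).2.2.2.2 p hp).1, (hasCode_refl hp).mul h⟩

/-- The code of an element of the Weyl group of type `D₄`. -/
def code (w : W) : ℕ := (exists_code w).choose

theorem code_mem (w : W) : code w ∈ elems := (exists_code w).choose_spec.1

theorem hasCode_code (w : W) : HasCode w (code w) := (exists_code w).choose_spec.2

theorem code_injective : Function.Injective code := fun v w h =>
  Subtype.ext ((hasCode_code v).unique (h ▸ hasCode_code w))

theorem code_eq_of_hasCode {w : W} {n : ℕ} (hn : cmul n cone = n)
    (h : HasCode w n) : code w = n := by
  have h1 : ∀ x < 8, act (code w) x = act n x := fun x hx =>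
    pt_injOn (act_lt _ _) (act_lt _ _) ((hasCode_code w x hx).symm.trans (h x hx))
  rw [← hn, ← (elems_facts (code_mem w)).1, cmul, cmul]
  rw [h1 _ (digit_lt _ _), h1 _ (digit_lt _ _), h1 _ (digit_lt _ _), h1 _ (digit_lt _ _)]

theorem code_one : code 1 = cone := code_eq_of_hasCode (by decide) hasCode_one

theorem cmul_cmul_cone {m n : ℕ} (hn : cmul n cone = n) : cmul (cmul m n) cone = cmul m n := by
  conv_rhs => rw [← hn]
  have h : ∀ i < 4, digit cone i < 8 := fun i _ => digit_lt _ _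
  have h' : ∀ i < 4, digit (cmul m n) i = act m (digit n i) := fun i hi => digit_cmul m n hi
  conv_lhs => rw [cmul, act_cmul _ _ (digit_lt _ _), act_cmul _ _ (digit_lt _ _),
    act_cmul _ _ (digit_lt _ _), act_cmul _ _ (digit_lt _ _)]
  conv_rhs => rw [cmul, digit_cmul _ _ (by norm_num), digit_cmul _ _ (by norm_num),
    digit_cmul _ _ (by norm_num), digit_cmul _ _ (by norm_num)]

theorem code_mul (v w : W) : code (v * w) = cmul (code v) (code w) :=
  code_eq_of_hasCode (cmul_cmul_cone (elems_facts (code_mem w)).1)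
    ((hasCode_code v).mul (hasCode_code w))

theorem vec_simpleRoots (i : Fin 4) : α i = vec (simpleRoots[i]) := by
  have h : ∀ i : Fin 4, pt (i + 4) = -ε i := by
    intro i
    rw [ε_eq_pt, ← pt_xor i (by omega)]
    congr 1
    revert i; decide
  fin_cases i
  · change ε 0 - ε 1 = pt 0 + pt 5; rw [sub_eq_add_neg, ← h, ε_eq_pt]; rfl
  · change ε 1 - ε 2 = pt 1 + pt 6; rw [sub_eq_add_neg, ← h, ε_eq_pt]; rfl
  · change ε 2 - ε 3 = pt 2 + pt 7; rw [sub_eq_add_neg, ← h, ε_eq_pt]; rfl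
  · change ε 2 + ε 3 = pt 2 + pt 3; rw [ε_eq_pt, ε_eq_pt]; rfl

theorem exists_word : ∀ n ∈ elems, ∃ l : List W,
    (∀ x ∈ l, ∃ α ∈ π, (x : V4 ≃ₗᵢ[ℝ] V4) = refl α) ∧ HasCode (l.prod : W) n := by
  refine close_induction ⟨[], by simp, by simpa using hasCode_one⟩ ?_
  intro g hg x ⟨l, hl, hx⟩
  obtain ⟨p, hp, rfl⟩ := List.mem_map.1 hg
  refine ⟨reflW p (simpleRoots_subset p hp) :: l, ?_, ?_⟩
  · intro y hy
    rcases List.mem_cons.1 hy with rfl | hy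
    · obtain ⟨i, rfl⟩ : ∃ i : Fin 4, p = simpleRoots[i] := by
        obtain ⟨i, hi, rfl⟩ := List.getElem_of_mem hp
        exact ⟨⟨i, hi⟩, rfl⟩
      exact ⟨vec _, ⟨i, vec_simpleRoots i⟩, rfl⟩
    · exact hl y hy
  · rw [List.prod_cons]
    exact (hasCode_refl (simpleRoots_subset p hp)).mul hx

theorem exists_eq_code {n : ℕ} (hn : n ∈ elems) : ∃ w, code w = n := by
  obtain ⟨l, -, h⟩ := exists_word n hn
  exact ⟨l.prod, code_eq_of_hasCode (elems_facts hn).1 h⟩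

theorem code_inv (w : W) : code w⁻¹ = cinv (code w) := by
  obtain ⟨v, hv⟩ := exists_eq_code (elems_facts (code_mem w)).2.1
  rw [← hv]
  congr 1
  rw [inv_eq_iff_mul_eq_one, mul_eq_one_iff_eq_inv, eq_comm, inv_eq_iff_mul_eq_one]
  apply code_injective
  rw [code_mul, hv, (elems_facts (code_mem w)).2.2.1, code_one]

theorem code_reflW {p : ℕ × ℕ} (hp : p ∈ roots) : code (reflW p hp) = reflCode p := by
  refine code_eq_of_hasCode ?_ (hasCode_refl hp)
  have : ∀ p ∈ roots, cmul (reflCode p) cone = reflCode p := by decide +kernel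
  exact this p hp

theorem code_τ (i : Fin 4) : code (τ i) = reflCode simpleRoots[i] := by
  have hi : simpleRoots[i] ∈ roots := simpleRoots_subset _ (List.getElem_mem _)
  rw [← code_reflW hi]
  congr 1
  apply Subtype.ext
  change refl (α i) = refl (vec _)
  rw [vec_simpleRoots]

instance : Finite W := by
  refine Finite.of_injective (fun w => (⟨code w, List.mem_toFinset.2 (code_mem w)⟩ :
    {n // n ∈ elems.toFinset})) fun v w h => code_injective (congrArg Subtype.val h)

instance : Fintype W := Fintype.ofFinite W

theorem sum_code {M : Type*} [AddCommMonoid M] (f : ℕ → M) :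
    ∑ w : W, f (code w) = (elems.map f).sum := by
  rw [← List.sum_toFinset f elems_nodup]
  refine Finset.sum_bij (fun w _ => code w) (fun w _ => List.mem_toFinset.2 (code_mem w))
    (fun v _ w _ h => code_injective h) (fun n hn => ?_) fun _ _ => rfl
  obtain ⟨w, hw⟩ := exists_eq_code (List.mem_toFinset.1 hn)
  exact ⟨w, Finset.mem_univ _, hw⟩

theorem sgn_code_prod {l : List W} (hl : ∀ x ∈ l, ∃ α ∈ π, (x : V4 ≃ₗᵢ[ℝ] V4) = refl α) :
    sgn (code l.prod) = (-1) ^ l.length := by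
  induction l with
  | nil => rw [List.prod_nil, code_one]; decide
  | cons x l ih =>
    obtain ⟨_, ⟨i, rfl⟩, hx⟩ := hl x (by simp)
    have hx' : x = τ i := Subtype.ext hx
    have hi : simpleRoots[i] ∈ roots := simpleRoots_subset _ (List.getElem_mem _)
    rw [List.prod_cons, code_mul, hx', code_τ, ((elems_facts (code_mem _)).2.2.2.2 _ hi).2,
      ih fun y hy => hl y (by simp [hy]), List.length_cons, pow_succ]
    ring

theorem exists_prod_eq (w : W) : ∃ l : List W,
    (∀ x ∈ l, ∃ α ∈ π, (x : V4 ≃ₗᵢ[ℝ] V4) = refl α) ∧ l.prod = w := by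
  obtain ⟨l, hl, h⟩ := exists_word _ (code_mem w)
  exact ⟨l, hl, Subtype.ext (h.unique (hasCode_code w))⟩

theorem sign_eq_sgn (w : W) : sign Φ π w = sgn (code w) := by
  have hne : {n | ∃ l : List (weyl Φ),
    (∀ x ∈ l, ∃ α ∈ π, (x : V4 ≃ₗᵢ[ℝ] V4) = refl α) ∧ l.prod = w ∧ l.length = n}.Nonempty := by
    obtain ⟨l, hl, h⟩ := exists_prod_eq w
    exact ⟨_, l, hl, h, rfl⟩
  obtain ⟨l, hl, h, hn⟩ := Nat.sInf_mem hne
  rw [sign, length, ← hn, ← h, sgn_code_prod hl]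

theorem sign_one : sign Φ π (1 : W) = 1 := by
  rw [sign_eq_sgn, code_one]; decide

theorem sign_mul (v w : W) : sign Φ π (v * w) = sign Φ π v * sign Φ π w := by
  obtain ⟨l, hl, rfl⟩ := exists_prod_eq v
  obtain ⟨l', hl', rfl⟩ := exists_prod_eq w
  rw [← List.prod_append, sign_eq_sgn, sign_eq_sgn, sign_eq_sgn, sgn_code_prod hl,
    sgn_code_prod hl', sgn_code_prod, List.length_append, pow_add]
  intro x hx
  rcases List.mem_append.1 hx with h | h
  · exact hl x h
  · exact hl' x h

theorem sign_eq_one_or (w : W) : sign Φ π w = 1 ∨ sign Φ π w = -1 := neg_one_pow_eq_or ℤ _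

/-- `h` lists the codes of the elements of `H`. -/
structure Presents (H : Subgroup W) (h : List ℕ) : Prop where
  mem_iff : ∀ w, w ∈ H ↔ code w ∈ h
  subset : ∀ n ∈ h, n ∈ elems

/-- The list `close gens` is stable under the generators and their inverses. -/
def closeCheck (gens : List ℕ) : Bool :=
  let h := close gens
  let m := bits h
  m.testBit cone && gens.all fun g => (bits elems).testBit g &&
    h.all fun x => m.testBit (cmul g x) && m.testBit (cmul (cinv g) x)

theorem presents_closure {T : Set W} {gens : List ℕ} (hT : ∀ t ∈ T, code t ∈ gens)
    (hg : ∀ g ∈ gens, ∃ t ∈ T, code t = g) (hc : closeCheck gens = true) :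
    Presents (Subgroup.closure T) (close gens) := by
  simp only [closeCheck, Bool.and_eq_true, List.all_eq_true, testBit_bits] at hc
  obtain ⟨h1, hc⟩ := hc
  have hex : ∀ n ∈ close gens, ∃ w ∈ Subgroup.closure T, code w = n := by
    refine close_induction ⟨1, Subgroup.one_mem _, code_one⟩ ?_
    rintro g hg' x ⟨w, hw, rfl⟩
    obtain ⟨t, ht, rfl⟩ := hg g hg'
    exact ⟨t * w, Subgroup.mul_mem _ (Subgroup.subset_closure ht) hw, code_mul t w⟩
  refine ⟨fun w => ⟨fun hw => ?_, fun hw => ?_⟩, fun n hn => ?_⟩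
  · refine Subgroup.closure_induction_left (p := fun w _ => code w ∈ close gens) ?_ ?_ ?_ hw
    · rwa [code_one]
    · intro t ht y _ hy
      rw [code_mul]
      exact ((hc _ (hT t ht)).2 _ hy).1
    · intro t ht y _ hy
      rw [code_mul, code_inv]
      exact ((hc _ (hT t ht)).2 _ hy).2
  · obtain ⟨v, hv, h⟩ := hex _ hw
    rwa [← code_injective h]
  · obtain ⟨v, -, rfl⟩ := hex n hn
    exact code_mem v

/-- The set of vectors encoded by a list. -/
def vecs (L : List (ℕ × ℕ)) : Set V4 := {v | ∃ p ∈ L, v = vec p}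

theorem presents_WJ {L : List (ℕ × ℕ)} (hL : ∀ p ∈ L, p ∈ roots)
    (hc : closeCheck (L.map reflCode) = true) :
    Presents (WJ (vecs L)) (close (L.map reflCode)) := by
  refine presents_closure ?_ ?_ hc
  · rintro w ⟨_, ⟨p, hp, rfl⟩, hw⟩
    refine List.mem_map.2 ⟨p, hp, ?_⟩
    rw [← code_reflW (hL p hp)]
    exact congrArg code (Subtype.ext hw.symm)
  · intro g hg
    obtain ⟨p, hp, rfl⟩ := List.mem_map.1 hg
    exact ⟨reflW p (hL p hp), ⟨vec p, ⟨p, hp, rfl⟩, rfl⟩, code_reflW _⟩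

end WeylGroup

section ConjugacyClasses

/-- Words in the simple reflections for the class representatives. -/
def classWord : Fin 13 → List (Fin 4) := ![
  [], [1], [0, 1], [0, 2, 1], [0, 1, 0, 2, 1, 0], [0, 3, 1], [0, 1, 0, 3, 1, 0], [2, 3, 1],
  [1, 2, 1, 3, 1, 2], [0, 2, 3, 1], [0, 1, 0, 2, 1, 0, 3, 1, 0, 2, 1, 3], [1, 0, 2, 3, 1],
  [1, 0, 3, 1, 0, 2]]

def wordCode (l : List (Fin 4)) : ℕ := l.foldr (fun i x => cmul (reflCode simpleRoots[i]) x) cone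

def classCode (j : Fin 13) : ℕ := wordCode (classWord j)

theorem code_prod_τ (l : List (Fin 4)) : code (l.map τ).prod = wordCode l := by
  induction l with
  | nil => exact code_one
  | cons i l ih =>
    rw [List.map_cons, List.prod_cons, code_mul, ih, code_τ]
    rfl

theorem code_classRep (j : Fin 13) : code (classRep j) = classCode j := by
  rw [classCode, ← code_prod_τ]
  congr 1
  fin_cases j <;>
    simp [classRep, classWord, τ₁, τ₂, τ₃, τ₄, mul_assoc]

def classBits (j : Fin 13) : ℕ := bits (elems.map fun y => cmul (cmul y (classCode j)) (cinv y))

theorem class_check : (elems.all fun x => (List.finRange 13).any fun j =>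
    (classBits j).testBit x && (List.finRange 13).all fun k =>
      (k == j) || !(classBits k).testBit x) = true := by decide +kernel

theorem isConj_iff_code (j : Fin 13) (g : W) :
    IsConj (classRep j) g ↔ (classBits j).testBit (code g) = true := by
  rw [classBits, testBit_bits, List.mem_map, isConj_iff]
  constructor
  · rintro ⟨c, rfl⟩
    exact ⟨code c, code_mem c, by rw [code_mul, code_mul, code_inv, code_classRep]⟩
  · rintro ⟨y, hy, h⟩
    obtain ⟨c, rfl⟩ := exists_eq_code hy
    refine ⟨c, code_injective ?_⟩
    rw [code_mul, code_mul, code_inv, code_classRep, h]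

theorem existsUnique_isConj (g : W) : ∃! j : Fin 13, IsConj (classRep j) g := by
  have h := List.all_eq_true.1 class_check _ (code_mem g)
  simp only [List.any_eq_true, Bool.and_eq_true, List.all_eq_true, List.mem_finRange, true_and,
    forall_const, Bool.or_eq_true, beq_iff_eq, Bool.not_eq_true'] at h
  obtain ⟨j, h1, h2⟩ := h
  refine ⟨j, (isConj_iff_code j g).2 h1, fun k hk => ?_⟩
  rcases h2 k with h3 | h3
  · exact h3
  · exact absurd ((isConj_iff_code k g).1 hk) (by rw [h3]; decide)

end ConjugacyClasses

section Coefficients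

variable {K : Type*} [Field K]

/-- Bit mask of the products `u h` with `u ∈ h'` of sign `s` and `h ∈ h`. -/
def prodBits (s : ℤ) (h h' : List ℕ) : ℕ :=
  bits ((h'.filter fun u => sgn u == s).flatMap fun u => h.map (cmul u))

def pick (p q x : ℕ) : ℤ := bif p.testBit x then 1 else bif q.testBit x then -1 else 0

/-- The coefficient of the tabloid with code `x` in the polytabloid. -/
def polyCoeff (h h' : List ℕ) (x : ℕ) : ℤ := pick (prodBits 1 h h') (prodBits (-1) h h') x

def disjointCheck (h h' : List ℕ) : Bool := h.all fun x => x == cone || !(bits h').testBit x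

theorem mem_prodBits {H H' : Subgroup W} {h h' : List ℕ} (hH : Presents H h) (hH' : Presents H' h')
    (s : ℤ) (w : W) : (prodBits s h h').testBit (code w) = true ↔
      ∃ u ∈ H', sign Φ π u = s ∧ u⁻¹ * w ∈ H := by
  rw [prodBits, testBit_bits]
  simp only [List.mem_flatMap, List.mem_filter, List.mem_map, beq_iff_eq]
  constructor
  · rintro ⟨a, ⟨ha, hs⟩, b, hb, hab⟩
    obtain ⟨u, rfl⟩ := exists_eq_code (hH'.subset _ ha)
    obtain ⟨v, rfl⟩ := exists_eq_code (hH.subset _ hb)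
    rw [← code_mul] at hab
    have := code_injective hab
    subst this
    refine ⟨u, (hH'.mem_iff u).2 ha, by rw [sign_eq_sgn, hs], ?_⟩
    rwa [inv_mul_cancel_left, hH.mem_iff]
  · rintro ⟨u, hu, hs, hw⟩
    refine ⟨code u, ⟨(hH'.mem_iff u).1 hu, by rw [← sign_eq_sgn, hs]⟩, _, (hH.mem_iff _).1 hw, ?_⟩
    rw [← code_mul, mul_inv_cancel_left]

theorem inf_eq_bot_of_check {H H' : Subgroup W} {h h' : List ℕ} (hH : Presents H h)
    (hH' : Presents H' h') (hd : disjointCheck h h' = true) : H ⊓ H' = ⊥ := by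
  rw [eq_bot_iff]
  rintro w ⟨h1, h2⟩
  have h3 := List.all_eq_true.1 hd _ ((hH.mem_iff w).1 h1)
  have h4 := (testBit_bits h' _).2 ((hH'.mem_iff w).1 h2)
  rw [h4] at h3
  simp only [Bool.not_true, Bool.or_false, beq_iff_eq] at h3
  exact code_injective (h3.trans code_one.symm)

theorem tabloidCoeff_eq_polyCoeff {H H' : Subgroup W} {h h' : List ℕ} (hH : Presents H h)
    (hH' : Presents H' h') (hd : H ⊓ H' = ⊥) (w : W) :
    tabloidCoeff H (signOn (sign Φ π) H') w = polyCoeff h h' (code w) := by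
  rw [polyCoeff, pick]
  cases hp : (prodBits 1 h h').testBit (code w) with
  | true =>
    obtain ⟨u, hu, hs, hw⟩ := (mem_prodBits hH hH' _ _).1 hp
    rw [tabloidCoeff_signOn_of_mem hd hu hw, hs]; rfl
  | false =>
    cases hq : (prodBits (-1) h h').testBit (code w) with
    | true =>
      obtain ⟨u, hu, hs, hw⟩ := (mem_prodBits hH hH' _ _).1 hq
      rw [tabloidCoeff_signOn_of_mem hd hu hw, hs]; rfl
    | false =>
      rw [tabloidCoeff_signOn_of_notMem]
      · rfl
      · intro u hu hw
        rcases sign_eq_one_or u with hs | hs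
        · rw [(mem_prodBits hH hH' _ _).2 ⟨u, hu, hs, hw⟩] at hp
          cases hp
        · rw [(mem_prodBits hH hH' _ _).2 ⟨u, hu, hs, hw⟩] at hq
          cases hq

theorem exists_of_polyCoeff_ne_zero {H H' : Subgroup W} {h h' : List ℕ} (hH : Presents H h)
    (hH' : Presents H' h') {w : W} (hw : polyCoeff h h' (code w) ≠ 0) :
    ∃ u ∈ H', u⁻¹ * w ∈ H := by
  rw [polyCoeff, pick] at hw
  cases hp : (prodBits 1 h h').testBit (code w) with
  | true =>
    obtain ⟨u, hu, hs, hw⟩ := (mem_prodBits hH hH' _ _).1 hp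
    exact ⟨u, hu, hw⟩
  | false =>
    cases hq : (prodBits (-1) h h').testBit (code w) with
    | true =>
      obtain ⟨u, hu, hs, hw⟩ := (mem_prodBits hH hH' _ _).1 hq
      exact ⟨u, hu, hw⟩
    | false => rw [hp, hq] at hw; exact absurd rfl hw

theorem sign_ne_zero (w : W) : sign Φ π w ≠ 0 := by
  rcases sign_eq_one_or w with h | h <;> rw [h] <;> decide

theorem signOn_of_mem {H' : Subgroup W} {u : W} (hu : u ∈ H') :
    signOn (sign Φ π) H' u = sign Φ π u := by simp [signOn, hu]

theorem signOn_of_notMem {H' : Subgroup W} {u : W} (hu : u ∉ H') :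
    signOn (sign Φ π) H' u = 0 := by simp [signOn, hu]

theorem isSignFunction_sign (H' : Subgroup W) : IsSignFunction (signOn (sign Φ π) H') :=
  isSignFunction_signOn sign_mul sign_one H'

/-- Every tabloid has a nonzero coefficient or is fixed by an odd element of the second group. -/
def coverCheck (h h' : List ℕ) : Bool :=
  let m := bits h
  elems.all fun x => polyCoeff h h' x != 0 ||
    h'.any fun t => sgn t == -1 && m.testBit (cmul (cmul (cinv x) t) x)

theorem covers_of_check {H H' : Subgroup W} {h h' : List ℕ} (hH : Presents H h)
    (hH' : Presents H' h') (hc : coverCheck h h' = true) (w : W) :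
    polyCoeff h h' (code w) ≠ 0 ∨
      ∃ u, signOn (sign Φ π) H' u = -1 ∧ w⁻¹ * u * w ∈ H := by
  have h1 := List.all_eq_true.1 hc _ (code_mem w)
  simp only [Bool.or_eq_true, List.any_eq_true, Bool.and_eq_true, bne_iff_ne, beq_iff_eq,
    testBit_bits] at h1
  refine h1.imp_right ?_
  rintro ⟨t, ht, hs, hm⟩
  obtain ⟨u, rfl⟩ := exists_eq_code (hH'.subset _ ht)
  refine ⟨u, ?_, ?_⟩
  · rw [signOn_of_mem ((hH'.mem_iff u).2 ht), sign_eq_sgn, hs]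
  · rw [hH.mem_iff, code_mul, code_mul, code_inv]
    exact hm

theorem covers_sign {H H' : Subgroup W} {h h' : List ℕ} (hH : Presents H h)
    (hH' : Presents H' h') (hc : coverCheck h h' = true) : Covers (signOn (sign Φ π) H') H := by
  intro w
  refine (covers_of_check hH hH' hc w).imp_left fun h1 => ?_
  obtain ⟨u, hu, hw⟩ := exists_of_polyCoeff_ne_zero hH hH' h1
  exact ⟨u, by rw [signOn_of_mem hu]; exact sign_ne_zero u, hw⟩

theorem polytabloid_coeff {H H' : Subgroup W} {h h' : List ℕ} (hH : Presents H h)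
    (hH' : Presents H' h') (hd : H ⊓ H' = ⊥) (w : W) :
    (polytabloid K (sign Φ π) H H').coeff (w : W ⧸ H) = (polyCoeff h h' (code w) : K) := by
  rw [polytabloid_eq_signedSum, signedSum_coeff, tabloidCoeff_eq_polyCoeff hH hH' hd]

theorem coeff_ne_zero_of_check [CharZero K] {H H' : Subgroup W} {h h' : List ℕ}
    (hH : Presents H h) (hH' : Presents H' h') (hd : H ⊓ H' = ⊥) (hc : coverCheck h h' = true)
    (w : W) (hw : kappa K (sign Φ π) H H' (tabloid w) ≠ 0) :
    (polytabloid K (sign Φ π) H H').coeff (w : W ⧸ H) ≠ 0 := by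
  rw [polytabloid_coeff hH hH' hd]
  rcases covers_of_check hH hH' hc w with h1 | ⟨u, hu, hw'⟩
  · exact_mod_cast h1
  · rw [kappa_eq_signedSum] at hw
    exact absurd ((isSignFunction_sign H').signedSum_eq_zero hu hw') hw

end Coefficients

section Characters

variable {K : Type*} [Field K] [CharZero K]

/-- `E` is the coefficient function of a generator of a module with the `i`-th irreducible
character. -/
def charCheck (E : ℕ → ℤ) (n : ℤ) (i : Fin 13) : Bool :=
  n != 0 && E cone == 1 && (elems.map fun x => E x * E (cinv x)).sum == n &&
    (List.finRange 13).all fun j =>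
      let c := cinv (classCode j)
      (elems.map fun x => E (cmul (cmul (cinv x) c) x)).sum == n * charTable i j

/-- `e` generates an irreducible module with the `i`-th irreducible character. -/
def GeneratesRow {H : Subgroup W} (e : MonoidAlgebra K (W ⧸ H)) (i : Fin 13) : Prop :=
  ∃ n, IsQuasiPrimitive e n ∧
    ∀ j, (cyclic e).toRepresentation.character (classRep j) = ((charTable i j : ℤ) : K)

theorem generatesRow_of_check {H : Subgroup W} {β : W → ℤ} (hβ : IsSignFunction β)
    (hc : Covers β H) {E : ℕ → ℤ} (hE : ∀ w, tabloidCoeff H β w = E (code w)) {n : ℤ} {i : Fin 13}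
    (hchk : charCheck E n i = true) :
    GeneratesRow (signedSum K H β (tabloid 1)) i := by
  simp only [charCheck, Bool.and_eq_true, bne_iff_ne, beq_iff_eq, List.all_eq_true,
    List.mem_finRange, forall_const] at hchk
  obtain ⟨⟨⟨h0, h1⟩, hn⟩, hrow⟩ := hchk
  have hq : IsQuasiPrimitive (signedSum K H β (tabloid 1)) (n : K) := by
    refine hβ.isQuasiPrimitive hc (by rw [hE, code_one, h1]) ?_ h0
    rw [← hn, ← sum_code (fun x => E x * E (cinv x))]
    exact Finset.sum_congr rfl fun g _ => by rw [hE, hE, code_inv]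
  refine ⟨n, hq, fun j => ?_⟩
  have h2 := hq.character (classRep j)
  have h3 : ∑ x : W, (signedSum K H β (tabloid 1)).coeff
      ((x⁻¹ * (classRep j)⁻¹ * x : W) : W ⧸ H) = ((n * charTable i j : ℤ) : K) := by
    rw [← hrow j, ← sum_code (fun x => E (cmul (cmul (cinv x) (cinv (classCode j))) x))]
    push_cast
    refine Finset.sum_congr rfl fun x _ => ?_
    rw [signedSum_coeff, hE, code_mul, code_mul, code_inv, code_inv, code_classRep]
  rw [h3] at h2
  push_cast at h2
  exact mul_left_cancel₀ hq.ne_zero h2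

theorem GeneratesRow.affords {H : Subgroup W} {e : MonoidAlgebra K (W ⧸ H)} {i : Fin 13}
    (h : GeneratesRow e i) : Affords (cyclic e).toRepresentation (i + 1) := by
  obtain ⟨n, hq, hrow⟩ := h
  exact ⟨hq.irreducible, i, rfl, hrow⟩

theorem affords_of_equiv {M N : Type*} [AddCommGroup M] [Module K M] [AddCommGroup N] [Module K N]
    {ρ : Representation K W M} {σ : Representation K W N} (φ : ρ.Equiv σ) {n : ℕ}
    (h : Affords σ n) : Affords ρ n := by
  obtain ⟨hirr, i, hi, hrow⟩ := h
  refine ⟨?_, i, hi, fun j => ?_⟩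
  · rw [Representation.irreducible_iff_isSimpleModule_asModule] at hirr ⊢
    let f : ρ.asModule →ₗ[MonoidAlgebra K W] σ.asModule :=
      Representation.IntertwiningMap.equivLinearMapAsModule ρ σ φ.toIntertwiningMap
    have hf : Function.Bijective f := φ.toLinearEquiv.bijective
    exact IsSimpleModule.congr (LinearEquiv.ofBijective f hf)
  · rw [Representation.char_iso φ, hrow]

theorem GeneratesRow.sum_character_smul_eq_zero {H : Subgroup W} {e : MonoidAlgebra K (W ⧸ H)}
    {n : K} (h : IsQuasiPrimitive e n) {M : Type*} [AddCommGroup M] [Module K M]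
    {ρ : Representation K W M} (h0 : coeffOp ρ e = 0) (m : M) :
    ∑ g : W, (cyclic e).toRepresentation.character g⁻¹ • ρ g m = 0 := by
  have h1 : n • ∑ g : W, (cyclic e).toRepresentation.character g⁻¹ • ρ g m =
      ∑ x : W, ρ x (coeffOp ρ e (ρ x⁻¹ m)) := by
    simp only [Finset.smul_sum, smul_smul, h.character, inv_inv, Finset.sum_smul, coeffOp_apply,
      map_sum, map_smul]
    rw [Finset.sum_comm]
    refine Finset.sum_congr rfl fun x _ => ?_
    rw [← Equiv.sum_comp (MulAut.conj x).toEquiv]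
    refine Finset.sum_congr rfl fun g _ => ?_
    have h2 : (MulAut.conj x).toEquiv g = x * g * x⁻¹ := rfl
    rw [h2, ← Module.End.mul_apply, ← Module.End.mul_apply, ← map_mul, ← map_mul]
    congr 4
    group
  simp only [h0, LinearMap.zero_apply, map_zero, Finset.sum_const_zero] at h1
  exact (smul_eq_zero.1 h1).resolve_left h.ne_zero

theorem charTable_col_sum (j : Fin 13) :
    ∑ i, charTable i 0 * charTable i j = if j = 0 then 192 else 0 := by
  revert j; decide +kernel

theorem exists_coeffOp_ne_zero {H : Fin 13 → Subgroup W}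
    {e : (i : Fin 13) → MonoidAlgebra K (W ⧸ H i)} (he : ∀ i, GeneratesRow (e i) i)
    {M : Type*} [AddCommGroup M] [Module K M] [Nontrivial M] (ρ : Representation K W M) :
    ∃ i, coeffOp ρ (e i) ≠ 0 := by
  classical
  by_contra! hc
  obtain ⟨m, hm⟩ := exists_ne (0 : M)
  have h1 : ∀ i, ∑ g : W, (cyclic (e i)).toRepresentation.character g⁻¹ • ρ g m = 0 := fun i => by
    obtain ⟨n, hq, -⟩ := he i
    exact GeneratesRow.sum_character_smul_eq_zero hq (hc i) m
  have h2 : ∑ g : W, (∑ i, ((charTable i 0 : ℤ) : K) *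
      (cyclic (e i)).toRepresentation.character g⁻¹) • ρ g m = 0 := by
    simp only [Finset.sum_smul, mul_smul]
    rw [Finset.sum_comm]
    refine Finset.sum_eq_zero fun i _ => ?_
    rw [← Finset.smul_sum, h1, smul_zero]
  have h3 : ∀ g : W, ∑ i, ((charTable i 0 : ℤ) : K) *
      (cyclic (e i)).toRepresentation.character g⁻¹ = if g = 1 then 192 else 0 := by
    intro g
    obtain ⟨j, hj, -⟩ := existsUnique_isConj g⁻¹
    have h4 : ∀ i, (cyclic (e i)).toRepresentation.character g⁻¹ = ((charTable i j : ℤ) : K) := by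
      intro i
      obtain ⟨c, hc⟩ := isConj_iff.1 hj
      obtain ⟨n, -, hrow⟩ := he i
      rw [← hc, Representation.char_conj, hrow]
    have h5 : j = 0 ↔ g = 1 := by
      constructor
      · rintro rfl
        have : g⁻¹ = 1 := isConj_one_right.1 hj
        exact inv_eq_one.1 this
      · rintro rfl
        refine (existsUnique_isConj (1 : W)).unique (by simpa using hj) ?_
        exact IsConj.refl 1
    simp only [h4]
    have h6 := congrArg (Int.cast : ℤ → K) (charTable_col_sum j)
    push_cast at h6
    rw [h6]
    simp only [h5]
  simp only [h3, ite_smul, zero_smul, Finset.sum_ite_eq', Finset.mem_univ, if_true, map_one,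
    Module.End.one_apply] at h2
  exact hm ((smul_eq_zero.1 h2).resolve_left (by norm_num))

theorem Affords.unique {M : Type*} [AddCommGroup M] [Module K M] {ρ : Representation K W M}
    {m n : ℕ} (hm : Affords ρ m) (hn : Affords ρ n) : m = n := by
  obtain ⟨-, i, hi, h1⟩ := hm
  obtain ⟨-, k, hk, h2⟩ := hn
  have h3 : ∀ j, charTable i j = charTable k j := fun j => by
    exact_mod_cast (h1 j).symm.trans (h2 j)
  have h4 : ∀ i k : Fin 13, ((List.finRange 13).all fun j => charTable i j == charTable k j) = true →
      i = k := by decide +kernel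
  rw [← hi, ← hk, h4 i k (List.all_eq_true.2 fun j _ => beq_iff_eq.2 (h3 j))]

end Characters

section Obtuse

variable {E : Type*} [NormedAddCommGroup E] [InnerProductSpace ℝ E]

theorem smul_mem_span_nnreal {S : Set E} {v : E} {c : ℝ} (hc : 0 ≤ c)
    (hv : v ∈ Submodule.span ℝ≥0 S) : c • v ∈ Submodule.span ℝ≥0 S :=
  Submodule.smul_mem _ (⟨c, hc⟩ : ℝ≥0) hv

theorem inner_posPart_negPart_nonpos {ι : Type*} (s : Finset ι) {x : ι → E}
    (hx : ∀ i j, i ≠ j → ⟪x i, x j⟫ ≤ 0) (c : ι → ℝ) :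
    ⟪∑ i ∈ s, max (c i) 0 • x i, ∑ i ∈ s, max (-c i) 0 • x i⟫ ≤ 0 := by
  simp only [sum_inner, inner_sum, real_inner_smul_left, real_inner_smul_right]
  refine Finset.sum_nonpos fun i _ => Finset.sum_nonpos fun j _ => ?_
  by_cases hij : i = j
  · subst hij
    have h : max (c i) 0 * max (-c i) 0 = 0 := by
      rcases le_total (c i) 0 with h | h
      · rw [max_eq_right h, zero_mul]
      · rw [max_eq_right (neg_nonpos.2 h), mul_zero]
    rw [mul_left_comm, ← mul_assoc, h, zero_mul]
  · exact mul_nonpos_of_nonneg_of_nonpos (le_max_right _ _)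
      (mul_nonpos_of_nonneg_of_nonpos (le_max_right _ _) (hx _ _ (by tauto)))

theorem sum_posPart_sub_negPart {ι : Type*} (s : Finset ι) (x : ι → E) (c : ι → ℝ) :
    ∑ i ∈ s, max (c i) 0 • x i - ∑ i ∈ s, max (-c i) 0 • x i = ∑ i ∈ s, c i • x i := by
  rw [← Finset.sum_sub_distrib]
  refine Finset.sum_congr rfl fun i _ => ?_
  rw [← sub_smul]
  congr 1
  rcases le_total (c i) 0 with h | h
  · rw [max_eq_right h, max_eq_left (neg_nonneg.2 h)]; ring
  · rw [max_eq_left h, max_eq_right (neg_nonpos.2 h)]; ring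

/-- Vectors in an open half-space with pairwise nonpositive inner products are linearly
independent. -/
theorem linearIndependent_of_obtuse {J : Set E} (hJ : ∀ a ∈ J, ∀ b ∈ J, a ≠ b → ⟪a, b⟫ ≤ 0)
    (f : E →ₗ[ℝ] ℝ) (hf : ∀ a ∈ J, 0 < f a) : LinearIndependent ℝ (Subtype.val : J → E) := by
  rw [linearIndependent_iff']
  intro s c hc i hi
  have hob := inner_posPart_negPart_nonpos s (x := (Subtype.val : J → E))
    (fun i j hij => hJ _ i.2 _ j.2 fun h => hij (Subtype.ext h)) c
  have hd := sum_posPart_sub_negPart s (Subtype.val : J → E) c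
  rw [hc, sub_eq_zero] at hd
  rw [← hd] at hob
  have h0 := real_inner_self_nonpos.1 hob
  have key : ∀ d : J → ℝ, (∀ j, 0 ≤ d j) → ∑ j ∈ s, d j • (j : E) = 0 → d i = 0 := by
    intro d hd h
    have h1 := congrArg f h
    rw [map_sum, map_zero] at h1
    have h2 := (Finset.sum_eq_zero_iff_of_nonneg (fun j _ => by
      rw [map_smul, smul_eq_mul]
      exact mul_nonneg (hd j) (hf _ j.2).le)).1 h1 i hi
    rw [map_smul, smul_eq_mul] at h2
    exact (mul_eq_zero.1 h2).resolve_right (hf _ i.2).ne'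
  have h1 := key _ (fun j => le_max_right (c j) 0) h0
  have h2 := key _ (fun j => le_max_right (-c j) 0) (hd ▸ h0)
  have h3 := le_max_left (c i) 0
  have h4 := le_max_left (-c i) 0
  linarith

end Obtuse

section Lattice

/-- The `D₄` lattice. -/
def IsLatticeVector (v : V4) : Prop :=
  ∃ n : Fin 4 → ℤ, (∀ i, v i = n i) ∧ Even (n 0 + n 1 + n 2 + n 3)

theorem IsLatticeVector.add {u v : V4} (hu : IsLatticeVector u) (hv : IsLatticeVector v) :
    IsLatticeVector (u + v) := by
  obtain ⟨m, hm, hm'⟩ := hu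
  obtain ⟨n, hn, hn'⟩ := hv
  refine ⟨m + n, fun i => by simp [hm, hn], ?_⟩
  have h : (m + n) 0 + (m + n) 1 + (m + n) 2 + (m + n) 3 =
      m 0 + m 1 + m 2 + m 3 + (n 0 + n 1 + n 2 + n 3) := by
    simp only [Pi.add_apply]; ring
  rw [h]
  exact hm'.add hn'

theorem IsLatticeVector.zsmul {u : V4} (hu : IsLatticeVector u) (c : ℤ) :
    IsLatticeVector (c • u) := by
  obtain ⟨m, hm, hm'⟩ := hu
  refine ⟨fun i => c * m i, fun i => by simp [hm], ?_⟩
  have h : c * m 0 + c * m 1 + c * m 2 + c * m 3 = c * (m 0 + m 1 + m 2 + m 3) := by ring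
  change Even (c * m 0 + c * m 1 + c * m 2 + c * m 3)
  rw [h]
  exact hm'.mul_left c

theorem isLatticeVector_zero : IsLatticeVector 0 := ⟨0, by simp, by simp⟩

theorem IsLatticeVector.two_le {u : V4} (hu : IsLatticeVector u) (h0 : u ≠ 0) : 2 ≤ ⟪u, u⟫ := by
  obtain ⟨m, hm, hm'⟩ := hu
  rw [inner_eq_dot hm hm]
  have h1 : 0 ≤ dot m m := by
    unfold dot
    nlinarith [mul_self_nonneg (m 0), mul_self_nonneg (m 1), mul_self_nonneg (m 2),
      mul_self_nonneg (m 3)]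
  have h2 : Even (dot m m) := by
    unfold dot
    rw [Int.even_iff] at hm' ⊢
    have : ∀ a : ℤ, a * a % 2 = a % 2 := fun a => by
      rcases Int.emod_two_eq_zero_or_one a with h | h <;> simp [Int.mul_emod, h]
    have h3 := this (m 0)
    have h4 := this (m 1)
    have h5 := this (m 2)
    have h6 := this (m 3)
    omega
  have h3 : dot m m ≠ 0 := by
    intro h
    apply h0
    have h4 : ⟪u, u⟫ = 0 := by rw [inner_eq_dot hm hm, h]; simp
    exact inner_self_eq_zero.1 h4
  have h4 : (2 : ℤ) ≤ dot m m := by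
    obtain ⟨k, hk⟩ := h2
    omega
  exact_mod_cast h4

theorem isLatticeVector_of_mem {v : V4} (hv : v ∈ Φ) : IsLatticeVector v := by
  obtain ⟨p, hp, rfl⟩ := mem_Φ_iff.1 hv
  have : ∀ p ∈ roots, Even (vecCoord p 0 + vecCoord p 1 + vecCoord p 2 + vecCoord p 3) := by
    decide
  exact ⟨vecCoord p, vec_apply p, this p hp⟩

theorem inner_self_of_mem {v : V4} (hv : v ∈ Φ) : ⟪v, v⟫ = 2 := by
  obtain ⟨p, hp, rfl⟩ := mem_Φ_iff.1 hv
  rw [real_inner_self_eq_norm_sq, normSq_vec hp]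

theorem refl_apply_of_mem {v : V4} (hv : v ∈ Φ) (u : V4) : refl v u = u - ⟪v, u⟫ • v := by
  rw [refl_apply, ← real_inner_self_eq_norm_sq, inner_self_of_mem hv]
  congr 2
  ring

theorem apply_mem_Φ (w : W) {v : V4} (hv : v ∈ Φ) : (w : V4 ≃ₗᵢ[ℝ] V4) v ∈ Φ := by
  have h1 := inner_self_of_mem hv
  obtain ⟨p, hp, rfl⟩ := mem_Φ_iff.1 hv
  obtain ⟨ha, hb⟩ := roots_lt hp
  have h2 : (w : V4 ≃ₗᵢ[ℝ] V4) (vec p) = vec (act (code w) p.1, act (code w) p.2) := by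
    rw [vec, map_add, hasCode_code w _ ha, hasCode_code w _ hb]; rfl
  rw [← (w : V4 ≃ₗᵢ[ℝ] V4).inner_map_map, h2, inner_vec] at h1
  rw [h2]
  have key : ∀ a < 8, ∀ b < 8, dot (vecCoord (a, b)) (vecCoord (a, b)) ≠ 2 ∨
    (a, b) ∈ roots ∨ (b, a) ∈ roots := by decide +kernel
  rcases key _ (act_lt (code w) p.1) _ (act_lt (code w) p.2) with h | h | h
  · exact absurd (by exact_mod_cast h1) h
  · exact mem_Φ_iff.2 ⟨_, h, rfl⟩
  · exact mem_Φ_iff.2 ⟨_, h, add_comm _ _⟩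

theorem exists_reflW {v : V4} (hv : v ∈ Φ) : ∃ w : W, (w : V4 ≃ₗᵢ[ℝ] V4) = refl v :=
  ⟨⟨refl v, Subgroup.subset_closure ⟨v, hv, rfl⟩⟩, rfl⟩

variable {J : Set V4}

theorem rootsOf_subset (hJ : J ⊆ Φ) : rootsOf Φ J ⊆ Φ := by
  rintro _ ⟨w, -, j, hj, rfl⟩
  exact apply_mem_Φ w (hJ hj)

theorem subset_rootsOf : J ⊆ rootsOf Φ J := fun j hj => ⟨1, Subgroup.one_mem _, j, hj, rfl⟩

theorem exists_mem_reflSubgroup (hJ : J ⊆ Φ) {r : V4} (hr : r ∈ rootsOf Φ J) :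
    ∃ g ∈ WJ J, (g : V4 ≃ₗᵢ[ℝ] V4) = refl r := by
  obtain ⟨w, hw, j, hj, rfl⟩ := hr
  obtain ⟨g, hg⟩ := exists_reflW (hJ hj)
  refine ⟨w * g * w⁻¹, ?_, ?_⟩
  · exact Subgroup.mul_mem _ (Subgroup.mul_mem _ hw (Subgroup.subset_closure ⟨j, hj, hg⟩))
      (Subgroup.inv_mem _ hw)
  · rw [refl_map, ← hg]; rfl

theorem isSubsystem_rootsOf (hJ : J ⊆ Φ) : IsSubsystem Φ (rootsOf Φ J) := by
  have hs : ∀ α ∈ rootsOf Φ J, ∀ β ∈ rootsOf Φ J, refl α β ∈ rootsOf Φ J := by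
    intro α hα β hβ
    obtain ⟨g, hg, hgα⟩ := exists_mem_reflSubgroup hJ hα
    obtain ⟨w, hw, j, hj, rfl⟩ := hβ
    exact ⟨g * w, Subgroup.mul_mem _ hg hw, j, hj, by rw [← hgα]; rfl⟩
  refine ⟨rootsOf_subset hJ, hs, fun α hα β hβ hαβ => ?_⟩
  have h1 := inner_self_of_mem hαβ
  rw [inner_add_add_self, inner_self_of_mem (rootsOf_subset hJ hα),
    inner_self_of_mem (rootsOf_subset hJ hβ), real_inner_comm α β] at h1
  have h2 : refl α β = α + β := by
    rw [refl_apply_of_mem (rootsOf_subset hJ hα)]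
    have : ⟪α, β⟫ = -1 := by
      have := real_inner_comm α β
      linarith
    rw [this, neg_one_smul, sub_neg_eq_add, add_comm]
  rw [← h2]
  exact hs α hα β hβ

theorem rootsOf_subset_span (hJ : J ⊆ Φ) : rootsOf Φ J ⊆ Submodule.span ℤ J := by
  have hlat : ∀ v ∈ Submodule.span ℤ J, IsLatticeVector v := by
    intro v hv
    induction hv using Submodule.span_induction with
    | mem x hx => exact isLatticeVector_of_mem (hJ hx)
    | zero => exact isLatticeVector_zero
    | add x y _ _ hx hy => exact hx.add hy
    | smul a x _ hx => exact hx.zsmul a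
  have hrefl : ∀ α ∈ J, ∀ v ∈ Submodule.span ℤ J, refl α v ∈ Submodule.span ℤ J := by
    intro α hα v hv
    obtain ⟨m, hm, -⟩ := hlat v hv
    obtain ⟨n, hn, -⟩ := isLatticeVector_of_mem (hJ hα)
    rw [refl_apply_of_mem (hJ hα), inner_eq_dot hn hm, Int.cast_smul_eq_zsmul]
    exact Submodule.sub_mem _ hv (Submodule.smul_mem _ _ (Submodule.subset_span hα))
  rintro _ ⟨w, hw, j, hj, rfl⟩
  have : ∀ v ∈ Submodule.span ℤ J, (w : V4 ≃ₗᵢ[ℝ] V4) v ∈ Submodule.span ℤ J := by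
    refine Subgroup.closure_induction_left
      (p := fun (w : W) _ => ∀ v ∈ Submodule.span ℤ J, (w : V4 ≃ₗᵢ[ℝ] V4) v ∈ Submodule.span ℤ J)
      ?_ ?_ ?_ hw
    · intro v hv; exact hv
    · rintro g ⟨α, hα, hg⟩ y _ hy v hv
      rw [Subgroup.coe_mul, hg]
      exact hrefl α hα _ (hy v hv)
    · rintro g ⟨α, hα, hg⟩ y _ hy v hv
      rw [Subgroup.coe_mul, Subgroup.coe_inv, hg, refl_inv]
      exact hrefl α hα _ (hy v hv)
  exact this j (Submodule.subset_span hj)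

theorem isSimpleSystem_rootsOf (hJ : J ⊆ Φ) (hob : ∀ a ∈ J, ∀ b ∈ J, a ≠ b → ⟪a, b⟫ ≤ 0)
    (f : V4 →ₗ[ℝ] ℝ) (hf : ∀ a ∈ J, 0 < f a) : IsSimpleSystem (rootsOf Φ J) J := by
  refine ⟨subset_rootsOf, linearIndependent_of_obtuse hob f hf, fun v hv => ?_⟩
  have hv2 := inner_self_of_mem (rootsOf_subset hJ hv)
  have hspan := rootsOf_subset_span hJ hv
  rw [← Subtype.range_coe (s := J), SetLike.mem_coe,
    Finsupp.mem_span_range_iff_exists_finsupp] at hspan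
  obtain ⟨c, rfl⟩ := hspan
  have hnn : ∀ d : J → ℝ, (∀ j, 0 ≤ d j) →
      ∑ j ∈ c.support, d j • (j : V4) ∈ Submodule.span ℝ≥0 J := fun d hd =>
    Submodule.sum_mem _ fun j _ => smul_mem_span_nnreal (hd j) (Submodule.subset_span j.2)
  have hlat : ∀ d : J → ℤ, IsLatticeVector (∑ j ∈ c.support, (d j : ℝ) • (j : V4)) := by
    intro d
    refine Finset.sum_induction _ IsLatticeVector (fun _ _ h h' => h.add h') isLatticeVector_zero
      fun j _ => ?_
    rw [Int.cast_smul_eq_zsmul]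
    exact (isLatticeVector_of_mem (hJ j.2)).zsmul _
  have hob' := inner_posPart_negPart_nonpos c.support (x := (Subtype.val : J → V4))
    (fun i j hij => hob _ i.2 _ j.2 fun h => hij (Subtype.ext h)) (fun j => (c j : ℝ))
  have hd := sum_posPart_sub_negPart c.support (Subtype.val : J → V4) (fun j => (c j : ℝ))
  have hp := hlat fun j => max (c j) 0
  have hq := hlat fun j => max (-c j) 0
  have hpn := hnn (fun j => max (c j : ℝ) 0) fun j => le_max_right _ _
  have hqn := hnn (fun j => max (-c j : ℝ) 0) fun j => le_max_right _ _
  push_cast at hp hq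
  have hsum : (c.sum fun i a => a • (i : V4)) = ∑ j ∈ c.support, (c j : ℝ) • (j : V4) :=
    Finset.sum_congr rfl fun j _ => (Int.cast_smul_eq_zsmul ℝ (c j) (j : V4)).symm
  rw [hsum, ← hd] at hv2 ⊢
  set p := ∑ j ∈ c.support, max (c j : ℝ) 0 • (j : V4)
  set q := ∑ j ∈ c.support, max (-c j : ℝ) 0 • (j : V4)
  by_cases h1 : p = 0
  · right
    rw [h1, zero_sub, neg_neg]
    exact hqn
  by_cases h2 : q = 0
  · left
    rw [h2, sub_zero]
    exact hpn
  exfalso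
  have h3 := hp.two_le h1
  have h4 := hq.two_le h2
  rw [inner_sub_sub_self, real_inner_comm p q] at hv2
  have h5 := real_inner_comm p q
  linarith

theorem disjoint_rootsOf {J' : Set V4} (hJ : J ⊆ Φ) (hJ' : J' ⊆ Φ) (h : WJ J ⊓ WJ J' = ⊥) :
    rootsOf Φ J' ⊆ Φ \ rootsOf Φ J := by
  intro r hr
  refine ⟨rootsOf_subset hJ' hr, fun hr' => ?_⟩
  obtain ⟨g, hg, hgr⟩ := exists_mem_reflSubgroup hJ hr'
  obtain ⟨g', hg', hgr'⟩ := exists_mem_reflSubgroup hJ' hr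
  have h1 : g = g' := Subtype.ext (hgr.trans hgr'.symm)
  have h2 : g ∈ WJ J ⊓ WJ J' := ⟨hg, h1 ▸ hg'⟩
  rw [h, Subgroup.mem_bot] at h2
  have h3 : refl r r = r := by rw [← hgr, h2]; rfl
  rw [refl_self] at h3
  have h4 := inner_self_of_mem (rootsOf_subset hJ' hr)
  have h5 : ⟪-r, r⟫ = ⟪r, r⟫ := by rw [h3]
  rw [inner_neg_left] at h5
  linarith

theorem reflSubgroup_orth_eq_bot (h : ∀ r ∈ Φ, ∃ j ∈ J, ⟪r, j⟫ ≠ 0) :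
    WJ (orth Φ (rootsOf Φ J)) = ⊥ := by
  have h1 : orth Φ (rootsOf Φ J) = ∅ := by
    rw [Set.eq_empty_iff_forall_notMem]
    rintro r ⟨hr, hr'⟩
    obtain ⟨j, hj, hne⟩ := h r hr
    exact hne (hr' j (subset_rootsOf hj))
  rw [h1, WJ, reflSubgroup]
  simp

end Lattice

section SimpleCoordinates

/-- The coefficients of the vector with coordinates `c` at the simple roots, multiplied by `2`. -/
def twiceSimpleCoord (c : Fin 4 → ℤ) : List ℤ :=
  [2 * c 0, 2 * (c 0 + c 1), c 0 + c 1 + c 2 - c 3, c 0 + c 1 + c 2 + c 3]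

def isNonneg (c : Fin 4 → ℤ) : Bool := (twiceSimpleCoord c).all fun a => Int.ble' 0 a

theorem rt_apply (a b c d : ℝ) :
    rt a b c d = WithLp.toLp 2 ![a, b - a, c + d - b, d - c] := by
  ext i
  fin_cases i <;> simp [rt, α, ε] <;> ring

theorem eq_rt (v : V4) :
    v = rt (v 0) (v 0 + v 1) ((v 0 + v 1 + v 2 - v 3) / 2) ((v 0 + v 1 + v 2 + v 3) / 2) := by
  rw [rt_apply]
  ext i
  fin_cases i <;> simp <;> ring

theorem span_π : Submodule.span ℝ π = ⊤ := by
  refine Submodule.eq_top_iff'.2 fun v => ?_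
  rw [eq_rt v, rt]
  have h : ∀ i, α i ∈ Submodule.span ℝ π := fun i => Submodule.subset_span ⟨i, rfl⟩
  exact add_mem (add_mem (add_mem (Submodule.smul_mem _ _ (h 0)) (Submodule.smul_mem _ _ (h 1)))
    (Submodule.smul_mem _ _ (h 2))) (Submodule.smul_mem _ _ (h 3))

theorem mem_span_nnreal_π {v : V4} {c : Fin 4 → ℤ} (hv : ∀ i, v i = c i)
    (h : isNonneg c = true) : v ∈ Submodule.span ℝ≥0 π := by
  simp only [isNonneg, twiceSimpleCoord, List.all_cons, List.all_nil, Bool.and_true,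
    Bool.and_eq_true, Int.ble'_eq_true] at h
  obtain ⟨h0, h1, h2, h3⟩ := h
  have hm : ∀ i, α i ∈ Submodule.span ℝ≥0 π := fun i => Submodule.subset_span ⟨i, rfl⟩
  have h0' : (0 : ℝ) ≤ 2 * c 0 := by exact_mod_cast h0
  have h1' : (0 : ℝ) ≤ 2 * (c 0 + c 1) := by exact_mod_cast h1
  have h2' : (0 : ℝ) ≤ c 0 + c 1 + c 2 - c 3 := by exact_mod_cast h2
  have h3' : (0 : ℝ) ≤ c 0 + c 1 + c 2 + c 3 := by exact_mod_cast h3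
  rw [eq_rt v, rt]
  simp only [hv]
  refine add_mem (add_mem (add_mem (smul_mem_span_nnreal ?_ (hm 0)) (smul_mem_span_nnreal ?_ (hm 1)))
    (smul_mem_span_nnreal ?_ (hm 2))) (smul_mem_span_nnreal ?_ (hm 3)) <;> linarith

/-- The height of a vector. -/
def height : V4 →ₗ[ℝ] ℝ :=
  innerₛₗ ℝ (WithLp.toLp 2 ![3, 2, 1, 0] : V4)

theorem height_apply (v : V4) : height v = 3 * v 0 + 2 * v 1 + v 2 := by
  simp [height, PiLp.inner_apply, Fin.sum_univ_four]
  ring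

end SimpleCoordinates

section Systems

def unorderedEq (p q : ℕ × ℕ) : Bool := (p.1 == q.1 && p.2 == q.2) || (p.1 == q.2 && p.2 == q.1)

theorem vec_eq_of_unorderedEq {p q : ℕ × ℕ} (h : unorderedEq p q = true) : vec p = vec q := by
  simp only [unorderedEq, Bool.or_eq_true, Bool.and_eq_true, beq_iff_eq] at h
  rcases h with ⟨h1, h2⟩ | ⟨h1, h2⟩
  · rw [vec, vec, h1, h2]
  · rw [vec, vec, h1, h2, add_comm]

def actPair (n : ℕ) (p : ℕ × ℕ) : ℕ × ℕ := (act n p.1, act n p.2)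

theorem apply_vec (w : W) {p : ℕ × ℕ} (hp : p.1 < 8 ∧ p.2 < 8) :
    (w : V4 ≃ₗᵢ[ℝ] V4) (vec p) = vec (actPair (code w) p) := by
  rw [vec, map_add, hasCode_code w _ hp.1, hasCode_code w _ hp.2]; rfl

theorem actPair_lt (n : ℕ) (p : ℕ × ℕ) : (actPair n p).1 < 8 ∧ (actPair n p).2 < 8 :=
  ⟨act_lt _ _, act_lt _ _⟩

/-- `L` is a list of positive roots with pairwise nonpositive inner products. -/
def systemCheck (L : List (ℕ × ℕ)) : Bool :=
  closeCheck (L.map reflCode) && L.all fun p => roots.contains p && isNonneg (vecCoord p) &&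
    Int.blt' 0 (3 * vecCoord p 0 + 2 * vecCoord p 1 + vecCoord p 2) &&
    L.all fun q => p == q || Int.ble' (dot (vecCoord p) (vecCoord q)) 0

theorem systemCheck_spec {L : List (ℕ × ℕ)} (h : systemCheck L = true) :
    closeCheck (L.map reflCode) = true ∧ (∀ p ∈ L, p ∈ roots) ∧
      (∀ p ∈ L, isNonneg (vecCoord p) = true) ∧
      (∀ p ∈ L, 0 < 3 * vecCoord p 0 + 2 * vecCoord p 1 + vecCoord p 2) ∧
      ∀ p ∈ L, ∀ q ∈ L, p = q ∨ dot (vecCoord p) (vecCoord q) ≤ 0 := by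
  simp only [systemCheck, Bool.and_eq_true, List.all_eq_true, List.contains_eq_mem,
    decide_eq_true_eq, Bool.or_eq_true, beq_iff_eq, Int.ble'_eq_true, Int.blt'_eq_true] at h
  obtain ⟨h1, h2⟩ := h
  exact ⟨h1, fun p hp => (h2 p hp).1.1.1, fun p hp => (h2 p hp).1.1.2, fun p hp => (h2 p hp).1.2,
    fun p hp => (h2 p hp).2⟩

theorem vecs_subset_Φ {L : List (ℕ × ℕ)} (h : ∀ p ∈ L, p ∈ roots) : vecs L ⊆ Φ := by
  rintro _ ⟨p, hp, rfl⟩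
  exact mem_Φ_iff.2 ⟨p, h p hp, rfl⟩

/-- The list of the elements of `W(L)`. -/
def group (L : List (ℕ × ℕ)) : List ℕ := close (L.map reflCode)

theorem presents_group {L : List (ℕ × ℕ)} (h : systemCheck L = true) :
    Presents (WJ (vecs L)) (group L) :=
  presents_WJ (systemCheck_spec h).2.1 (systemCheck_spec h).1

theorem vecs_subset_positive {L : List (ℕ × ℕ)} (h : systemCheck L = true) :
    vecs L ⊆ positive Φ π := by
  rintro _ ⟨p, hp, rfl⟩
  exact ⟨vecs_subset_Φ (systemCheck_spec h).2.1 ⟨p, hp, rfl⟩,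
    mem_span_nnreal_π (vec_apply p) ((systemCheck_spec h).2.2.1 p hp)⟩

theorem isSimpleSystem_vecs {L : List (ℕ × ℕ)} (h : systemCheck L = true) :
    IsSimpleSystem (rootsOf Φ (vecs L)) (vecs L) := by
  obtain ⟨-, h1, -, h3, h4⟩ := systemCheck_spec h
  refine isSimpleSystem_rootsOf (vecs_subset_Φ h1) ?_ height ?_
  · rintro _ ⟨p, hp, rfl⟩ _ ⟨q, hq, rfl⟩ hne
    rw [inner_vec]
    rcases h4 p hp q hq with rfl | h5
    · exact absurd rfl hne
    · exact_mod_cast h5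
  · rintro _ ⟨p, hp, rfl⟩
    rw [height_apply, vec_apply, vec_apply, vec_apply]
    exact_mod_cast h3 p hp

def orthCheck (L : List (ℕ × ℕ)) : Bool :=
  roots.all fun r => L.any fun p => dot (vecCoord r) (vecCoord p) != 0

theorem reflSubgroup_orth_vecs {L : List (ℕ × ℕ)} (h : orthCheck L = true) :
    WJ (orth Φ (rootsOf Φ (vecs L))) = ⊥ := by
  refine reflSubgroup_orth_eq_bot fun r hr => ?_
  obtain ⟨q, hq, rfl⟩ := mem_Φ_iff.1 hr
  have h1 := List.all_eq_true.1 h q hq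
  simp only [List.any_eq_true, bne_iff_ne] at h1
  obtain ⟨p, hp, hne⟩ := h1
  refine ⟨vec p, ⟨p, hp, rfl⟩, ?_⟩
  rw [inner_vec]
  exact_mod_cast hne

theorem isUsefulSystem_vecs {L L' : List (ℕ × ℕ)} (h : systemCheck L = true)
    (h' : systemCheck L' = true) (hd : disjointCheck (group L) (group L') = true)
    (ho : (orthCheck L || orthCheck L') = true) : IsUsefulSystem Φ π (vecs L) (vecs L') := by
  have h1 := vecs_subset_Φ (systemCheck_spec h).2.1
  have h1' := vecs_subset_Φ (systemCheck_spec h').2.1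
  have hinf := inf_eq_bot_of_check (presents_group h) (presents_group h') hd
  refine ⟨isSubsystem_rootsOf h1, isSimpleSystem_vecs h, vecs_subset_positive h,
    isSubsystem_rootsOf h1', isSimpleSystem_vecs h', vecs_subset_positive h',
    disjoint_rootsOf h1 h1' hinf, hinf, ?_⟩
  rcases Bool.or_eq_true _ _ ▸ ho with ho | ho
  · exact (congrArg (· ⊓ _) (reflSubgroup_orth_vecs ho)).trans (bot_inf_eq _)
  · exact (congrArg (_ ⊓ ·) (reflSubgroup_orth_vecs ho)).trans (inf_bot_eq _)

/-- The roots of the subsystem with simple system `L`. -/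
def orbit (L : List (ℕ × ℕ)) : List (ℕ × ℕ) := (group L).flatMap fun n => L.map (actPair n)

def goodCheck (L L' : List (ℕ × ℕ)) : Bool :=
  elems.all fun x => polyCoeff (group L) (group L') x != 0 ||
    (orbit L).any fun r => (orbit L').any (unorderedEq (actPair x r))

theorem vec_mem_rootsOf {L : List (ℕ × ℕ)} (h : systemCheck L = true) {r : ℕ × ℕ}
    (hr : r ∈ orbit L) : vec r ∈ rootsOf Φ (vecs L) ∧ r.1 < 8 ∧ r.2 < 8 := by
  simp only [orbit, List.mem_flatMap, List.mem_map] at hr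
  obtain ⟨n, hn, p, hp, rfl⟩ := hr
  refine ⟨?_, actPair_lt _ _⟩
  obtain ⟨u, rfl⟩ := exists_eq_code ((presents_group h).subset n hn)
  rw [← apply_vec u (roots_lt ((systemCheck_spec h).2.1 p hp))]
  exact ⟨u, ((presents_group h).mem_iff u).2 hn, vec p, ⟨p, hp, rfl⟩, rfl⟩

theorem isGoodSystem_vecs {K : Type*} [Field K] [CharZero K] {L L' : List (ℕ × ℕ)}
    (h : systemCheck L = true) (h' : systemCheck L' = true)
    (hu : IsUsefulSystem Φ π (vecs L) (vecs L')) (hg : goodCheck L L' = true) :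
    IsGoodSystem K Φ π (vecs L) (vecs L') := by
  refine ⟨hu, fun d _ hd => ?_⟩
  have h1 := List.all_eq_true.1 hg _ (code_mem d)
  simp only [Bool.or_eq_true, bne_iff_ne, List.any_eq_true] at h1
  rcases h1 with h1 | ⟨r, hr, r', hr', hrr⟩
  · rw [polytabloid_coeff (presents_group h) (presents_group h') hu.inf_eq_bot]
    exact_mod_cast h1
  · exfalso
    obtain ⟨h2, h3⟩ := vec_mem_rootsOf h hr
    obtain ⟨h4, -⟩ := vec_mem_rootsOf h' hr'
    have h5 : vec r' ∈ ((d : V4 ≃ₗᵢ[ℝ] V4) '' rootsOf Φ (vecs L)) ∩ rootsOf Φ (vecs L') :=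
      ⟨⟨vec r, h2, by rw [apply_vec d h3, vec_eq_of_unorderedEq hrr]⟩, h4⟩
    rw [hd] at h5
    exact h5

end Systems

section ExtendedDiagram

/-- The nodes of the extended Dynkin diagram. -/
def extendedRoots : List (ℕ × ℕ) := (4, 5) :: simpleRoots

def extendedCheck (L : List (ℕ × ℕ)) : Bool :=
  elems.any fun x => (L.all fun p => extendedRoots.any fun q => unorderedEq (actPair x q) p) &&
    extendedRoots.any fun q => L.all fun p =>
      (List.finRange 4).any fun i => vecCoord (actPair x q) i != vecCoord p i

theorem π_eq_vecs : π = vecs simpleRoots := by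
  ext v
  constructor
  · rintro ⟨i, rfl⟩
    exact ⟨_, List.getElem_mem _, vec_simpleRoots i⟩
  · rintro ⟨p, hp, rfl⟩
    obtain ⟨i, hi, rfl⟩ := List.getElem_of_mem hp
    exact ⟨⟨i, hi⟩, vec_simpleRoots ⟨i, hi⟩⟩

theorem vec_neg_highest : vec (4, 5) = -vec (0, 1) := by
  rw [vec, vec, neg_add, ← pt_xor 0 (by norm_num), ← pt_xor 1 (by norm_num)]
  rfl

theorem insert_neg_highest : insert (-vec (0, 1)) π = vecs extendedRoots := by
  rw [π_eq_vecs, ← vec_neg_highest]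
  ext v
  simp [vecs, extendedRoots]

theorem isExtendedSubsystem_delete {K : Set V4} (hK : K ⊆ vecs extendedRoots)
    (hK' : ¬ vecs extendedRoots ⊆ K) : IsExtendedSubsystem Φ π ⊤ K (WJ K) := by
  have h := IsExtendedSubsystem.base (Φ := Φ) (J₀ := π) (G₀ := ⊤)
  have h1 := h.delete π subset_rfl (by simp) (vec (0, 1)) ?_ ?_ ?_ K
    (insert_neg_highest ▸ hK) (insert_neg_highest ▸ hK')
  · convert h1 using 1
    rw [WJ, reflSubgroup]
    congr 1
    ext g
    simp only [Set.mem_ofPred_eq, Subgroup.mem_top, true_and, span_π, Submodule.mem_top,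
      forall_const]
    refine exists_congr fun α => and_congr_right fun _ => ⟨fun hg v => by rw [hg], fun hg => ?_⟩
    exact LinearIsometryEquiv.ext hg
  · have : ∃ x ∈ elems, unorderedEq (actPair x (0, 5)) (0, 1) = true := by
      have : (elems.any fun x => unorderedEq (actPair x (0, 5)) (0, 1)) = true := by decide +kernel
      exact List.any_eq_true.1 this
    obtain ⟨x, hx, hxe⟩ := this
    obtain ⟨g, rfl⟩ := exists_eq_code hx
    refine ⟨g, Subgroup.mem_top _, vec (0, 5), ?_, ?_⟩
    · rw [π_eq_vecs]; exact ⟨_, by decide, rfl⟩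
    · rw [apply_vec g (by decide), vec_eq_of_unorderedEq hxe]
  · rw [span_π]; exact Submodule.mem_top
  · rintro g - j ⟨i, rfl⟩ -
    obtain ⟨p, hp, hgp⟩ := mem_Φ_iff.1 (apply_mem_Φ g (α_mem i))
    rw [hgp]
    refine mem_span_nnreal_π (c := fun i => vecCoord (0, 1) i - vecCoord p i) (fun i => ?_) ?_
    · rw [PiLp.sub_apply, vec_apply, vec_apply]; push_cast; rfl
    · have : ∀ p ∈ roots, isNonneg (fun i => vecCoord (0, 1) i - vecCoord p i) = true := by
        decide +kernel
      exact this p hp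

theorem map_conj_WJ (w : W) (K : Set V4) :
    (WJ K).map (MulAut.conj w).toMonoidHom = WJ ((w : V4 ≃ₗᵢ[ℝ] V4) '' K) := by
  rw [WJ, reflSubgroup, MonoidHom.map_closure, WJ, reflSubgroup]
  congr 1
  ext g
  constructor
  · rintro ⟨u, ⟨α, hα, hu⟩, rfl⟩
    refine ⟨_, ⟨α, hα, rfl⟩, ?_⟩
    rw [refl_map, ← hu]; rfl
  · rintro ⟨_, ⟨α, hα, rfl⟩, hg⟩
    refine ⟨w⁻¹ * g * w, ⟨α, hα, ?_⟩, ?_⟩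
    · rw [Subgroup.coe_mul, Subgroup.coe_mul, hg, refl_map, Subgroup.coe_inv]
      group
    · change w * (w⁻¹ * g * w) * w⁻¹ = g
      group

theorem isExtendedSubsystem_vecs {L : List (ℕ × ℕ)} (h : extendedCheck L = true) :
    IsExtendedSubsystem Φ π ⊤ (vecs L) (WJ (vecs L)) := by
  obtain ⟨x, hx, h1⟩ := List.any_eq_true.1 h
  obtain ⟨w, rfl⟩ := exists_eq_code hx
  rw [Bool.and_eq_true, List.all_eq_true, List.any_eq_true] at h1
  obtain ⟨h1, q, hq, h2⟩ := h1
  have hlt : ∀ q ∈ extendedRoots, q.1 < 8 ∧ q.2 < 8 := by decide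
  let K : Set V4 := {v | v ∈ vecs extendedRoots ∧ (w : V4 ≃ₗᵢ[ℝ] V4) v ∈ vecs L}
  have hKL : (w : V4 ≃ₗᵢ[ℝ] V4) '' K = vecs L := by
    apply Set.Subset.antisymm
    · rintro _ ⟨v, hv, rfl⟩
      exact hv.2
    · rintro _ ⟨p, hp, rfl⟩
      obtain ⟨q, hq, hqp⟩ := List.any_eq_true.1 (h1 p hp)
      have h3 : (w : V4 ≃ₗᵢ[ℝ] V4) (vec q) = vec p := by
        rw [apply_vec w (hlt q hq), vec_eq_of_unorderedEq hqp]
      exact ⟨vec q, ⟨⟨q, hq, rfl⟩, p, hp, h3⟩, h3⟩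
  have hK' : ¬ vecs extendedRoots ⊆ K := by
    intro hc
    obtain ⟨-, p, hp, hqp⟩ := hc ⟨q, hq, rfl⟩
    obtain ⟨i, -, hi⟩ := List.any_eq_true.1 (List.all_eq_true.1 h2 p hp)
    rw [bne_iff_ne] at hi
    apply hi
    rw [apply_vec w (hlt q hq)] at hqp
    have := congrArg (fun v : V4 => v i) hqp
    simpa [vec_apply] using this
  have h4 := (isExtendedSubsystem_delete (fun v hv => hv.1) hK').conj w (Subgroup.mem_top _)
  rwa [map_conj_WJ, hKL] at h4

end ExtendedDiagram

section Tables

def rowL : Fin 11 → List (ℕ × ℕ) := ![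
  [(0, 5), (1, 6), (2, 7)], [(0, 5), (1, 6), (2, 3)], [(1, 6), (2, 7), (2, 3)],
  [(0, 5), (0, 1), (2, 7), (2, 3)], [(0, 5), (2, 7), (2, 3)], [(0, 5), (1, 6)],
  [(0, 5), (2, 7)], [(0, 5), (2, 3)], [(2, 7), (2, 3)],
  [(0, 5), (1, 6), (2, 7), (2, 3)], []]

def colL : Fin 11 → List (ℕ × ℕ) := ![
  [(0, 3), (1, 2)], [(0, 7), (1, 2)], [(0, 7), (0, 3)], [(0, 6), (1, 7), (1, 3)],
  [(0, 2), (1, 6)], [(0, 7), (0, 3), (1, 2)], [(2, 3), (0, 6), (1, 7)],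
  [(2, 7), (1, 3), (0, 6)], [(0, 5), (1, 3), (1, 7)], [],
  [(0, 5), (1, 6), (2, 7), (2, 3)]]

/-- The numbers `|W| / χ(1)`. -/
def rowIndex : Fin 11 → ℤ := ![64, 64, 64, 96, 24, 24, 64, 64, 64, 192, 192]

/-- The indices of the characters in the character table. -/
def rowNumber : Fin 11 → Fin 13 := ![3, 8, 4, 2, 12, 12, 5, 7, 6, 0, 1]

theorem rowNumber_add_one (r : Fin 11) : (rowNumber r : ℕ) + 1 = rowChar r := by
  fin_cases r <;> rfl

theorem rt_eq_vec {a b c d : ℤ} {p : ℕ × ℕ} (h : ∀ i, vecCoord p i = ![a, b - a, c + d - b, d - c] i) :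
    rt a b c d = vec p := by
  rw [rt_apply]
  ext i
  rw [vec_apply, h]
  fin_cases i <;> simp

theorem rt_0001 : rt 0 0 0 1 = vec (2, 3) := by
  simpa using rt_eq_vec (a := 0) (b := 0) (c := 0) (d := 1) (p := (2, 3)) (by decide)
theorem rt_0010 : rt 0 0 1 0 = vec (2, 7) := by
  simpa using rt_eq_vec (a := 0) (b := 0) (c := 1) (d := 0) (p := (2, 7)) (by decide)
theorem rt_0100 : rt 0 1 0 0 = vec (1, 6) := by
  simpa using rt_eq_vec (a := 0) (b := 1) (c := 0) (d := 0) (p := (1, 6)) (by decide)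
theorem rt_0101 : rt 0 1 0 1 = vec (1, 3) := by
  simpa using rt_eq_vec (a := 0) (b := 1) (c := 0) (d := 1) (p := (1, 3)) (by decide)
theorem rt_0110 : rt 0 1 1 0 = vec (1, 7) := by
  simpa using rt_eq_vec (a := 0) (b := 1) (c := 1) (d := 0) (p := (1, 7)) (by decide)
theorem rt_0111 : rt 0 1 1 1 = vec (1, 2) := by
  simpa using rt_eq_vec (a := 0) (b := 1) (c := 1) (d := 1) (p := (1, 2)) (by decide)
theorem rt_1000 : rt 1 0 0 0 = vec (0, 5) := by
  simpa using rt_eq_vec (a := 1) (b := 0) (c := 0) (d := 0) (p := (0, 5)) (by decide)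
theorem rt_1100 : rt 1 1 0 0 = vec (0, 6) := by
  simpa using rt_eq_vec (a := 1) (b := 1) (c := 0) (d := 0) (p := (0, 6)) (by decide)
theorem rt_1101 : rt 1 1 0 1 = vec (0, 3) := by
  simpa using rt_eq_vec (a := 1) (b := 1) (c := 0) (d := 1) (p := (0, 3)) (by decide)
theorem rt_1110 : rt 1 1 1 0 = vec (0, 7) := by
  simpa using rt_eq_vec (a := 1) (b := 1) (c := 1) (d := 0) (p := (0, 7)) (by decide)
theorem rt_1111 : rt 1 1 1 1 = vec (0, 2) := by
  simpa using rt_eq_vec (a := 1) (b := 1) (c := 1) (d := 1) (p := (0, 2)) (by decide)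
theorem rt_1211 : rt 1 2 1 1 = vec (0, 1) := by
  simpa using rt_eq_vec (a := 1) (b := 2) (c := 1) (d := 1) (p := (0, 1)) (by decide)

theorem vecs_nil : vecs [] = ∅ := by ext; simp [vecs]

theorem vecs_cons (p : ℕ × ℕ) (L : List (ℕ × ℕ)) : vecs (p :: L) = insert (vec p) (vecs L) := by
  ext; simp [vecs]

theorem vecs_singleton (p : ℕ × ℕ) : vecs [p] = {vec p} := by
  rw [vecs_cons, vecs_nil, insert_empty_eq]

theorem rowJ_eq (r : Fin 11) : rowJ r = vecs (rowL r) := by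
  fin_cases r <;>
    simp [rowJ, rowL, vecs_cons, vecs_nil, rt_0001, rt_0010, rt_0100, rt_1000, rt_1211]

theorem colJ_eq (r : Fin 11) : colJ r = vecs (colL r) := by
  fin_cases r <;>
    simp [colJ, colL, vecs_cons, vecs_nil, rt_0001, rt_0010, rt_0100, rt_0101, rt_0110, rt_0111,
      rt_1000, rt_1100, rt_1101, rt_1110, rt_1111]

end Tables

section Checks

def pairCheck (r : Fin 11) : Bool :=
  systemCheck (rowL r) && systemCheck (colL r) && extendedCheck (rowL r) &&
    extendedCheck (colL r) && disjointCheck (group (rowL r)) (group (colL r)) &&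
    (orthCheck (rowL r) || orthCheck (colL r)) && goodCheck (rowL r) (colL r) &&
    coverCheck (group (rowL r)) (group (colL r)) 

theorem pairCheck_eq_true (r : Fin 11) : pairCheck r = true := by
  revert r; decide +kernel

theorem charCheck_pair (r : Fin 11) :
    charCheck (polyCoeff (group (rowL r)) (group (colL r))) (rowIndex r) (rowNumber r) = true := by
  revert r; decide +kernel

end Checks

section Generators

variable {K : Type*} [Field K] [CharZero K]

theorem generatesRow_polytabloid {H H' : Subgroup W} {h h' : List ℕ} (hH : Presents H h)
    (hH' : Presents H' h') (hd : disjointCheck h h' = true) (hc : coverCheck h h' = true)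
    {n : ℤ} {i : Fin 13} (hchk : charCheck (polyCoeff h h') n i = true) :
    GeneratesRow (polytabloid K (sign Φ π) H H') i := by
  rw [polytabloid_eq_signedSum]
  exact generatesRow_of_check (isSignFunction_sign H') (covers_sign hH hH' hc)
    (tabloidCoeff_eq_polyCoeff hH hH' (inf_eq_bot_of_check hH hH' hd)) hchk

/-- The code of `-1`. -/
def cneg : ℕ := ofDigits4 4 5 6 7

theorem code_longest : code (classRep 10) = cneg := by
  rw [code_classRep]; decide +kernel

theorem mul_longest (g : W) : g * classRep 10 = classRep 10 * g := by
  apply code_injective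
  rw [code_mul, code_mul, code_longest]
  have : ∀ x ∈ elems, cmul x cneg = cmul cneg x := by decide +kernel
  exact this _ (code_mem g)

theorem longest_mul_self : classRep 10 * classRep 10 = 1 := by
  apply code_injective
  rw [code_mul, code_longest, code_one]
  decide +kernel

/-- The coefficients of `e - (-1) e`. -/
def twistCoeff (h h' : List ℕ) (x : ℕ) : ℤ := polyCoeff h h' x - polyCoeff h h' (cmul cneg x)

def twistCheck (h h' : List ℕ) : Bool :=
  let m := bits h
  !(bits h').testBit cneg && elems.all fun x =>
    polyCoeff h h' x != 0 || polyCoeff h h' (cmul cneg x) != 0 ||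
    h'.any fun t => (sgn t == -1 && m.testBit (cmul (cmul (cinv x) t) x)) ||
      (sgn t == 1 && m.testBit (cmul (cmul (cinv x) (cmul cneg t)) x))

theorem generatesRow_sub_twist {H H' : Subgroup W} {h h' : List ℕ} (hH : Presents H h)
    (hH' : Presents H' h') (hd : disjointCheck h h' = true) (hc : twistCheck h h' = true)
    {n : ℤ} {i : Fin 13} (hchk : charCheck (twistCoeff h h') n i = true) :
    GeneratesRow (polytabloid K (sign Φ π) H H' -
      tabloidRep K H (classRep 10) (polytabloid K (sign Φ π) H H')) i := by
  have hinf := inf_eq_bot_of_check hH hH' hd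
  simp only [twistCheck, Bool.and_eq_true, Bool.not_eq_true', List.all_eq_true] at hc
  obtain ⟨hz, hc⟩ := hc
  have hzH : classRep 10 ∉ H' := by
    intro hmem
    rw [hH'.mem_iff, code_longest, ← testBit_bits, hz] at hmem
    cases hmem
  have hzu : ∀ u ∈ H', classRep 10 * u ∉ H' := fun u hu hm =>
    hzH ((H'.mul_mem_cancel_right hu).1 hm)
  have h1 : ∀ u ∈ H', twist (classRep 10) (signOn (sign Φ π) H') u = sign Φ π u := fun u hu => by
    rw [twist, signOn_of_mem hu, signOn_of_notMem (hzu u hu), sub_zero]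
  have h2 : ∀ u ∈ H', twist (classRep 10) (signOn (sign Φ π) H') (classRep 10 * u) =
      -sign Φ π u := fun u hu => by
    rw [twist, ← mul_assoc, longest_mul_self, one_mul, signOn_of_mem hu,
      signOn_of_notMem (hzu u hu), zero_sub]
  rw [polytabloid_eq_signedSum, ← signedSum_twist longest_mul_self]
  refine generatesRow_of_check
    (isSignFunction_twist sign_mul sign_one mul_longest longest_mul_self hzH) ?_ ?_ hchk
  · intro w
    have h3 := hc _ (code_mem w)
    simp only [Bool.or_eq_true, List.any_eq_true, Bool.and_eq_true, bne_iff_ne, beq_iff_eq,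
      testBit_bits] at h3
    rcases h3 with (h3 | h3) | ⟨t, ht, h3⟩
    · obtain ⟨u, hu, hw⟩ := exists_of_polyCoeff_ne_zero hH hH' h3
      exact .inl ⟨u, by rw [h1 u hu]; exact sign_ne_zero u, hw⟩
    · rw [← code_longest, ← code_mul] at h3
      obtain ⟨u, hu, hw⟩ := exists_of_polyCoeff_ne_zero hH hH' h3
      refine .inl ⟨classRep 10 * u, by rw [h2 u hu]; exact neg_ne_zero.2 (sign_ne_zero u), ?_⟩
      rwa [mul_inv_rev, inv_eq_of_mul_eq_one_left longest_mul_self, mul_assoc]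
    · obtain ⟨u, rfl⟩ := exists_eq_code (hH'.subset _ ht)
      have hu := (hH'.mem_iff u).2 ht
      rcases h3 with ⟨hs, h3⟩ | ⟨hs, h3⟩
      · refine .inr ⟨u, by rw [h1 u hu, sign_eq_sgn, hs], ?_⟩
        rw [hH.mem_iff, code_mul, code_mul, code_inv]
        exact h3
      · refine .inr ⟨classRep 10 * u, by rw [h2 u hu, sign_eq_sgn, hs], ?_⟩
        rw [hH.mem_iff, code_mul, code_mul, code_inv, code_mul, code_longest]
        exact h3
  · intro w
    rw [tabloidCoeff_twist, tabloidCoeff_eq_polyCoeff hH hH' hinf,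
      tabloidCoeff_eq_polyCoeff hH hH' hinf, code_mul, code_longest, twistCoeff]

end Generators

section Sums

variable {K : Type*} [Field K]

/-- The polytabloid of the second pair is the sum of the polytabloid of the first pair and its
image under `-1`. -/
def sumCheck (h h₁ h₂ : List ℕ) : Bool :=
  elems.all fun x => polyCoeff h h₂ x == polyCoeff h h₁ x + polyCoeff h h₁ (cmul cneg x)

theorem polytabloid_eq_add {H H₁ H₂ : Subgroup W} {h h₁ h₂ : List ℕ} (hH : Presents H h)
    (hH₁ : Presents H₁ h₁) (hH₂ : Presents H₂ h₂) (hd₁ : disjointCheck h h₁ = true)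
    (hd₂ : disjointCheck h h₂ = true) (hs : sumCheck h h₁ h₂ = true) :
    polytabloid K (sign Φ π) H H₂ = polytabloid K (sign Φ π) H H₁ +
      tabloidRep K H (classRep 10) (polytabloid K (sign Φ π) H H₁) := by
  refine coeff_ext fun w => ?_
  have h1 := beq_iff_eq.1 (List.all_eq_true.1 hs _ (code_mem w))
  rw [polytabloid_coeff hH hH₂ (inf_eq_bot_of_check hH hH₂ hd₂), h1, MonoidAlgebra.coeff_add,
    Finsupp.add_apply, tabloidRep_coeff, polytabloid_coeff hH hH₁ (inf_eq_bot_of_check hH hH₁ hd₁),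
    polytabloid_coeff hH hH₁ (inf_eq_bot_of_check hH hH₁ hd₁), code_mul,
    inv_eq_of_mul_eq_one_left longest_mul_self, code_longest, Int.cast_add]


end Sums

section Instances

theorem systemCheck_rowL (r : Fin 11) : systemCheck (rowL r) = true := by
  have h := pairCheck_eq_true r
  simp only [pairCheck, Bool.and_eq_true] at h
  exact h.1.1.1.1.1.1.1

theorem systemCheck_colL (r : Fin 11) : systemCheck (colL r) = true := by
  have h := pairCheck_eq_true r
  simp only [pairCheck, Bool.and_eq_true] at h
  exact h.1.1.1.1.1.1.2

theorem presents_rowJ (r : Fin 11) : Presents (WJ (rowJ r)) (group (rowL r)) := by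
  rw [rowJ_eq]; exact presents_group (systemCheck_rowL r)

theorem presents_colJ (r : Fin 11) : Presents (WJ (colJ r)) (group (colL r)) := by
  rw [colJ_eq]; exact presents_group (systemCheck_colL r)

/-- The codes of the elements of `W(G₂)`. -/
def groupG2 : List ℕ := close [wordCode [1], wordCode [0, 2, 3]]

/-- The codes of the elements of `W(B₃)`. -/
def groupB3 : List ℕ := close [wordCode [1], wordCode [3], cmul (reflCode (0, 5)) (reflCode (0, 1))]

theorem code_τ₂ : code τ₂ = wordCode [1] := by rw [← code_prod_τ]; simp [τ₂]
theorem code_τ₄ : code τ₄ = wordCode [3] := by rw [← code_prod_τ]; simp [τ₄]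
theorem code_τ₁τ₃τ₄ : code (τ₁ * τ₃ * τ₄) = wordCode [0, 2, 3] := by
  rw [← code_prod_τ]; simp [τ₁, τ₃, τ₄, mul_assoc]

theorem presents_WG2 : Presents WG2 groupG2 := by
  refine presents_closure ?_ ?_ (by decide +kernel)
  · rintro t (rfl | rfl)
    · rw [code_τ₂]; simp
    · rw [code_τ₁τ₃τ₄]; simp
  · intro g hg
    simp only [List.mem_cons, List.not_mem_nil, or_false] at hg
    rcases hg with rfl | rfl
    · exact ⟨_, .inl rfl, code_τ₂⟩
    · exact ⟨_, .inr rfl, code_τ₁τ₃τ₄⟩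

theorem presents_WB3 : Presents WB3 groupB3 := by
  have h0 : ((0, 5) : ℕ × ℕ) ∈ roots := by decide
  have h1 : ((0, 1) : ℕ × ℕ) ∈ roots := by decide
  have h2 : code (reflW _ h0 * reflW _ h1) = cmul (reflCode (0, 5)) (reflCode (0, 1)) := by
    rw [code_mul, code_reflW, code_reflW]
  have h3 : ((reflW _ h0 * reflW _ h1 : W) : V4 ≃ₗᵢ[ℝ] V4) =
      refl (rt 1 0 0 0) * refl (rt 1 2 1 1) := by rw [rt_1000, rt_1211]; rfl
  refine presents_closure ?_ ?_ (by decide +kernel)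
  · rintro t (rfl | rfl | ht)
    · rw [code_τ₂]; simp
    · rw [code_τ₄]; simp
    · rw [← h3] at ht
      rw [Subtype.ext ht, h2]; simp
  · intro g hg
    simp only [List.mem_cons, List.not_mem_nil, or_false] at hg
    rcases hg with rfl | rfl | rfl
    · exact ⟨_, .inl rfl, code_τ₂⟩
    · exact ⟨_, .inr (.inl rfl), code_τ₄⟩
    · exact ⟨_, .inr (.inr h3), h2⟩

def listA1 : List (ℕ × ℕ) := [(0, 3)]
def listA2 : List (ℕ × ℕ) := [(2, 3), (1, 7)]
def listA1' : List (ℕ × ℕ) := [(0, 5)]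
def listA3' : List (ℕ × ℕ) := [(1, 6), (2, 3), (2, 7)]

theorem JA1_eq : JA1 = vecs listA1 := by rw [JA1, listA1, vecs_singleton, rt_1101]
theorem JA2_eq : JA2 = vecs listA2 := by
  rw [JA2, listA2, vecs_cons, vecs_singleton, rt_0001, rt_0110]
theorem JA1'_eq : JA1' = vecs listA1' := by rw [JA1', listA1', vecs_singleton, rt_1000]
theorem JA3'_eq : JA3' = vecs listA3' := by
  rw [JA3', listA3', vecs_cons, vecs_cons, vecs_singleton, rt_0100, rt_0001, rt_0010]

theorem smallSystems_check : ([listA1, listA2, listA1', listA3'].all fun L =>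
    systemCheck L && extendedCheck L) = true := by decide +kernel

theorem presents_JA1 : Presents (WJ JA1) (group listA1) := by
  rw [JA1_eq]
  exact presents_group (Bool.and_eq_true_iff.1 (List.all_eq_true.1 smallSystems_check _ (by simp))).1
theorem presents_JA2 : Presents (WJ JA2) (group listA2) := by
  rw [JA2_eq]
  exact presents_group (Bool.and_eq_true_iff.1 (List.all_eq_true.1 smallSystems_check _ (by simp))).1
theorem presents_JA1' : Presents (WJ JA1') (group listA1') := by
  rw [JA1'_eq]
  exact presents_group (Bool.and_eq_true_iff.1 (List.all_eq_true.1 smallSystems_check _ (by simp))).1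
theorem presents_JA3' : Presents (WJ JA3') (group listA3') := by
  rw [JA3'_eq]
  exact presents_group (Bool.and_eq_true_iff.1 (List.all_eq_true.1 smallSystems_check _ (by simp))).1

theorem isExtendedSubsystem_JA1 : IsExtendedSubsystem Φ π ⊤ JA1 (WJ JA1) := by
  rw [JA1_eq]
  exact isExtendedSubsystem_vecs
    (Bool.and_eq_true_iff.1 (List.all_eq_true.1 smallSystems_check _ (by simp))).2
theorem isExtendedSubsystem_JA2 : IsExtendedSubsystem Φ π ⊤ JA2 (WJ JA2) := by
  rw [JA2_eq]
  exact isExtendedSubsystem_vecs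
    (Bool.and_eq_true_iff.1 (List.all_eq_true.1 smallSystems_check _ (by simp))).2
theorem isExtendedSubsystem_JA1' : IsExtendedSubsystem Φ π ⊤ JA1' (WJ JA1') := by
  rw [JA1'_eq]
  exact isExtendedSubsystem_vecs
    (Bool.and_eq_true_iff.1 (List.all_eq_true.1 smallSystems_check _ (by simp))).2
theorem isExtendedSubsystem_JA3' : IsExtendedSubsystem Φ π ⊤ JA3' (WJ JA3') := by
  rw [JA3'_eq]
  exact isExtendedSubsystem_vecs
    (Bool.and_eq_true_iff.1 (List.all_eq_true.1 smallSystems_check _ (by simp))).2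

theorem checks_G2 : (disjointCheck groupG2 (group listA2) && coverCheck groupG2 (group listA2) &&
    charCheck (polyCoeff groupG2 (group listA2)) 32 11) = true := by decide +kernel

theorem checks_A3 : (disjointCheck (group (rowL 0)) (group listA1) &&
    twistCheck (group (rowL 0)) (group listA1) &&
    charCheck (twistCoeff (group (rowL 0)) (group listA1)) 48 10 &&
    sumCheck (group (rowL 0)) (group listA1) (group (colL 0))) = true := by decide +kernel

theorem checks_A1 : (disjointCheck (group listA1') (group listA3') &&
    twistCheck (group listA1') (group listA3') &&
    charCheck (twistCoeff (group listA1') (group listA3')) 48 9 &&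
    disjointCheck (group listA1') groupB3 && coverCheck (group listA1') groupB3 &&
    sumCheck (group listA1') (group listA3') groupB3) = true := by decide +kernel

end Instances

section Modules

variable (K : Type*) [Field K] [CharZero K]

theorem isGoodDual_of_check {H H' : Subgroup W} {h h' : List ℕ} (hH : Presents H h)
    (hH' : Presents H' h') (hsw : IsSWSubgroup Φ π H) (hsw' : IsSWSubgroup Φ π H')
    (hd : disjointCheck h h' = true) (hc : coverCheck h h' = true) : IsGoodDual K Φ π H H' :=
  ⟨⟨hsw, hsw', inf_eq_bot_of_check hH hH' hd⟩,
    coeff_ne_zero_of_check hH hH' (inf_eq_bot_of_check hH hH' hd) hc⟩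

theorem pairCheck_spec (r : Fin 11) : extendedCheck (rowL r) = true ∧ extendedCheck (colL r) = true ∧
    disjointCheck (group (rowL r)) (group (colL r)) = true ∧
    (orthCheck (rowL r) || orthCheck (colL r)) = true ∧ goodCheck (rowL r) (colL r) = true ∧
    coverCheck (group (rowL r)) (group (colL r)) = true := by
  have h := pairCheck_eq_true r
  simp only [pairCheck, Bool.and_eq_true] at h
  exact ⟨h.1.1.1.1.1.2, h.1.1.1.1.2, h.1.1.1.2, h.1.1.2, h.1.2, h.2⟩

theorem isExtendedSubsystem_rowJ (r : Fin 11) : IsExtendedSubsystem Φ π ⊤ (rowJ r) (WJ (rowJ r)) := by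
  rw [rowJ_eq]; exact isExtendedSubsystem_vecs (pairCheck_spec r).1

theorem isExtendedSubsystem_colJ (r : Fin 11) : IsExtendedSubsystem Φ π ⊤ (colJ r) (WJ (colJ r)) := by
  rw [colJ_eq]; exact isExtendedSubsystem_vecs (pairCheck_spec r).2.1

theorem generatesRow_pair (r : Fin 11) :
    GeneratesRow (polytabloid K (sign Φ π) (WJ (rowJ r)) (WJ (colJ r))) (rowNumber r) :=
  generatesRow_polytabloid (presents_rowJ r) (presents_colJ r) (pairCheck_spec r).2.2.1
    (pairCheck_spec r).2.2.2.2.2 (charCheck_pair r)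

theorem isGoodSystem_pair (r : Fin 11) : IsGoodSystem K Φ π (rowJ r) (colJ r) := by
  obtain ⟨-, -, hd, ho, hg, -⟩ := pairCheck_spec r
  rw [rowJ_eq, colJ_eq]
  exact isGoodSystem_vecs (systemCheck_rowL r) (systemCheck_colL r)
    (isUsefulSystem_vecs (systemCheck_rowL r) (systemCheck_colL r) hd ho) hg

theorem isGoodDual_pair (r : Fin 11) : IsGoodDual K Φ π (WJ (rowJ r)) (WJ (colJ r)) :=
  isGoodDual_of_check K (presents_rowJ r) (presents_colJ r) ⟨_, isExtendedSubsystem_rowJ r⟩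
    ⟨_, isExtendedSubsystem_colJ r⟩ (pairCheck_spec r).2.2.1 (pairCheck_spec r).2.2.2.2.2

theorem generatesRow_G2 : GeneratesRow (polytabloid K (sign Φ π) WG2 (WJ JA2)) 11 := by
  have h := checks_G2
  simp only [Bool.and_eq_true] at h
  exact generatesRow_polytabloid presents_WG2 presents_JA2 h.1.1 h.1.2 h.2

theorem isGoodDual_G2 (hsw : IsSWSubgroup Φ π WG2) : IsGoodDual K Φ π WG2 (WJ JA2) := by
  have h := checks_G2
  simp only [Bool.and_eq_true] at h
  exact isGoodDual_of_check K presents_WG2 presents_JA2 hsw ⟨_, isExtendedSubsystem_JA2⟩ h.1.1 h.1.2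

theorem generatesRow_A3 : GeneratesRow (polytabloid K (sign Φ π) (WJ JA3) (WJ JA1) -
    tabloidRep K _ (classRep 10) (polytabloid K (sign Φ π) (WJ JA3) (WJ JA1))) 10 := by
  have h := checks_A3
  simp only [Bool.and_eq_true] at h
  exact generatesRow_sub_twist (presents_rowJ 0) presents_JA1 h.1.1.1 h.1.1.2 h.1.2

theorem polytabloid_A3 : polytabloid K (sign Φ π) (WJ JA3) (WJ J2A1) =
    polytabloid K (sign Φ π) (WJ JA3) (WJ JA1) +
      tabloidRep K _ (classRep 10) (polytabloid K (sign Φ π) (WJ JA3) (WJ JA1)) := by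
  have h := checks_A3
  simp only [Bool.and_eq_true] at h
  exact polytabloid_eq_add (presents_rowJ 0) presents_JA1 (presents_colJ 0) h.1.1.1
    (pairCheck_spec 0).2.2.1 h.2

theorem isUsefulDual_A3 : IsUsefulDual Φ π (WJ JA3) (WJ JA1) := by
  have h := checks_A3
  simp only [Bool.and_eq_true] at h
  exact ⟨⟨_, isExtendedSubsystem_rowJ 0⟩, ⟨_, isExtendedSubsystem_JA1⟩,
    inf_eq_bot_of_check (presents_rowJ 0) presents_JA1 h.1.1.1⟩

theorem generatesRow_A1 : GeneratesRow (polytabloid K (sign Φ π) (WJ JA1') (WJ JA3') -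
    tabloidRep K _ (classRep 10) (polytabloid K (sign Φ π) (WJ JA1') (WJ JA3'))) 9 := by
  have h := checks_A1
  simp only [Bool.and_eq_true] at h
  exact generatesRow_sub_twist presents_JA1' presents_JA3' h.1.1.1.1.1 h.1.1.1.1.2 h.1.1.1.2

theorem polytabloid_A1 : polytabloid K (sign Φ π) (WJ JA1') WB3 =
    polytabloid K (sign Φ π) (WJ JA1') (WJ JA3') +
      tabloidRep K _ (classRep 10) (polytabloid K (sign Φ π) (WJ JA1') (WJ JA3')) := by
  have h := checks_A1
  simp only [Bool.and_eq_true] at h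
  exact polytabloid_eq_add presents_JA1' presents_JA3' presents_WB3 h.1.1.1.1.1 h.1.1.2 h.2

theorem isUsefulDual_A1 : IsUsefulDual Φ π (WJ JA1') (WJ JA3') := by
  have h := checks_A1
  simp only [Bool.and_eq_true] at h
  exact ⟨⟨_, isExtendedSubsystem_JA1'⟩, ⟨_, isExtendedSubsystem_JA3'⟩,
    inf_eq_bot_of_check presents_JA1' presents_JA3' h.1.1.1.1.1⟩

theorem isGoodDual_A1 (hsw : IsSWSubgroup Φ π WB3) : IsGoodDual K Φ π (WJ JA1') WB3 := by
  have h := checks_A1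
  simp only [Bool.and_eq_true] at h
  exact isGoodDual_of_check K presents_JA1' presents_WB3 ⟨_, isExtendedSubsystem_JA1'⟩ hsw
    h.1.1.2 h.1.2

theorem subquotient_A3 : Nonempty ((subquotient (S K (WJ JA3) (WJ JA1)) (S K (WJ JA3) (WJ J2A1))).Equiv
    (cyclic (polytabloid K (sign Φ π) (WJ JA3) (WJ JA1) - tabloidRep K _ (classRep 10)
      (polytabloid K (sign Φ π) (WJ JA3) (WJ JA1)))).toRepresentation) :=
  subquotient_equiv_cyclic mul_longest longest_mul_self (polytabloid_A3 K)

theorem subquotient_A1 : Nonempty ((subquotient (S K (WJ JA1') (WJ JA3')) (S K (WJ JA1') WB3)).Equiv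
    (cyclic (polytabloid K (sign Φ π) (WJ JA1') (WJ JA3') - tabloidRep K _ (classRep 10)
      (polytabloid K (sign Φ π) (WJ JA1') (WJ JA3')))).toRepresentation) :=
  subquotient_equiv_cyclic mul_longest longest_mul_self (polytabloid_A1 K)

/-- The listed modules exhaust the irreducible modules. -/
theorem exists_equiv_of_isIrreducible {M : Type*} [AddCommGroup M] [Module K M]
    (ρ : Representation K W M) [ρ.IsIrreducible] :
    (∃! n : ℕ, Affords ρ n) ∧
      ((∃ r : Fin 11,
          Nonempty (ρ.Equiv (S K (WJ (rowJ r)) (WJ (colJ r))).toRepresentation)) ∨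
        Nonempty (ρ.Equiv (S K WG2 (WJ JA2)).toRepresentation) ∨
        Nonempty (ρ.Equiv (subquotient (S K (WJ JA3) (WJ JA1)) (S K (WJ JA3) (WJ J2A1)))) ∨
        Nonempty (ρ.Equiv
          (subquotient (S K (WJ JA1') (WJ JA3')) (S K (WJ JA1') WB3)))) := by
  have key : ∀ i : Fin 13, ∃ (H : Subgroup W) (e : MonoidAlgebra K (W ⧸ H)), GeneratesRow e i ∧
      (Nonempty (ρ.Equiv (cyclic e).toRepresentation) →
        (∃ r : Fin 11,
          Nonempty (ρ.Equiv (S K (WJ (rowJ r)) (WJ (colJ r))).toRepresentation)) ∨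
        Nonempty (ρ.Equiv (S K WG2 (WJ JA2)).toRepresentation) ∨
        Nonempty (ρ.Equiv (subquotient (S K (WJ JA3) (WJ JA1)) (S K (WJ JA3) (WJ J2A1)))) ∨
        Nonempty (ρ.Equiv
          (subquotient (S K (WJ JA1') (WJ JA3')) (S K (WJ JA1') WB3)))) := by
    intro i
    have hi : (∃ r, rowNumber r = i) ∨ i = 11 ∨ i = 10 ∨ i = 9 := by revert i; decide
    rcases hi with ⟨r, rfl⟩ | rfl | rfl | rfl
    · exact ⟨_, _, generatesRow_pair K r, fun h => .inl ⟨r, h⟩⟩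
    · exact ⟨_, _, generatesRow_G2 K, fun h => .inr (.inl h)⟩
    · refine ⟨_, _, generatesRow_A3 K, fun ⟨φ⟩ => .inr (.inr (.inl ?_))⟩
      obtain ⟨ψ⟩ := subquotient_A3 K
      exact ⟨φ.trans ψ.symm⟩
    · refine ⟨_, _, generatesRow_A1 K, fun ⟨φ⟩ => .inr (.inr (.inr ?_))⟩
      obtain ⟨ψ⟩ := subquotient_A1 K
      exact ⟨φ.trans ψ.symm⟩
  choose H e he hlist using key
  have : Nontrivial M := by
    by_contra hM
    rw [not_nontrivial_iff_subsingleton] at hM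
    exact (bot_ne_top (α := Subrepresentation ρ)) (SetLike.ext fun x => by
      rw [Subsingleton.elim x 0]
      exact iff_of_true (Submodule.zero_mem (⊥ : Subrepresentation ρ).toSubmodule)
        (Submodule.zero_mem (⊤ : Subrepresentation ρ).toSubmodule))
  obtain ⟨i, hi⟩ := exists_coeffOp_ne_zero he ρ
  have h1 : Nonempty (ρ.Equiv (cyclic (e i)).toRepresentation) := by
    obtain ⟨n, hq, -⟩ := he i
    exact hq.nonempty_equiv ρ hi
  refine ⟨?_, hlist i h1⟩
  obtain ⟨φ⟩ := h1
  exact ⟨_, affords_of_equiv φ (he i).affords, fun n hn =>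
    hn.unique (affords_of_equiv φ (he i).affords)⟩

end Modules

section Tabloids

variable (K : Type*) [Field K]

/-- Words of the coset representatives of `W(A₃)`. -/
def tabloidWord : Fin 8 → List (Fin 4) := ![[], [3], [1, 3], [0, 1, 3], [2, 1, 3], [0, 2, 1, 3],
  [1, 0, 2, 1, 3], [3, 1, 0, 2, 1, 3]]

def tabloidCode (i : Fin 8) : ℕ := wordCode (tabloidWord i)

def tabloidElem (i : Fin 8) : W := ((tabloidWord i).map τ).prod

theorem code_tabloidElem (i : Fin 8) : code (tabloidElem i) = tabloidCode i := code_prod_τ _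

def inCoset (i : Fin 8) (x : ℕ) : Bool := (bits (group (rowL 0))).testBit (cmul (cinv (tabloidCode i)) x)

theorem inCoset_iff (i : Fin 8) (w : W) :
    inCoset i (code w) = true ↔ (tabloidElem i)⁻¹ * w ∈ WJ JA3 := by
  rw [inCoset, testBit_bits, ← code_tabloidElem, ← code_inv, ← code_mul]
  exact ((presents_rowJ 0).mem_iff _).symm

theorem inCoset_check : (elems.all fun x => (List.finRange 8).any fun i => inCoset i x &&
    (List.finRange 8).all fun j => j == i || !inCoset j x) = true := by decide +kernel

theorem existsUnique_coset (w : W) : ∃! i, ((tabloidElem i : W) : W ⧸ WJ JA3) = w := by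
  have h := List.all_eq_true.1 inCoset_check _ (code_mem w)
  simp only [List.any_eq_true, Bool.and_eq_true, List.all_eq_true, List.mem_finRange, true_and,
    forall_const, Bool.or_eq_true, beq_iff_eq, Bool.not_eq_true'] at h
  obtain ⟨i, h1, h2⟩ := h
  refine ⟨i, QuotientGroup.eq.2 ((inCoset_iff i w).1 h1), fun j hj => ?_⟩
  rcases h2 j with h3 | h3
  · exact h3
  · rw [(inCoset_iff j w).2 (QuotientGroup.eq.1 hj)] at h3
    cases h3

theorem bijective_tabloidElem :
    Function.Bijective fun i => ((tabloidElem i : W) : W ⧸ WJ JA3) := by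
  refine ⟨fun i j hij => (existsUnique_coset (tabloidElem j)).unique hij rfl, fun q => ?_⟩
  induction q using QuotientGroup.induction_on with
  | H w => exact (existsUnique_coset w).exists

/-- The coefficients of the image of the polytabloid under the element with code `c`. -/
def imageCoeff (c x : ℕ) : ℤ := polyCoeff (group (rowL 0)) (group (colL 0)) (cmul (cinv c) x)

theorem image_coeff (w g : W) :
    (tabloidRep K (WJ JA3) w (polytabloid K (sign Φ π) (WJ JA3) (WJ J2A1))).coeff (g : W ⧸ WJ JA3) =
      (imageCoeff (code w) (code g) : K) := by
  rw [tabloidRep_coeff, imageCoeff, ← code_inv, ← code_mul]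
  exact polytabloid_coeff (presents_rowJ 0) (presents_colJ 0)
    (inf_eq_bot_of_check (presents_rowJ 0) (presents_colJ 0) (pairCheck_spec 0).2.2.1) _

def indicator (i : Fin 8) (x : ℕ) : ℤ := bif inCoset i x then 1 else 0

theorem tabloidElem_coeff (i : Fin 8) (g : W) :
    (tabloid (tabloidElem i) : MonoidAlgebra K (W ⧸ WJ JA3)).coeff (g : W ⧸ WJ JA3) =
      (indicator i (code g) : K) := by
  classical
  rw [tabloid_coeff, indicator]
  by_cases h : (tabloidElem i)⁻¹ * g ∈ WJ JA3
  · rw [if_pos h, (inCoset_iff i g).2 h]; simp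
  · rw [if_neg h, Bool.eq_false_iff.2 fun hc => h ((inCoset_iff i g).1 hc)]; simp

/-- The image of the polytabloid is `t_i - t_j - t_k + t_l`. -/
def expansionCheck (c : ℕ) (i j k l : Fin 8) : Bool := elems.all fun x =>
  imageCoeff c x == indicator i x - indicator j x - indicator k x + indicator l x

theorem image_eq_of_check {w : W} {i j k l : Fin 8} (h : expansionCheck (code w) i j k l = true) :
    tabloidRep K (WJ JA3) w (polytabloid K (sign Φ π) (WJ JA3) (WJ J2A1)) =
      tabloid (tabloidElem i) - tabloid (tabloidElem j) - tabloid (tabloidElem k) +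
        tabloid (tabloidElem l) := by
  refine coeff_ext fun g => ?_
  have h1 := beq_iff_eq.1 (List.all_eq_true.1 h _ (code_mem g))
  rw [image_coeff, h1, MonoidAlgebra.coeff_add, Finsupp.add_apply, MonoidAlgebra.coeff_sub,
    Finsupp.sub_apply, MonoidAlgebra.coeff_sub, Finsupp.sub_apply, tabloidElem_coeff,
    tabloidElem_coeff, tabloidElem_coeff, tabloidElem_coeff]
  push_cast
  ring

theorem expansions : (expansionCheck (tabloidCode 0) 0 3 4 7 && expansionCheck (tabloidCode 1) 1 3 4 6 &&
    expansionCheck (tabloidCode 2) 2 3 4 5 && expansionCheck (wordCode [1]) 0 3 4 7) = true := by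
  decide +kernel

theorem image_tabloidElem :
    polytabloid K (sign Φ π) (WJ JA3) (WJ J2A1) = tabloid (tabloidElem 0) - tabloid (tabloidElem 3) -
      tabloid (tabloidElem 4) + tabloid (tabloidElem 7) ∧
    tabloidRep K (WJ JA3) (tabloidElem 1) (polytabloid K (sign Φ π) (WJ JA3) (WJ J2A1)) =
      tabloid (tabloidElem 1) - tabloid (tabloidElem 3) -
      tabloid (tabloidElem 4) + tabloid (tabloidElem 6) ∧
    tabloidRep K (WJ JA3) (tabloidElem 2) (polytabloid K (sign Φ π) (WJ JA3) (WJ J2A1)) =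
      tabloid (tabloidElem 2) - tabloid (tabloidElem 3) -
      tabloid (tabloidElem 4) + tabloid (tabloidElem 5) ∧
    tabloidRep K (WJ JA3) τ₂ (polytabloid K (sign Φ π) (WJ JA3) (WJ J2A1)) =
      polytabloid K (sign Φ π) (WJ JA3) (WJ J2A1) := by
  have h := expansions
  simp only [Bool.and_eq_true] at h
  obtain ⟨⟨⟨h0, h1⟩, h2⟩, h3⟩ := h
  rw [← code_tabloidElem] at h0 h1 h2
  rw [← code_τ₂] at h3
  have h4 := image_eq_of_check K h0
  rw [show tabloidElem 0 = 1 by rfl, map_one, Module.End.one_apply] at h4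
  exact ⟨h4, image_eq_of_check K h1, image_eq_of_check K h2,
    (image_eq_of_check K h3).trans h4.symm⟩

theorem imageCoeff_table : ∀ i j : Fin 3, imageCoeff (tabloidCode (i.castLE (by norm_num)))
    (tabloidCode (j.castLE (by norm_num))) = if i = j then 1 else 0 := by decide +kernel

theorem linearIndependent_images : LinearIndependent K fun i : Fin 3 =>
    tabloidRep K (WJ JA3) (tabloidElem (i.castLE (by norm_num)))
      (polytabloid K (sign Φ π) (WJ JA3) (WJ J2A1)) := by
  rw [Fintype.linearIndependent_iff]
  intro c hc j
  have h := congrArg (fun m : MonoidAlgebra K (W ⧸ WJ JA3) =>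
    m.coeff ((tabloidElem (j.castLE (by norm_num)) : W) : W ⧸ WJ JA3)) hc
  simp only [MonoidAlgebra.coeff_sum, MonoidAlgebra.coeff_smul, Finsupp.finsetSum_apply,
    Finsupp.smul_apply, image_coeff, code_tabloidElem, imageCoeff_table, smul_eq_mul] at h
  simpa using h

end Tabloids

section Basis

variable (K : Type*) [Field K] [CharZero K]

theorem tabloidElem_eq : tabloidElem = ![1, τ₄, τ₂ * τ₄, τ₁ * τ₂ * τ₄, τ₃ * τ₂ * τ₄,
    τ₁ * τ₃ * τ₂ * τ₄, τ₂ * τ₁ * τ₃ * τ₂ * τ₄, τ₄ * τ₂ * τ₁ * τ₃ * τ₂ * τ₄] := by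
  funext i
  fin_cases i <;> simp [tabloidElem, tabloidWord, τ₁, τ₂, τ₃, τ₄, mul_assoc]

theorem specht_A3_eq_span : (S K (WJ JA3) (WJ J2A1)).toSubmodule =
    Submodule.span K (Set.range fun i : Fin 3 =>
      tabloidRep K (WJ JA3) (tabloidElem (i.castLE (by norm_num)))
        (polytabloid K (sign Φ π) (WJ JA3) (WJ J2A1))) := by
  symm
  refine Submodule.eq_of_le_of_finrank_eq ?_ ?_
  · rw [Submodule.span_le]
    rintro _ ⟨i, rfl⟩
    exact Submodule.subset_span ⟨_, rfl⟩
  · rw [finrank_span_eq_card (linearIndependent_images K), Fintype.card_fin]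
    obtain ⟨-, -, h⟩ := generatesRow_pair K 0
    have h0 : (cyclic (polytabloid K (sign Φ π) (WJ JA3) (WJ J2A1))).toRepresentation.character 1 =
        ((charTable 3 0 : ℤ) : K) := h 0
    rw [Representation.char_one] at h0
    have h1 : ((Module.finrank K (S K (WJ JA3) (WJ J2A1)).toSubmodule : ℕ) : K) = (3 : ℕ) :=
      h0.trans (by simp [charTable])
    exact_mod_cast h1.symm

theorem τ₂_mul_self : τ₂ * τ₂ = 1 := Subtype.ext (refl_mul_self _)

end Basis

section Folding

theorem existsUnique_pos_smul {E : Type*} [NormedAddCommGroup E] [InnerProductSpace ℝ E] {J : Set E}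
    (hob : ∀ a ∈ J, ∀ b ∈ J, a ≠ b → ⟪a, b⟫ ≤ 0) (h0 : ∀ a ∈ J, a ≠ 0) {v : E} (hv : v ∈ J) :
    ∃! s, s ∈ J ∧ ∃ c : ℝ, 0 < c ∧ v = c • s := by
  refine ⟨v, ⟨hv, 1, one_pos, (one_smul ℝ v).symm⟩, ?_⟩
  rintro s ⟨hs, c, hc, hvs⟩
  by_contra hne
  have h1 := hob s hs v hv hne
  rw [hvs, real_inner_smul_right] at h1
  have h2 : 0 < ⟪s, s⟫ := real_inner_self_pos.2 (h0 s hs)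
  nlinarith

/-- Folding along an isometry; the new simple roots are given with their orthogonality relations. -/
theorem isExtendedSubsystem_fold {J₀ J : Set V4} {G₀ G : Subgroup W}
    (h : IsExtendedSubsystem Φ J₀ G₀ J G) (hspan : Submodule.span ℝ J = ⊤) (T : V4 ≃ₗᵢ[ℝ] V4)
    (hT : ∀ r ∈ J, T r ∈ J) {J₁ : Set V4} (hob : ∀ a ∈ J₁, ∀ b ∈ J₁, a ≠ b → ⟪a, b⟫ ≤ 0)
    (h0 : ∀ a ∈ J₁, a ≠ 0) (hfix : ∀ s ∈ J₁, T s = s)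
    (hproj : ∀ r ∈ J, ∃ s ∈ J₁, ∀ v, T v = v → ⟪r - s, v⟫ = 0)
    (hsurj : ∀ s ∈ J₁, ∃ r ∈ J, ∀ v, T v = v → ⟪r - s, v⟫ = 0) {G₁ : Subgroup W}
    (hG₁ : ∀ g, g ∈ G₁ ↔ g ∈ G ∧ ∀ j ∈ J, (g : V4 ≃ₗᵢ[ℝ] V4) (T j) = T ((g : V4 ≃ₗᵢ[ℝ] V4) j)) :
    IsExtendedSubsystem Φ J₀ G₀ J₁ G₁ := by
  let V₁ : Submodule ℝ V4 := LinearMap.eqLocus T.toLinearEquiv.toLinearMap LinearMap.id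
  have hV : ∀ v, v ∈ V₁ ↔ T v = v := fun v => Iff.rfl
  have hst : ∀ {r s}, s ∈ J₁ → (∀ v, T v = v → ⟪r - s, v⟫ = 0) → V₁.starProjection r = s :=
    fun hs hrs => Submodule.eq_starProjection_of_mem_of_inner_eq_zero ((hV _).2 (hfix _ hs))
      fun v hv => hrs v ((hV v).1 hv)
  refine h.fold T (fun r hr => ⟨1, one_pos, T r, hT r hr, (one_smul ℝ _).symm⟩) V₁
    (fun v => by rw [hspan, hV]; simp) J₁ ?_ ?_ G₁ fun g => ?_
  · intro s hs
    obtain ⟨r, hr, hrs⟩ := hsurj s hs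
    exact ⟨r, hr, hst hs hrs⟩
  · intro r hr
    obtain ⟨s, hs, hrs⟩ := hproj r hr
    rw [hst hs hrs]
    exact existsUnique_pos_smul hob h0 hs
  · rw [hG₁]
    refine and_congr_right fun _ => ⟨fun hg v hv => ?_, fun hg j hj => hg j (Submodule.subset_span hj)⟩
    induction hv using Submodule.span_induction with
    | mem x hx => exact hg x hx
    | zero => simp
    | add x y _ _ hx hy => simp only [map_add, hx, hy]
    | smul a x _ hx => simp only [map_smul, hx]

end Folding

section G2

/-- The triality `α₁ ↦ α₃ ↦ α₄ ↦ α₁`. -/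
def triality : V4 ≃ₗᵢ[ℝ] V4 := refl (α 0 - α 2) * refl (α 2 - α 3)

theorem triality_apply (v : V4) : triality v = WithLp.toLp 2
    ![(v 0 + v 1 + v 2 + v 3) / 2, (v 0 + v 1 - v 2 - v 3) / 2, (v 0 - v 1 + v 2 - v 3) / 2,
      (-v 0 + v 1 + v 2 - v 3) / 2] := by
  rw [triality, LinearIsometryEquiv.coe_mul, Function.comp_apply, refl_apply, refl_apply]
  ext i
  fin_cases i <;>
    simp [α, ε, EuclideanSpace.norm_sq_eq, PiLp.inner_apply, Fin.sum_univ_four] <;> ring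

theorem triality_α : triality (α 0) = α 2 ∧ triality (α 1) = α 1 ∧ triality (α 2) = α 3 ∧
    triality (α 3) = α 0 := by
  refine ⟨?_, ?_, ?_, ?_⟩ <;> rw [triality_apply] <;> ext i <;> fin_cases i <;>
    simp [α, ε] <;> norm_num

/-- The coordinates of the image under the triality, multiplied by `2`. -/
def twiceTriality (c : Fin 4 → ℤ) : Fin 4 → ℤ := ![c 0 + c 1 + c 2 + c 3, c 0 + c 1 - c 2 - c 3,
  c 0 - c 1 + c 2 - c 3, -c 0 + c 1 + c 2 - c 3]

theorem triality_eq_iff {u v : V4} {a b : Fin 4 → ℤ} (hu : ∀ i, u i = a i) (hv : ∀ i, v i = b i) :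
    u = triality v ↔ ∀ i, 2 * a i = twiceTriality b i := by
  have h : ∀ i, 2 * triality v i = (twiceTriality b i : ℝ) := by
    intro i
    rw [triality_apply]
    fin_cases i <;> simp [twiceTriality, hv] <;> ring
  constructor
  · intro huv i
    have h1 := h i
    rw [← huv, hu, ← Int.cast_ofNat, ← Int.cast_mul] at h1
    exact Int.cast_injective h1
  · intro hab
    ext i
    have h1 := h i
    rw [← hab i] at h1
    push_cast at h1
    rw [hu]
    linarith

/-- The triality on the simple roots. -/
def trialityRoots : List ((ℕ × ℕ) × (ℕ × ℕ)) :=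
  [((0, 5), (2, 7)), ((1, 6), (1, 6)), ((2, 7), (2, 3)), ((2, 3), (0, 5))]

def commutesTriality (x : ℕ) : Bool := trialityRoots.all fun pq => (List.finRange 4).all fun i =>
  2 * vecCoord (actPair x pq.2) i == twiceTriality (vecCoord (actPair x pq.1)) i

theorem groupG2_check :
    (elems.all fun x => groupG2.contains x == commutesTriality x) = true := by decide +kernel

theorem triality_vec : ∀ pq ∈ trialityRoots, triality (vec pq.1) = vec pq.2 := by
  intro pq hpq
  symm
  rw [triality_eq_iff (vec_apply _) (vec_apply _)]
  revert pq
  decide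

theorem mem_WG2_iff (g : W) : g ∈ WG2 ↔ ∀ j ∈ π,
    (g : V4 ≃ₗᵢ[ℝ] V4) (triality j) = triality ((g : V4 ≃ₗᵢ[ℝ] V4) j) := by
  have hlt : ∀ pq ∈ trialityRoots, (pq.1.1 < 8 ∧ pq.1.2 < 8) ∧ pq.2.1 < 8 ∧ pq.2.2 < 8 := by decide
  have h1 : commutesTriality (code g) = true ↔ ∀ pq ∈ trialityRoots,
      (g : V4 ≃ₗᵢ[ℝ] V4) (triality (vec pq.1)) = triality ((g : V4 ≃ₗᵢ[ℝ] V4) (vec pq.1)) := by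
    simp only [commutesTriality, List.all_eq_true, List.mem_finRange, forall_const, beq_iff_eq]
    refine forall₂_congr fun pq hpq => ?_
    rw [triality_vec pq hpq, apply_vec g (hlt pq hpq).1, apply_vec g (hlt pq hpq).2,
      triality_eq_iff (vec_apply _) (vec_apply _)]
  have h2 := beq_iff_eq.1 (List.all_eq_true.1 groupG2_check _ (code_mem g))
  rw [presents_WG2.mem_iff, ← List.elem_iff, ← List.contains, h2, h1, π_eq_vecs]
  constructor
  · rintro h _ ⟨p, hp, rfl⟩
    have : ∀ p ∈ simpleRoots, ∃ pq ∈ trialityRoots, pq.1 = p := by decide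
    obtain ⟨pq, hpq, rfl⟩ := this p hp
    exact h pq hpq
  · intro h pq hpq
    have : ∀ pq ∈ trialityRoots, pq.1 ∈ simpleRoots := by decide
    exact h _ ⟨_, this pq hpq, rfl⟩

/-- The short simple root of `G₂`. -/
def shortRoot : V4 := (1 / 3 : ℝ) • (rt 1 0 0 0 + rt 0 0 1 0 + rt 0 0 0 1)

theorem shortRoot_eq : shortRoot = WithLp.toLp 2 ![1 / 3, -1 / 3, 2 / 3, 0] := by
  rw [shortRoot, rt_apply, rt_apply, rt_apply]
  ext i
  fin_cases i <;> norm_num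

theorem JG2_eq : JG2 = {α 1, shortRoot} := by
  rw [JG2, ← shortRoot]
  congr 1
  simp [rt]

theorem triality_shortRoot : triality shortRoot = shortRoot := by
  rw [triality_apply, shortRoot_eq]
  ext i
  fin_cases i <;> simp only [Matrix.cons_val] <;> norm_num

theorem inner_sub_shortRoot {v : V4} (hv : triality v = v) {i : Fin 4} (hi : i ≠ 1) :
    ⟪α i - shortRoot, v⟫ = 0 := by
  have h3 := congrArg (fun u : V4 => u 3) hv
  have h0 := congrArg (fun u : V4 => u 0) hv
  rw [triality_apply] at h0 h3
  simp only [Matrix.cons_val] at h0 h3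
  rw [shortRoot_eq]
  fin_cases i
  all_goals first | exact absurd rfl hi | skip
  all_goals
    simp [α, ε, PiLp.inner_apply, Fin.sum_univ_four]
    linarith

theorem isExtendedSubsystem_G2 : IsExtendedSubsystem Φ π ⊤ JG2 WG2 := by
  have hne : ⟪α 1, shortRoot⟫ ≤ 0 := by
    rw [shortRoot_eq]
    simp [α, ε, PiLp.inner_apply, Fin.sum_univ_four]
    norm_num
  rw [JG2_eq]
  refine isExtendedSubsystem_fold .base span_π triality ?_ ?_ ?_ ?_ ?_ ?_ fun g => ?_
  · obtain ⟨h0, h1, h2, h3⟩ := triality_α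
    rintro _ ⟨i, rfl⟩
    fin_cases i
    · exact ⟨2, h0.symm⟩
    · exact ⟨1, h1.symm⟩
    · exact ⟨3, h2.symm⟩
    · exact ⟨0, h3.symm⟩
  · rintro a (rfl | rfl) b (rfl | rfl) hab
    · exact absurd rfl hab
    · exact hne
    · rwa [real_inner_comm]
    · exact absurd rfl hab
  · rintro a (rfl | rfl) h
    · have := congrArg (fun u : V4 => u 1) h
      simp [α, ε] at this
    · have := congrArg (fun u : V4 => u 0) h
      rw [shortRoot_eq] at this
      simp at this
  · rintro s (rfl | rfl)
    · exact triality_α.2.1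
    · exact triality_shortRoot
  · rintro _ ⟨i, rfl⟩
    by_cases hi : i = 1
    · exact ⟨α 1, .inl rfl, fun v _ => by rw [hi, sub_self, inner_zero_left]⟩
    · exact ⟨shortRoot, .inr rfl, fun v hv => inner_sub_shortRoot hv hi⟩
  · rintro s (rfl | rfl)
    · exact ⟨α 1, ⟨1, rfl⟩, fun v _ => by rw [sub_self, inner_zero_left]⟩
    · exact ⟨α 0, ⟨0, rfl⟩, fun v hv => inner_sub_shortRoot hv (by decide)⟩
  · rw [mem_WG2_iff]
    exact ⟨fun h => ⟨Subgroup.mem_top g, h⟩, fun h => h.2⟩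

end G2

section B3

/-- The part of the extended diagram that is folded to `B₃`. -/
def listB3 : List (ℕ × ℕ) := [(0, 5), (4, 5), (1, 6), (2, 3)]

/-- The reflection `ε₁ ↦ -ε₁`. -/
def flip : V4 ≃ₗᵢ[ℝ] V4 := refl (ε 0)

theorem flip_apply (v : V4) : flip v = WithLp.toLp 2 ![-v 0, v 1, v 2, v 3] := by
  rw [flip, refl_apply]
  ext i
  fin_cases i <;> simp [ε, PiLp.inner_apply] <;> ring

def flipCode : ℕ := ofDigits4 4 1 2 3

theorem hasCode_flip : HasCode flip flipCode := by
  intro x hx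
  have h : ∀ x < 8, ∀ i, (![-ptCoord x 0, ptCoord x 1, ptCoord x 2, ptCoord x 3] : Fin 4 → ℤ) i =
      ptCoord (act flipCode x) i := by decide
  rw [flip_apply]
  ext i
  rw [pt_apply (act _ _), ← h x hx i]
  fin_cases i <;> simp [pt_apply]

theorem flip_vec {p : ℕ × ℕ} (hp : p.1 < 8 ∧ p.2 < 8) : flip (vec p) = vec (actPair flipCode p) := by
  rw [vec, map_add, hasCode_flip _ hp.1, hasCode_flip _ hp.2]; rfl

theorem presents_listB3 : Presents (WJ (vecs listB3)) (group listB3) :=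
  presents_WJ (by decide) (by decide +kernel)

def commutesFlip (x : ℕ) : Bool := listB3.all fun p => (List.finRange 4).all fun i =>
  vecCoord (actPair x (actPair flipCode p)) i == vecCoord (actPair flipCode (actPair x p)) i

theorem groupB3_check : (elems.all fun x =>
    groupB3.contains x == ((group listB3).contains x && commutesFlip x)) = true := by decide +kernel

theorem vec_eq_iff (p q : ℕ × ℕ) : vec p = vec q ↔ ∀ i, vecCoord p i = vecCoord q i := by
  constructor
  · intro h i
    have := congrArg (fun v : V4 => v i) h
    simp only [vec_apply] at this
    exact_mod_cast this
  · intro h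
    ext i
    rw [vec_apply, vec_apply, h]

theorem mem_WB3_iff (g : W) : g ∈ WB3 ↔ g ∈ WJ (vecs listB3) ∧ ∀ j ∈ vecs listB3,
    (g : V4 ≃ₗᵢ[ℝ] V4) (flip j) = flip ((g : V4 ≃ₗᵢ[ℝ] V4) j) := by
  have hlt : ∀ p ∈ listB3, p.1 < 8 ∧ p.2 < 8 := by decide
  have h1 : commutesFlip (code g) = true ↔ ∀ p ∈ listB3,
      (g : V4 ≃ₗᵢ[ℝ] V4) (flip (vec p)) = flip ((g : V4 ≃ₗᵢ[ℝ] V4) (vec p)) := by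
    simp only [commutesFlip, List.all_eq_true, List.mem_finRange, forall_const, beq_iff_eq]
    refine forall₂_congr fun p hp => ?_
    rw [flip_vec (hlt p hp), apply_vec g (hlt p hp), apply_vec g (actPair_lt _ _),
      flip_vec (actPair_lt _ _), vec_eq_iff]
  have h2 := beq_iff_eq.1 (List.all_eq_true.1 groupB3_check _ (code_mem g))
  rw [presents_WB3.mem_iff, ← List.elem_iff, ← List.contains, h2, Bool.and_eq_true, h1,
    List.contains, List.elem_iff, presents_listB3.mem_iff]
  refine and_congr_right fun _ => ⟨?_, fun h p hp => h _ ⟨p, hp, rfl⟩⟩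
  rintro h _ ⟨p, hp, rfl⟩
  exact h p hp

theorem span_listB3 : Submodule.span ℝ (vecs listB3) = ⊤ := by
  refine Submodule.eq_top_iff'.2 fun v => ?_
  have h : ∀ p ∈ listB3, vec p ∈ Submodule.span ℝ (vecs listB3) := fun p hp =>
    Submodule.subset_span ⟨p, hp, rfl⟩
  have hv : v = ((v 3 - v 2 - v 1 + v 0) / 2) • vec (0, 5) +
      ((v 3 - v 2 - v 1 - v 0) / 2) • vec (4, 5) + (v 3 - v 2) • vec (1, 6) + v 3 • vec (2, 3) := by
    ext i
    fin_cases i <;> simp [vec_apply, vecCoord, ptCoord] <;> ring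
  rw [hv]
  exact add_mem (add_mem (add_mem (Submodule.smul_mem _ _ (h _ (by decide)))
    (Submodule.smul_mem _ _ (h _ (by decide)))) (Submodule.smul_mem _ _ (h _ (by decide))))
    (Submodule.smul_mem _ _ (h _ (by decide)))

theorem JB3_eq : JB3 = {vec (1, 6), vec (2, 3), pt 5} := by
  rw [JB3, rt_0100, rt_0001, rt_1000, rt_1211]
  congr 3
  ext i
  fin_cases i <;> simp [vec_apply, vecCoord, pt_apply, ptCoord] <;> norm_num

theorem isExtendedSubsystem_B3 : IsExtendedSubsystem Φ π ⊤ JB3 WB3 := by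
  have h := isExtendedSubsystem_delete (K := vecs listB3) ?_ ?_
  · have hin : ∀ v : V4, flip v = v → v 0 = 0 := fun v hv => by
      have h1 := congrArg (fun u : V4 => u 0) hv
      rw [flip_apply] at h1
      simp only [Matrix.cons_val] at h1
      linarith
    have h05 : ∀ v : V4, flip v = v → ⟪vec (0, 5) - pt 5, v⟫ = 0 := fun v hv => by
      simp [PiLp.inner_apply, Fin.sum_univ_four, vec_apply, vecCoord, pt_apply, ptCoord, hin v hv]
    have h45 : ∀ v : V4, flip v = v → ⟪vec (4, 5) - pt 5, v⟫ = 0 := fun v hv => by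
      simp [PiLp.inner_apply, Fin.sum_univ_four, vec_apply, vecCoord, pt_apply, ptCoord, hin v hv]
    rw [JB3_eq]
    refine isExtendedSubsystem_fold h span_listB3 flip ?_ ?_ ?_ ?_ ?_ ?_ mem_WB3_iff
    · rintro _ ⟨p, hp, rfl⟩
      have h1 : ∀ p ∈ listB3, (p.1 < 8 ∧ p.2 < 8) ∧ actPair flipCode p ∈ listB3 := by decide
      rw [flip_vec (h1 p hp).1]
      exact ⟨_, (h1 p hp).2, rfl⟩
    · rintro a (rfl | rfl | rfl) b (rfl | rfl | rfl) hab
      all_goals first | exact absurd rfl hab | skip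
      all_goals
        simp [PiLp.inner_apply, Fin.sum_univ_four, vec_apply, vecCoord, pt_apply, ptCoord]
    · rintro a (rfl | rfl | rfl) h
      · have := congrArg (fun u : V4 => u 1) h
        simp [vec_apply, vecCoord, ptCoord] at this
      · have := congrArg (fun u : V4 => u 2) h
        simp [vec_apply, vecCoord, ptCoord] at this
      · have := congrArg (fun u : V4 => u 1) h
        simp [pt_apply, ptCoord] at this
    · rintro s (rfl | rfl | rfl)
      · exact flip_vec (by decide)
      · exact flip_vec (by decide)
      · exact hasCode_flip 5 (by decide)
    · rintro _ ⟨p, hp, rfl⟩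
      simp only [listB3, List.mem_cons, List.not_mem_nil, or_false] at hp
      rcases hp with rfl | rfl | rfl | rfl
      · exact ⟨pt 5, by simp, h05⟩
      · exact ⟨pt 5, by simp, h45⟩
      · exact ⟨_, .inl rfl, fun v _ => by rw [sub_self, inner_zero_left]⟩
      · exact ⟨_, .inr (.inl rfl), fun v _ => by rw [sub_self, inner_zero_left]⟩
    · rintro s (rfl | rfl | rfl)
      · exact ⟨_, ⟨(1, 6), by decide, rfl⟩, fun v _ => by rw [sub_self, inner_zero_left]⟩
      · exact ⟨_, ⟨(2, 3), by decide, rfl⟩, fun v _ => by rw [sub_self, inner_zero_left]⟩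
      · exact ⟨_, ⟨(0, 5), by decide, rfl⟩, h05⟩
  · rintro _ ⟨p, hp, rfl⟩
    have : ∀ p ∈ listB3, p ∈ extendedRoots := by decide
    exact ⟨p, this p hp, rfl⟩
  · intro h
    obtain ⟨p, hp, hpe⟩ := h ⟨(2, 7), by decide, rfl⟩
    rw [vec_eq_iff] at hpe
    have : ∀ p ∈ listB3, ¬ ∀ i, vecCoord (2, 7) i = vecCoord p i := by decide
    exact this p hp hpe

end B3

section Deletion

/-- Every element listed by `h` which agrees with the reflection in a root of `L'` on all roots of
`L` is that reflection. -/
def agreeCheck (h : List ℕ) (L L' : List (ℕ × ℕ)) : Bool := L'.all fun a =>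
  h.contains (reflCode a) && h.all fun x => x == reflCode a ||
    L.any fun p => (List.finRange 4).any fun i =>
      vecCoord (actPair x p) i != vecCoord (actPair (reflCode a) p) i

theorem closure_agree_eq_WJ {G : Subgroup W} {J : Set V4} {h : List ℕ} (hG : Presents G h)
    {L L' : List (ℕ × ℕ)} (hL : ∀ p ∈ L, (p.1 < 8 ∧ p.2 < 8) ∧ vec p ∈ Submodule.span ℝ J)
    (hL' : ∀ p ∈ L', p ∈ roots) (hc : agreeCheck h L L' = true) :
    Subgroup.closure {g : W | g ∈ G ∧ ∃ α ∈ vecs L', ∀ v ∈ Submodule.span ℝ J,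
      (g : V4 ≃ₗᵢ[ℝ] V4) v = refl α v} = WJ (vecs L') := by
  simp only [agreeCheck, List.all_eq_true, Bool.and_eq_true, Bool.or_eq_true, beq_iff_eq,
    List.any_eq_true, bne_iff_ne, List.contains, List.elem_iff] at hc
  rw [WJ, reflSubgroup]
  congr 1
  ext g
  constructor
  · rintro ⟨hg, _, ⟨a, ha, rfl⟩, hga⟩
    refine ⟨vec a, ⟨a, ha, rfl⟩, ?_⟩
    rcases (hc a ha).2 _ ((hG.mem_iff g).1 hg) with h1 | ⟨p, hp, i, -, hi⟩
    · rw [← code_reflW (hL' a ha)] at h1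
      rw [code_injective h1]; rfl
    · exfalso
      have h2 := hga _ (hL p hp).2
      have h3 : refl (vec a) (vec p) = vec (actPair (reflCode a) p) := by
        rw [← code_reflW (hL' a ha), ← apply_vec _ (hL p hp).1]; rfl
      rw [apply_vec g (hL p hp).1, h3, vec_eq_iff] at h2
      exact hi (h2 i)
  · rintro ⟨_, ⟨a, ha, rfl⟩, hga⟩
    refine ⟨?_, vec a, ⟨a, ha, rfl⟩, fun v _ => by rw [hga]⟩
    have : g = reflW a (hL' a ha) := Subtype.ext hga
    rw [this, hG.mem_iff, code_reflW]
    exact (hc a ha).1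

theorem orbit_2A1 : ((group (colL 0)).all fun x => (colL 0).all fun p =>
    dot (vecCoord (0, 3)) (vecCoord (actPair x p)) != 0 || unorderedEq (actPair x p) (1, 2) ||
      unorderedEq (actPair x p) (5, 6)) = true := by decide +kernel

theorem isExtendedSubsystem_2A1_A1 : IsExtendedSubsystem Φ J2A1 (WJ J2A1) JA1 (WJ JA1) := by
  have hJ : J2A1 = vecs (colL 0) := colJ_eq 0
  have hpres : Presents (WJ (vecs (colL 0))) (group (colL 0)) := presents_group (systemCheck_colL 0)
  have hmem : ∀ p ∈ colL 0, p = (0, 3) ∨ p = (1, 2) := by decide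
  have hlt : ∀ p ∈ colL 0, p.1 < 8 ∧ p.2 < 8 := by decide
  have hinner : ⟪vec (0, 3), vec (1, 2)⟫ = 0 := by
    rw [inner_vec, show dot (vecCoord (0, 3)) (vecCoord (1, 2)) = 0 by decide, Int.cast_zero]
  have hne : vec (1, 2) ≠ vec (0, 3) := by rw [Ne, vec_eq_iff]; decide
  rw [hJ, JA1_eq]
  have h := (IsExtendedSubsystem.base (Φ := Φ) (J₀ := vecs (colL 0))
    (G₀ := WJ (vecs (colL 0)))).delete {vec (1, 2)} ?_ ?_ (vec (1, 2)) ?_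
    (Submodule.mem_span_singleton_self _) ?_ (vecs listA1) ?_ ?_
  · convert h using 1
    refine (closure_agree_eq_WJ hpres (J := vecs (colL 0)) (L := colL 0) (fun p hp => ⟨hlt p hp,
      Submodule.subset_span ⟨p, hp, rfl⟩⟩) (by decide) (by decide +kernel)).symm
  · rintro _ rfl
    exact ⟨(1, 2), by decide, rfl⟩
  · rintro _ rfl _ ⟨⟨p, hp, rfl⟩, hp'⟩
    rcases hmem p hp with rfl | rfl
    · rw [real_inner_comm]; exact hinner
    · exact absurd rfl hp'
  · exact ⟨1, Subgroup.one_mem _, _, ⟨(1, 2), by decide, rfl⟩, rfl⟩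
  · rintro g hg _ ⟨p, hp, rfl⟩ hspan
    have h1 := List.all_eq_true.1 (List.all_eq_true.1 orbit_2A1 _ ((hpres.mem_iff g).1 hg)) p hp
    simp only [Bool.or_eq_true, bne_iff_ne] at h1
    rw [apply_vec g (hlt p hp)] at hspan ⊢
    rcases h1 with (h1 | h1) | h1
    · obtain ⟨c, hc⟩ := Submodule.mem_span_singleton.1 hspan
      have h2 : ⟪vec (0, 3), vec (actPair (code g) p)⟫ = 0 := by
        rw [← hc, real_inner_smul_right, hinner, mul_zero]
      rw [inner_vec] at h2
      exact absurd (by exact_mod_cast h2) h1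
    · rw [vec_eq_of_unorderedEq h1, sub_self]
      exact zero_mem _
    · have h2 : vec (1, 2) - vec (5, 6) = (2 : ℝ) • vec (1, 2) := by
        ext i
        fin_cases i <;> simp [vec_apply, vecCoord, ptCoord] <;> norm_num
      rw [vec_eq_of_unorderedEq h1, h2]
      exact smul_mem_span_nnreal zero_le_two (Submodule.subset_span (Set.mem_singleton _))
  · rw [listA1, vecs_singleton]
    rintro _ rfl
    exact .inr ⟨(0, 3), by decide, rfl⟩
  · rw [listA1, vecs_singleton]
    exact fun hs => hne (hs (.inr rfl))

theorem smul_add_eq_of_apply_zero {v : V4} (h0 : v 0 = 0) :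
    v = (v 3 - v 2) • vec (1, 6) + v 3 • vec (2, 3) + (v 3 - v 2 - v 1) • pt 5 := by
  ext i
  fin_cases i <;> simp [vec_apply, pt_apply, vecCoord, ptCoord, h0]

theorem mem_span_JB3 {v : V4} (h0 : v 0 = 0) : v ∈ Submodule.span ℝ JB3 := by
  rw [smul_add_eq_of_apply_zero h0, JB3_eq]
  exact add_mem (add_mem (Submodule.smul_mem _ _ (Submodule.subset_span (by simp)))
    (Submodule.smul_mem _ _ (Submodule.subset_span (by simp))))
    (Submodule.smul_mem _ _ (Submodule.subset_span (by simp)))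

theorem mem_span_nnreal_JB3 {v : V4} (h0 : v 0 = 0) (h1 : 0 ≤ v 3 - v 2) (h2 : 0 ≤ v 3)
    (h3 : 0 ≤ v 3 - v 2 - v 1) : v ∈ Submodule.span ℝ≥0 JB3 := by
  rw [smul_add_eq_of_apply_zero h0, JB3_eq]
  exact add_mem (add_mem (smul_mem_span_nnreal h1 (Submodule.subset_span (by simp)))
    (smul_mem_span_nnreal h2 (Submodule.subset_span (by simp))))
    (smul_mem_span_nnreal h3 (Submodule.subset_span (by simp)))

/-- The vector with coordinates `c` is a nonnegative combination of the simple roots of `B₃`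
when subtracted from the highest root. -/
def belowHighest (c : Fin 4 → ℤ) : Bool := c 0 == 0 && Int.ble' 0 (2 - c 3 + c 2) &&
  Int.ble' 0 (1 - c 3) && Int.ble' 0 (2 - c 3 + c 2 + c 1)

theorem sub_mem_of_belowHighest {v : V4} {c : Fin 4 → ℤ} (hv : ∀ i, v i = c i)
    (h : belowHighest c = true) : vec (3, 6) - v ∈ Submodule.span ℝ≥0 JB3 := by
  simp only [belowHighest, Bool.and_eq_true, beq_iff_eq, Int.ble'_eq_true] at h
  obtain ⟨⟨⟨h0, h1⟩, h2⟩, h3⟩ := h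
  have h1' : (0 : ℝ) ≤ 2 - c 3 + c 2 := by exact_mod_cast h1
  have h2' : (0 : ℝ) ≤ 1 - c 3 := by exact_mod_cast h2
  have h3' : (0 : ℝ) ≤ 2 - c 3 + c 2 + c 1 := by exact_mod_cast h3
  have ha : ∀ i, vecCoord (3, 6) i = ![0, 0, -1, 1] i := by decide
  refine mem_span_nnreal_JB3 ?_ ?_ ?_ ?_ <;>
    simp only [PiLp.sub_apply, hv, vec_apply, ha, h0, Matrix.cons_val] <;> push_cast <;> linarith

theorem orbit_B3 : (groupB3.all fun x => belowHighest (vecCoord (actPair x (1, 6))) &&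
    belowHighest (vecCoord (actPair x (2, 3))) && belowHighest (ptCoord (act x 5))) = true := by
  decide +kernel

theorem isExtendedSubsystem_B3_A3 : IsExtendedSubsystem Φ JB3 WB3 JA3' (WJ JA3') := by
  rw [JA3'_eq]
  have hneg : -vec (3, 6) = vec (2, 7) := by
    ext i
    fin_cases i <;> simp [vec_apply, vecCoord, ptCoord]
  have h := (IsExtendedSubsystem.base (Φ := Φ) (J₀ := JB3) (G₀ := WB3)).delete JB3 subset_rfl
    (by simp) (vec (3, 6)) ?_ ?_ ?_ (vecs listA3') ?_ ?_
  · convert h using 1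
    refine (closure_agree_eq_WJ presents_WB3 (J := JB3) (L := listA3') (fun p hp => ?_) (by decide)
      (by decide +kernel)).symm
    have h1 : ∀ p ∈ listA3', (p.1 < 8 ∧ p.2 < 8) ∧ vecCoord p 0 = 0 := by decide
    refine ⟨(h1 p hp).1, mem_span_JB3 ?_⟩
    rw [vec_apply, (h1 p hp).2, Int.cast_zero]
  · have : (groupB3.any fun x => unorderedEq (actPair x (2, 3)) (3, 6)) = true := by decide +kernel
    obtain ⟨x, hx, hxe⟩ := List.any_eq_true.1 this
    obtain ⟨g, rfl⟩ := exists_eq_code (presents_WB3.subset x hx)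
    refine ⟨g, (presents_WB3.mem_iff g).2 hx, vec (2, 3), by rw [JB3_eq]; simp, ?_⟩
    rw [apply_vec g (by decide), vec_eq_of_unorderedEq hxe]
  · exact mem_span_JB3 (by simp [vec_apply, vecCoord, ptCoord])
  · intro g hg j hj _
    have h1 := List.all_eq_true.1 orbit_B3 _ ((presents_WB3.mem_iff g).1 hg)
    simp only [Bool.and_eq_true] at h1
    rw [JB3_eq] at hj
    rcases hj with rfl | rfl | rfl
    · rw [apply_vec g (by decide)]
      exact sub_mem_of_belowHighest (vec_apply _) h1.1.1
    · rw [apply_vec g (by decide)]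
      exact sub_mem_of_belowHighest (vec_apply _) h1.1.2
    · rw [hasCode_code g 5 (by decide)]
      exact sub_mem_of_belowHighest (pt_apply _) h1.2
  · rw [hneg, JB3_eq, listA3', vecs_cons, vecs_cons, vecs_singleton]
    rintro _ (rfl | rfl | rfl) <;> simp
  · intro hs
    obtain ⟨p, hp, hpe⟩ := hs (.inr (by rw [JB3_eq]; simp : pt 5 ∈ JB3))
    have h1 : ∀ p ∈ listA3', ¬ ∀ i, ptCoord 5 i = vecCoord p i := by decide
    refine h1 p hp fun i => ?_
    have := congrArg (fun v : V4 => v i) hpe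
    simp only [pt_apply, vec_apply] at this
    exact_mod_cast this

end Deletion

end WeylSpecht

end

open WeylSpecht in
theorem mainTheorem4 (K : Type*) [Field K] [CharZero K] :
    -- the listed elements represent the conjugacy classes of `W(D₄)`
    (∀ g : W, ∃! j : Fin 13, IsConj (classRep j) g) ∧
    -- the eleven pairs of subsystems
    (∀ r : Fin 11,
      IsExtendedSubsystem Φ π ⊤ (rowJ r) (WJ (rowJ r)) ∧
      IsExtendedSubsystem Φ π ⊤ (colJ r) (WJ (colJ r)) ∧
      IsGoodSystem K Φ π (rowJ r) (colJ r) ∧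
      IsGoodDual K Φ π (WJ (rowJ r)) (WJ (colJ r)) ∧
      Affords (S K (WJ (rowJ r)) (WJ (colJ r))).toRepresentation (rowChar r)) ∧
    -- the pair `A₃`, `2A₁` in detail: tabloids, polytabloids, a basis, the action of `τ₂`
    (let t : W → MonoidAlgebra K (W ⧸ WJ JA3) := fun w => tabloid w
     let ρ : Representation K W (MonoidAlgebra K (W ⧸ WJ JA3)) := tabloidRep K (WJ JA3)
     let e : MonoidAlgebra K (W ⧸ WJ JA3) := polytabloid K (sign Φ π) (WJ JA3) (WJ J2A1)
     Function.Bijective (fun i : Fin 8 =>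
        ((![1, τ₄, τ₂ * τ₄, τ₁ * τ₂ * τ₄, τ₃ * τ₂ * τ₄, τ₁ * τ₃ * τ₂ * τ₄,
          τ₂ * τ₁ * τ₃ * τ₂ * τ₄, τ₄ * τ₂ * τ₁ * τ₃ * τ₂ * τ₄] i : W) : W ⧸ WJ JA3)) ∧
      e = t 1 - t (τ₁ * τ₂ * τ₄) - t (τ₃ * τ₂ * τ₄) + t (τ₄ * τ₂ * τ₁ * τ₃ * τ₂ * τ₄) ∧
      ρ τ₄ e = t τ₄ - t (τ₁ * τ₂ * τ₄) - t (τ₃ * τ₂ * τ₄) + t (τ₂ * τ₁ * τ₃ * τ₂ * τ₄) ∧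
      ρ (τ₂ * τ₄) e =
        t (τ₂ * τ₄) - t (τ₁ * τ₂ * τ₄) - t (τ₃ * τ₂ * τ₄) + t (τ₁ * τ₃ * τ₂ * τ₄) ∧
      LinearIndependent K ![e, ρ τ₄ e, ρ (τ₂ * τ₄) e] ∧
      (S K (WJ JA3) (WJ J2A1)).toSubmodule = Submodule.span K {e, ρ τ₄ e, ρ (τ₂ * τ₄) e} ∧
      ρ τ₂ e = e ∧ ρ τ₂ (ρ τ₄ e) = ρ (τ₂ * τ₄) e ∧ ρ τ₂ (ρ (τ₂ * τ₄) e) = ρ τ₄ e) ∧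
    -- `χ₁₂` from the Steinberg subgroup `W(G₂)`
    (IsExtendedSubsystem Φ π ⊤ JG2 WG2 ∧
      IsExtendedSubsystem Φ π ⊤ JA2 (WJ JA2) ∧
      IsGoodDual K Φ π WG2 (WJ JA2) ∧
      Affords (S K WG2 (WJ JA2)).toRepresentation 12) ∧
    -- `χ₁₁` as a quotient
    (IsExtendedSubsystem Φ π ⊤ JA1 (WJ JA1) ∧
      IsExtendedSubsystem Φ J2A1 (WJ J2A1) JA1 (WJ JA1) ∧
      IsGoodDual K Φ π (WJ JA3) (WJ J2A1) ∧
      IsUsefulDual Φ π (WJ JA3) (WJ JA1) ∧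
      S K (WJ JA3) (WJ J2A1) ≤ S K (WJ JA3) (WJ JA1) ∧
      Affords (subquotient (S K (WJ JA3) (WJ JA1)) (S K (WJ JA3) (WJ J2A1))) 11) ∧
    -- `χ₁₀` as a quotient, from the Steinberg subgroup `W(B₃)`
    (IsExtendedSubsystem Φ π ⊤ JA1' (WJ JA1') ∧
      IsExtendedSubsystem Φ π ⊤ JA3' (WJ JA3') ∧
      IsExtendedSubsystem Φ π ⊤ JB3 WB3 ∧
      IsExtendedSubsystem Φ JB3 WB3 JA3' (WJ JA3') ∧
      IsUsefulDual Φ π (WJ JA1') (WJ JA3') ∧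
      IsGoodDual K Φ π (WJ JA1') WB3 ∧
      S K (WJ JA1') WB3 ≤ S K (WJ JA1') (WJ JA3') ∧
      Affords (subquotient (S K (WJ JA1') (WJ JA3')) (S K (WJ JA1') WB3)) 10) ∧
    -- the list is complete
    (∀ (M : Type*) [AddCommGroup M] [Module K M] (ρ : Representation K W M),
      ρ.IsIrreducible →
      (∃! n : ℕ, Affords ρ n) ∧
      ((∃ r : Fin 11,
          Nonempty (ρ.Equiv (S K (WJ (rowJ r)) (WJ (colJ r))).toRepresentation)) ∨
        Nonempty (ρ.Equiv (S K WG2 (WJ JA2)).toRepresentation) ∨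
        Nonempty (ρ.Equiv (subquotient (S K (WJ JA3) (WJ JA1)) (S K (WJ JA3) (WJ J2A1)))) ∨
        Nonempty (ρ.Equiv
          (subquotient (S K (WJ JA1') (WJ JA3')) (S K (WJ JA1') WB3))))) := by
  refine ⟨existsUnique_isConj, fun r => ⟨isExtendedSubsystem_rowJ r, isExtendedSubsystem_colJ r,
    isGoodSystem_pair K r, isGoodDual_pair K r, ?_⟩, ?_,
    ⟨isExtendedSubsystem_G2, isExtendedSubsystem_JA2, isGoodDual_G2 K ⟨_, isExtendedSubsystem_G2⟩,
      (generatesRow_G2 K).affords⟩,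
    ⟨isExtendedSubsystem_JA1, isExtendedSubsystem_2A1_A1, isGoodDual_pair K 0, isUsefulDual_A3,
      cyclic_le_of_eq_add (polytabloid_A3 K), ?_⟩,
    ⟨isExtendedSubsystem_JA1', isExtendedSubsystem_JA3', isExtendedSubsystem_B3,
      isExtendedSubsystem_B3_A3, isUsefulDual_A1, isGoodDual_A1 K ⟨_, isExtendedSubsystem_B3⟩,
      cyclic_le_of_eq_add (polytabloid_A1 K), ?_⟩,
    fun M _ _ ρ _ => exists_equiv_of_isIrreducible K ρ⟩
  · rw [← rowNumber_add_one r]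
    exact (generatesRow_pair K r).affords
  · obtain ⟨h0, h1, h2, h3⟩ := image_tabloidElem K
    have hb := bijective_tabloidElem
    have hli := linearIndependent_images K
    have hsp := specht_A3_eq_span K
    have hfun : (fun i : Fin 3 => tabloidRep K (WJ JA3) (tabloidElem (i.castLE (by norm_num)))
        (polytabloid K (sign Φ π) (WJ JA3) (WJ J2A1))) =
        ![polytabloid K (sign Φ π) (WJ JA3) (WJ J2A1),
          tabloidRep K (WJ JA3) τ₄ (polytabloid K (sign Φ π) (WJ JA3) (WJ J2A1)),
          tabloidRep K (WJ JA3) (τ₂ * τ₄) (polytabloid K (sign Φ π) (WJ JA3) (WJ J2A1))] := by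
      funext i
      rw [tabloidElem_eq]
      fin_cases i <;> simp
    rw [hfun] at hli hsp
    rw [tabloidElem_eq] at h0 h1 h2 hb
    refine ⟨hb, h0, h1, h2, hli, ?_, h3, ?_, ?_⟩
    · rw [hsp]
      congr 1
      simp only [Matrix.range_cons, Matrix.range_empty, Set.union_empty, Set.singleton_union]
    · rw [map_mul]; rfl
    · rw [map_mul, Module.End.mul_apply, ← Module.End.mul_apply, ← map_mul, τ₂_mul_self, map_one,
        Module.End.one_apply]
  · obtain ⟨φ⟩ := subquotient_A3 K
    exact affords_of_equiv φ (generatesRow_A3 K).affords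
  · obtain ⟨φ⟩ := subquotient_A1 K
    exact affords_of_equiv φ (generatesRow_A1 K).affords
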